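/- Let $V$ be a handlebody of genus $g\ge 0$ with boundary surface $S=\partial V$, and let $\alpha_1,\dots,\alpha_g\subset S$ be oriented curves bounding pairwise disjoint properly embedded discs in $V$ which cut $V$ into a ball. Let $\beta_1,\dots,\beta_g$ be closed curves in $S$ whose algebraic intersection numbers with the $\alpha_i$ are $\sigma(\alpha_i,\beta_j)=\delta_{ij}$, and let $a_i=[\alpha_i]$, $b_j=[\beta_j]$ be the resulting basis $(a_1,\dots,a_g,b_1,\dots,b_g)$ of $H_1(S;\mathbb{Q})$. Let $B$ be an integral $g\times g$ matrix such that $$M=\begin{pmatrix}\mathrm{Id}&B\\0&\mathrm{Id}\end{pmatrix}$$ is symplectic, i.e. $M^tJM=J$ with $J=\begin{pmatrix}0&\mathrm{Id}\\-\mathrm{Id}&0\end{pmatrix}$. Then there is a mapping class $\varphi$ of $S$ (an isotopy class of orientation-preserving homeomorphisms) which extends to $V$, which acts on $H_1(S;\mathbb{Q})$ by the matrix $M$ with respect to this basis, and which acts trivially (i.e. as the trivial outer automorphism) on $\pi_1(V)$. -/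

import Mathlib

noncomputable section

namespace Handlebody

/-! ### Singular homology with rational coefficients, and the class of a closed curve -/

section Homology

open CategoryTheory AlgebraicTopology Simplicial

/-- `H₁(X; ℚ)`, the first singular homology group of `X`. -/
abbrev H1 (X : Type) [TopologicalSpace X] : ModuleCat.{0} ℚ :=
  ((singularHomologyFunctor (ModuleCat.{0} ℚ) 1).obj (ModuleCat.of ℚ ℚ)).obj (TopCat.of X)

/-- The linear map `f_* : H₁(X; ℚ) → H₁(Y; ℚ)` induced by a continuous map. -/
def H1map {X Y : Type} [TopologicalSpace X] [TopologicalSpace Y] (f : C(X, Y)) :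
    H1 X →ₗ[ℚ] H1 Y :=
  (((singularHomologyFunctor (ModuleCat.{0} ℚ) 1).obj (ModuleCat.of ℚ ℚ)).map
    (TopCat.ofHom f)).hom

theorem H1map_id {X : Type} [TopologicalSpace X] :
    H1map (ContinuousMap.id X) = LinearMap.id := by
  unfold H1map
  rw [TopCat.ofHom_id, CategoryTheory.Functor.map_id]
  rfl

theorem H1map_comp {X Y Z : Type} [TopologicalSpace X] [TopologicalSpace Y] [TopologicalSpace Z]
    (f : C(X, Y)) (g : C(Y, Z)) : H1map (g.comp f) = H1map g ∘ₗ H1map f := by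
  unfold H1map
  rw [TopCat.ofHom_comp, CategoryTheory.Functor.map_comp]
  rfl

theorem H1map_homotopic {X Y : Type} [TopologicalSpace X] [TopologicalSpace Y] {f g : C(X, Y)}
    (H : f.Homotopic g) : H1map f = H1map g := by
  obtain ⟨H⟩ := H
  have := TopCat.Homotopy.congr_homologyMap_singularChainComplexFunctor
    (f := TopCat.ofHom f) (g := TopCat.ofHom g) H (ModuleCat.of ℚ ℚ) 1
  exact congrArg ModuleCat.Hom.hom this

/-- The singular 1-simplex `t ↦ γ t`, `t ∈ [0, 1]`, of a closed curve `γ : ℝ/ℤ → X`; here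
`t` is the second barycentric coordinate. -/
def loopSimplex {X : Type} [TopologicalSpace X] (γ : C(UnitAddCircle, X)) :
    (TopCat.toSSet.obj (TopCat.of X)) _⦋1⦌ :=
  ((TopCat.of X).toSSetObjEquiv (.op ⦋1⦌)).symm
    ⟨fun t => γ ((t.1 1 : ℝ) : UnitAddCircle), by
      exact γ.continuous.comp ((AddCircle.continuous_mk' 1).comp
        ((continuous_apply 1).comp continuous_subtype_val))⟩

theorem loopSimplex_faces {X : Type} [TopologicalSpace X] (γ : C(UnitAddCircle, X)) :
    (TopCat.toSSet.obj (TopCat.of X)).δ 0 (loopSimplex γ) =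
      (TopCat.toSSet.obj (TopCat.of X)).δ 1 (loopSimplex γ) := by
  apply ((TopCat.of X).toSSetObjEquiv (.op ⦋0⦌)).injective
  have key : ∀ i : Fin 2, ∀ t : stdSimplex ℝ (Fin 1),
      (TopCat.of X).toSSetObjEquiv (.op ⦋0⦌)
        ((TopCat.toSSet.obj (TopCat.of X)).δ i (loopSimplex γ)) t =
      γ (((stdSimplex.map (S := ℝ) (i.succAbove : Fin 1 → Fin 2) t).1 1 : ℝ) : UnitAddCircle) := by
    intro i t
    rfl
  ext t
  erw [key 0 t, key 1 t]
  have ht : t = stdSimplex.vertex 0 := Subsingleton.elim _ _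
  rw [ht, stdSimplex.map_vertex, stdSimplex.map_vertex]
  simpa using congrArg γ (AddCircle.coe_period (1 : ℝ))

theorem loopSimplex_boundary {X : Type} [TopologicalSpace X] (γ : C(UnitAddCircle, X)) :
    (TopCat.toSSet.obj (TopCat.of X)).ιChainComplex (R := ModuleCat.of ℚ ℚ) (loopSimplex γ) ≫
      ((TopCat.toSSet.obj (TopCat.of X)).chainComplex (ModuleCat.of ℚ ℚ)).d 1 0 = 0 := by
  rw [SSet.ιChainComplex_d, Fin.sum_univ_two, loopSimplex_faces]
  simp

/-- The homology class `[γ] ∈ H₁(X; ℚ)` of a closed curve `γ : ℝ/ℤ → X`: the class of the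
singular cycle `t ↦ γ t`. -/
def loopClass {X : Type} [TopologicalSpace X] (γ : C(UnitAddCircle, X)) : H1 X :=
  (HomologicalComplex.liftCycles
      ((TopCat.toSSet.obj (TopCat.of X)).chainComplex (ModuleCat.of ℚ ℚ))
      ((TopCat.toSSet.obj (TopCat.of X)).ιChainComplex (loopSimplex γ)) 0 (by simp)
      (loopSimplex_boundary γ) ≫
    HomologicalComplex.homologyπ
      ((TopCat.toSSet.obj (TopCat.of X)).chainComplex (ModuleCat.of ℚ ℚ)) 1).hom (1 : ℚ)

end Homology

/-! ### The mapping class group of a surface -/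

/-- The closed unit disc. -/
abbrev Disc : Type := Metric.closedBall (0 : ℂ) 1

/-- Two embedded closed discs are isotopic if they are joined by a continuous path of
embeddings. -/
def DiscIsotopic {S : Type} [TopologicalSpace S] (d d' : C(Disc, S)) : Prop :=
  ∃ H : C(unitInterval × Disc, S),
    (∀ t, Topology.IsEmbedding fun z => H (t, z)) ∧ (∀ z, H (0, z) = d z) ∧ ∀ z, H (1, z) = d' z

theorem DiscIsotopic.trans {S : Type} [TopologicalSpace S] {a b c : C(Disc, S)}
    (hab : DiscIsotopic a b) (hbc : DiscIsotopic b c) : DiscIsotopic a c := by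
  obtain ⟨H, hH, hH0, hH1⟩ := hab
  obtain ⟨K, hK, hK0, hK1⟩ := hbc
  let h1 : ContinuousMap.Homotopy a b := ⟨H, hH0, hH1⟩
  let h2 : ContinuousMap.Homotopy b c := ⟨K, hK0, hK1⟩
  refine ⟨(h1.trans h2).toContinuousMap, fun t => ?_, (h1.trans h2).map_zero_left,
    (h1.trans h2).map_one_left⟩
  by_cases ht : (t : ℝ) ≤ 1 / 2
  · have : (fun z => (h1.trans h2).toContinuousMap (t, z)) =
        fun z => H (⟨2 * t, (unitInterval.mul_pos_mem_iff zero_lt_two).2 ⟨t.2.1, ht⟩⟩, z) := by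
      funext z
      exact (ContinuousMap.Homotopy.trans_apply h1 h2 (t, z)).trans (dif_pos ht)
    rw [this]
    exact hH _
  · have : (fun z => (h1.trans h2).toContinuousMap (t, z)) =
        fun z => K (⟨2 * t - 1, unitInterval.two_mul_sub_one_mem_iff.2
          ⟨(not_le.1 ht).le, t.2.2⟩⟩, z) := by
      funext z
      exact (ContinuousMap.Homotopy.trans_apply h1 h2 (t, z)).trans (dif_neg ht)
    rw [this]
    exact hK _

theorem DiscIsotopic.symm {S : Type} [TopologicalSpace S] {a b : C(Disc, S)}
    (hab : DiscIsotopic a b) : DiscIsotopic b a := by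
  obtain ⟨H, hH, hH0, hH1⟩ := hab
  refine ⟨⟨fun p => H (unitInterval.symm p.1, p.2), by fun_prop⟩, fun t => hH (unitInterval.symm t),
    fun z => ?_, fun z => ?_⟩
  · simpa using hH1 z
  · simpa using hH0 z

theorem DiscIsotopic.refl {S : Type} [TopologicalSpace S] {a : C(Disc, S)}
    (ha : Topology.IsEmbedding a) : DiscIsotopic a a :=
  ⟨⟨fun p => a p.2, by fun_prop⟩, fun _ => ha, fun _ => rfl, fun _ => rfl⟩

/-- The orientation-preserving homeomorphisms of a connected orientable surface `S`: those `f`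
which carry every embedded closed disc to an isotopic embedded disc. (Two embeddings of a closed
disc in `S` are isotopic exactly when they induce the same orientation of `S`.) -/
def homeoPlus (S : Type) [TopologicalSpace S] : Subgroup (S ≃ₜ S) where
  carrier := {f | ∀ d : C(Disc, S), Topology.IsEmbedding d →
    DiscIsotopic d ((f : C(S, S)).comp d)}
  mul_mem' := by
    intro f g hf hg d hd
    exact (hg d hd).trans (hf ((g : C(S, S)).comp d) (g.isEmbedding.comp hd))
  one_mem' := fun d hd => DiscIsotopic.refl hd
  inv_mem' := by
    intro f hf d hd
    have h1 := hf ((f.symm : C(S, S)).comp d) (f.symm.isEmbedding.comp hd)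
    have h2 : (f : C(S, S)).comp ((f.symm : C(S, S)).comp d) = d := by
      ext z
      exact f.apply_symm_apply _
    rw [h2] at h1
    exact h1.symm

/-- The homeomorphisms isotopic to the identity; an isotopy is a level-preserving
homeomorphism of `[0, 1] × S`. -/
def isotopicToId (S : Type) [TopologicalSpace S] : Subgroup (homeoPlus S) where
  carrier := {f | ∃ H : (unitInterval × S) ≃ₜ (unitInterval × S),
    (∀ p, (H p).1 = p.1) ∧ (∀ x, H (0, x) = (0, x)) ∧ ∀ x, H (1, x) = (1, f.1 x)}
  mul_mem' := by
    rintro f g ⟨H, hH, hH0, hH1⟩ ⟨K, hK, hK0, hK1⟩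
    exact ⟨K.trans H, fun p => by simp [hH, hK], fun x => by simp [hH0, hK0],
      fun x => by simp [hH1, hK1]⟩
  one_mem' := ⟨Homeomorph.refl _, fun _ => rfl, fun _ => rfl, fun _ => rfl⟩
  inv_mem' := by
    rintro f ⟨H, hH, hH0, hH1⟩
    refine ⟨H.symm, fun p => ?_, fun x => ?_, fun x => ?_⟩
    · have := hH (H.symm p)
      rw [H.apply_symm_apply] at this
      exact this.symm
    · rw [H.symm_apply_eq, hH0]
    · rw [H.symm_apply_eq, hH1]
      simp

instance isotopicToId_normal (S : Type) [TopologicalSpace S] : (isotopicToId S).Normal where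
  conj_mem := by
    rintro f ⟨H, hH, hH0, hH1⟩ k
    let K : (unitInterval × S) ≃ₜ (unitInterval × S) := (Homeomorph.refl _).prodCongr k.1
    refine ⟨(K.symm.trans H).trans K, fun p => ?_, fun x => ?_, fun x => ?_⟩
    · simp [K, hH]
    · simp [K, hH0]
    · simp [K, hH1]

/-- The mapping class group `Mcg(S)`: orientation-preserving homeomorphisms modulo isotopy. -/
abbrev Mcg (S : Type) [TopologicalSpace S] : Type := homeoPlus S ⧸ isotopicToId S

/-- The action of mapping classes on `H₁(S; ℚ)`, `[f] ↦ f_*`. -/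
def homologyAction (S : Type) [TopologicalSpace S] : Mcg S →* Module.End ℚ (H1 S) :=
  QuotientGroup.lift (isotopicToId S)
    { toFun := fun f => H1map (f.1 : C(S, S))
      map_one' := H1map_id
      map_mul' := fun f g => H1map_comp (g.1 : C(S, S)) (f.1 : C(S, S)) }
    (by
      rintro f ⟨H, -, hH0, hH1⟩
      have : (ContinuousMap.id S).Homotopic (f.1 : C(S, S)) :=
        ⟨⟨⟨fun p => (H p).2, by fun_prop⟩, fun x => by simp [hH0], fun x => by simp [hH1]⟩⟩
      exact (H1map_homotopic this).symm.trans H1map_id)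

/-! ### Handlebodies -/

/-- The standard handlebody of genus `g` in `ℝ³`: the product `P × [0, 1]`, where `P` is the
rectangle `[0, 2g + 1] × [0, 3]` with the `g` open squares `(2i + 1, 2i + 2) × (1, 2)`,
`0 ≤ i < g`, removed. -/
def model (g : ℕ) : Set (ℝ × ℝ × ℝ) :=
  {p | p.1 ∈ Set.Icc (0 : ℝ) (2 * g + 1) ∧ p.2.1 ∈ Set.Icc (0 : ℝ) 3 ∧
    p.2.2 ∈ Set.Icc (0 : ℝ) 1 ∧
    ∀ i : Fin g, ¬ (p.1 ∈ Set.Ioo (2 * (i : ℝ) + 1) (2 * i + 2) ∧ p.2.1 ∈ Set.Ioo (1 : ℝ) 2)}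

/-- The boundary surface `∂V` of a handlebody `V`, identified with the standard one by `h`. -/
abbrev Boundary {g : ℕ} {V : Type} [TopologicalSpace V] (h : model g ≃ₜ V) : Type :=
  {v : V // (h.symm v : ℝ × ℝ × ℝ) ∈ frontier (model g)}

/-- The positive number `max |cos 2πθ| |sin 2πθ|`. -/
def supRadius (θ : UnitAddCircle) : ℝ :=
  max |(AddCircle.toCircle θ : ℂ).re| |(AddCircle.toCircle θ : ℂ).im|

theorem supRadius_pos (θ : UnitAddCircle) : 0 < supRadius θ := by
  unfold supRadius
  by_contra hc
  have h1 := (le_max_left _ _).trans (not_lt.1 hc)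
  have h2 := (le_max_right _ _).trans (not_lt.1 hc)
  have e1 := abs_nonpos_iff.1 h1
  have e2 := abs_nonpos_iff.1 h2
  have : (AddCircle.toCircle θ : ℂ) = 0 := Complex.ext e1 e2
  exact Circle.coe_ne_zero _ this

/-- The boundary of the unit square `[0, 1]²` as a simple closed curve, traversed
counterclockwise: the radial projection of the circle onto the square. -/
def squareLoop (θ : UnitAddCircle) : ℝ × ℝ :=
  (1 / 2 + (AddCircle.toCircle θ : ℂ).re / (2 * supRadius θ),
    1 / 2 + (AddCircle.toCircle θ : ℂ).im / (2 * supRadius θ))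

theorem continuous_squareLoop : Continuous squareLoop := by
  have h0 : Continuous fun θ : UnitAddCircle => (AddCircle.toCircle θ : ℂ) :=
    continuous_subtype_val.comp AddCircle.continuous_toCircle
  have hr : Continuous supRadius := by
    unfold supRadius
    fun_prop
  have hne : ∀ θ, 2 * supRadius θ ≠ 0 := fun θ => by
    have := supRadius_pos θ
    positivity
  unfold squareLoop
  refine Continuous.prodMk ?_ ?_
  · exact continuous_const.add ((Complex.continuous_re.comp h0).div (continuous_const.mul hr) hne)
  · exact continuous_const.add ((Complex.continuous_im.comp h0).div (continuous_const.mul hr) hne)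

theorem squareLoop_mem (θ : UnitAddCircle) :
    ((squareLoop θ).1 ∈ Set.Icc (0 : ℝ) 1 ∧ (squareLoop θ).2 ∈ Set.Icc (0 : ℝ) 1) ∧
      ((squareLoop θ).1 = 0 ∨ (squareLoop θ).1 = 1 ∨
        (squareLoop θ).2 = 0 ∨ (squareLoop θ).2 = 1) := by
  have hr := supRadius_pos θ
  have h1 : |(AddCircle.toCircle θ : ℂ).re| ≤ supRadius θ := le_max_left _ _
  have h2 : |(AddCircle.toCircle θ : ℂ).im| ≤ supRadius θ := le_max_right _ _
  have h3 : supRadius θ = |(AddCircle.toCircle θ : ℂ).re| ∨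
      supRadius θ = |(AddCircle.toCircle θ : ℂ).im| := max_choice _ _
  simp only [squareLoop]
  generalize supRadius θ = r at *
  have bound : ∀ a : ℝ, |a| ≤ r → 1 / 2 + a / (2 * r) ∈ Set.Icc (0 : ℝ) 1 := by
    intro a ha
    have hb : |a / (2 * r)| ≤ 1 / 2 := by
      rw [abs_div, abs_of_pos (by positivity : (0 : ℝ) < 2 * r), div_le_iff₀ (by positivity)]
      linarith
    have := abs_le.1 hb
    constructor <;> linarith
  have ends : ∀ a : ℝ, r = |a| → 1 / 2 + a / (2 * r) = 0 ∨ 1 / 2 + a / (2 * r) = 1 := by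
    intro a ha
    rcases abs_choice a with h | h
    · right
      rw [h] at ha
      subst ha
      field_simp
      norm_num
    · left
      rw [h] at ha
      have : a = -r := by linarith
      subst this
      field_simp
      norm_num
  refine ⟨⟨bound _ h1, bound _ h2⟩, ?_⟩
  rcases h3 with h | h
  · rcases ends _ h with h | h
    · exact Or.inl h
    · exact Or.inr (Or.inl h)
  · rcases ends _ h with h | h
    · exact Or.inr (Or.inr (Or.inl h))
    · exact Or.inr (Or.inr (Or.inr h))

/-- The points of the standard annulus around the `i`-th meridian of the standard handlebody. -/
def collarPoint (i : ℕ) (q : UnitAddCircle × Set.Icc (-1 : ℝ) 1) : ℝ × ℝ × ℝ :=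
  (2 * i + 3 / 2 + q.2 / 2, squareLoop q.1)

theorem continuous_collarPoint (i : ℕ) : Continuous (collarPoint i) := by
  have := continuous_squareLoop
  unfold collarPoint
  fun_prop

theorem collarPoint_mem {g : ℕ} (i : Fin g) (q : UnitAddCircle × Set.Icc (-1 : ℝ) 1) :
    collarPoint i q ∈ model g := by
  obtain ⟨θ, u, hu1, hu2⟩ := q
  obtain ⟨⟨⟨hy0, hy1⟩, hz⟩, -⟩ := squareLoop_mem θ
  have hi : ((i : ℕ) : ℝ) + 1 ≤ g := by exact_mod_cast i.2
  have hi0 : (0 : ℝ) ≤ (i : ℕ) := Nat.cast_nonneg _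
  refine ⟨⟨?_, ?_⟩, ⟨hy0, ?_⟩, hz, ?_⟩
  · simp only [collarPoint]
    linarith
  · simp only [collarPoint]
    linarith
  · simp only [collarPoint]
    linarith
  · rintro j ⟨-, hy, -⟩
    simp only [collarPoint] at hy
    linarith

theorem collarPoint_mem_frontier {g : ℕ} (i : Fin g)
    (q : UnitAddCircle × Set.Icc (-1 : ℝ) 1) : collarPoint i q ∈ frontier (model g) := by
  refine ⟨subset_closure (collarPoint_mem i q), fun hint => ?_⟩
  obtain ⟨ε, hε, hball⟩ := Metric.mem_nhds_iff.1 (mem_interior_iff_mem_nhds.1 hint)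
  obtain ⟨δ, hδ0, hδε, hδ1⟩ : ∃ δ : ℝ, 0 < δ ∧ δ < ε ∧ δ < 1 :=
    ⟨min ε 1 / 2, by positivity, by have := min_le_left ε 1; linarith,
      by have := min_le_right ε 1; linarith⟩
  obtain ⟨θ, u, hu1, hu2⟩ := q
  obtain ⟨⟨⟨hy0, hy1⟩, hz0, hz1⟩, hside⟩ := squareLoop_mem θ
  have key : ∀ dx dy dz : ℝ, |dx| ≤ δ → |dy| ≤ δ → |dz| ≤ δ →
      ((2 * (i : ℝ) + 3 / 2 + u / 2 + dx, (squareLoop θ).1 + dy, (squareLoop θ).2 + dz) :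
        ℝ × ℝ × ℝ) ∈ model g := by
    intro dx dy dz hx hy hz
    apply hball
    rw [Metric.mem_ball, Prod.dist_eq, Prod.dist_eq]
    simp only [collarPoint, Real.dist_eq, add_sub_cancel_left]
    exact (max_le hx (max_le hy hz)).trans_lt hδε
  have hd : |δ| ≤ δ := (abs_of_pos hδ0).le
  have hd' : |-δ| ≤ δ := by rw [abs_neg]; exact hd
  have h0 : |(0 : ℝ)| ≤ δ := by rw [abs_zero]; exact hδ0.le
  rcases hside with h | h | h | h
  · have := (key 0 (-δ) 0 h0 hd' h0).2.1.1
    simp only [h] at this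
    linarith
  · have hx : |-(δ * u / 2)| ≤ δ := by
      rw [abs_le]
      constructor <;> nlinarith
    refine (key (-(δ * u / 2)) δ 0 hx hd h0).2.2.2 i ⟨⟨?_, ?_⟩, ?_, ?_⟩
    · nlinarith
    · nlinarith
    · simp only [h]
      linarith
    · simp only [h]
      linarith
  · have := (key 0 0 (-δ) h0 h0 hd').2.2.1.1
    simp only [h] at this
    linarith
  · have := (key 0 0 δ h0 h0 hd).2.2.1.2
    simp only [h] at this
    linarith

/-- The `i`-th meridian annulus `S¹ × [-1, 1] → ∂V`. In the standard handlebody it is the part of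
the boundary of the box `[2i + 1, 2i + 2] × [0, 1] × [0, 1]` (which lies between the `i`-th
hole and the outer boundary) where the last two coordinates run around the unit square, and its
second parameter is the direction of the first coordinate. The annuli are translates of one
another, so they induce the same orientation of `∂V`; this is the orientation used for
intersection numbers. -/
def meridianAnnulus {g : ℕ} {V : Type} [TopologicalSpace V] (h : model g ≃ₜ V) (i : Fin g) :
    C(UnitAddCircle × Set.Icc (-1 : ℝ) 1, Boundary h) where
  toFun q := ⟨h ⟨collarPoint i q, collarPoint_mem i q⟩, by
    rw [h.symm_apply_apply]
    exact collarPoint_mem_frontier i q⟩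
  continuous_toFun :=
    (h.continuous.comp ((continuous_collarPoint i).subtype_mk _)).subtype_mk _

/-- The core curve `θ ↦ κ (θ, 0)` of an annulus. -/
def core {S : Type} [TopologicalSpace S] (κ : C(UnitAddCircle × Set.Icc (-1 : ℝ) 1, S)) :
    C(UnitAddCircle, S) :=
  ⟨fun θ => κ (θ, ⟨0, by norm_num⟩), by fun_prop⟩

/-- The `i`-th meridian curve `αᵢ`. In the standard handlebody it bounds the disc
`{2i + 3/2} × [0, 1] × [0, 1]`, and the `g` discs obtained in this way cut `P × [0, 1]` into a
ball. -/
def meridian {g : ℕ} {V : Type} [TopologicalSpace V] (h : model g ≃ₜ V) (i : Fin g) :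
    C(UnitAddCircle, Boundary h) :=
  core (meridianAnnulus h i)

/-! ### Algebraic intersection numbers -/

/-- The side `{κ (θ, u) | u < 0}` of the core of an annulus. -/
def negSide {S : Type} [TopologicalSpace S] (κ : C(UnitAddCircle × Set.Icc (-1 : ℝ) 1, S)) :
    Set S :=
  κ '' {q | (q.2 : ℝ) < 0}

/-- The side `{κ (θ, u) | 0 < u}` of the core of an annulus. -/
def posSide {S : Type} [TopologicalSpace S] (κ : C(UnitAddCircle × Set.Icc (-1 : ℝ) 1, S)) :
    Set S :=
  κ '' {q | 0 < (q.2 : ℝ)}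

/-- At time `t`, the closed curve `β` passes from the set `A` to the set `A'`. -/
def PassesAt {S : Type} [TopologicalSpace S] (β : C(UnitAddCircle, S)) (A A' : Set S) (t : ℝ) :
    Prop :=
  (∀ᶠ s : ℝ in nhdsWithin t (Set.Iio t), β (s : UnitAddCircle) ∈ A) ∧
    ∀ᶠ s : ℝ in nhdsWithin t (Set.Ioi t), β (s : UnitAddCircle) ∈ A'

/-- The closed curve `β` meets the core `α` of the embedded annulus `κ` in finitely many points,
crosses `α` at each of them, and the algebraic intersection number of `α` with `β` is `n`:
a crossing counts `1` if `β` passes from `u < 0` to `u > 0` (that is, if `α` and `β` cross in the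
orientation of the surface given by the coordinates `(θ, u)`), and `-1` in the other case. -/
def HasIntersectionNumber {S : Type} [TopologicalSpace S]
    (κ : C(UnitAddCircle × Set.Icc (-1 : ℝ) 1, S)) (β : C(UnitAddCircle, S)) (n : ℤ) : Prop :=
  ∃ P N : Finset ℝ,
    (∀ t : ℝ, t ∈ P ∪ N ↔
      t ∈ Set.Ico (0 : ℝ) 1 ∧ β (t : UnitAddCircle) ∈ Set.range (core κ)) ∧
    (∀ t ∈ P, PassesAt β (negSide κ) (posSide κ) t) ∧
    (∀ t ∈ N, PassesAt β (posSide κ) (negSide κ) t) ∧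
    n = (P.card : ℤ) - N.card

/-! ### The handlebody group -/

/-- The homeomorphism `F` of the handlebody extends the homeomorphism `f` of its boundary. -/
def Extends {g : ℕ} {V : Type} [TopologicalSpace V] (h : model g ≃ₜ V) (F : V ≃ₜ V)
    (f : Boundary h ≃ₜ Boundary h) : Prop :=
  ∀ s : Boundary h, F s.1 = (f s).1

/-- The handlebody group: the mapping classes of `∂V` which extend to `V`. -/
def handlebodyGroup {g : ℕ} {V : Type} [TopologicalSpace V] (h : model g ≃ₜ V) :
    Subgroup (Mcg (Boundary h)) :=
  Subgroup.map (QuotientGroup.mk' (isotopicToId (Boundary h)))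
    { carrier := {f | ∃ F : V ≃ₜ V, Extends h F f.1}
      mul_mem' := by
        rintro f f' ⟨F, hF⟩ ⟨F', hF'⟩
        exact ⟨F'.trans F, fun s => (congrArg F (hF' s)).trans (hF (f'.1 s))⟩
      one_mem' := ⟨Homeomorph.refl V, fun _ => rfl⟩
      inv_mem' := by
        rintro f ⟨F, hF⟩
        refine ⟨F.symm, fun s => ?_⟩
        rw [F.symm_apply_eq]
        have := hF (f.1.symm s)
        rw [f.1.apply_symm_apply] at this
        exact this.symm }

/-- The homeomorphism `F` acts trivially on the fundamental group of `V`, that is, as an inner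
automorphism: for every base point `x`, the map `F_* : π₁(V, x) → π₁(V, F x)` is the change of
base point isomorphism along some path from `x` to `F x`. -/
def ActsTriviallyOnPi1 {V : Type} [TopologicalSpace V] (F : V ≃ₜ V) : Prop :=
  ∀ x : V, ∃ p : Path x (F x), ∀ γ : FundamentalGroup V x,
    FundamentalGroup.map (F : C(V, V)) x γ = FundamentalGroup.fundamentalGroupMulEquivOfPath p γ

/-- The mapping class `φ` of `∂V` acts trivially on the fundamental group of `V`: it is
represented by a homeomorphism with an extension to `V` that acts trivially on `π₁(V)`. -/
def ClassActsTriviallyOnPi1 {g : ℕ} {V : Type} [TopologicalSpace V] (h : model g ≃ₜ V)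
    (φ : Mcg (Boundary h)) : Prop :=
  ∃ (f : homeoPlus (Boundary h)) (F : V ≃ₜ V),
    QuotientGroup.mk' (isotopicToId (Boundary h)) f = φ ∧ Extends h F f.1 ∧ ActsTriviallyOnPi1 F

end Handlebody

end

/-!
The mapping class is a product of twists of the standard handlebody `P × [0, 1]`, which is the
product of a planar domain `P` with an interval. A strip in `P` that joins two boundary components
of `P` gives a family of parallel discs in the handlebody, namely the squares over the arcs that run
along the strip. The twist along the strip (`Strip.twist`) rotates the square at the width `w` by
the angle `ramp w`, which grows from `0` to a full turn. Straight lines in the squares give a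
homotopy from the twist to the identity (`Strip.twist_homotopic`), so the twist acts trivially on
the fundamental group (`actsTriviallyOnPi1_of_homotopic`). On the boundary surface it is a Dehn
twist along the boundary curve of a disc. It preserves the orientation, since every embedded disc
is isotopic to one that lies in the part of the surface fixed by the twist
(`Strip.surfaceTwist_mem_homeoPlus`).

On homology a twist adds to a class a multiple of the class of the boundary of the disc. For the
straight strip from the outer boundary of `P` to the `i`-th hole (`boxStrip`) this curve is the
meridian `αᵢ`, and the twist realizes the matrix `B = E_ii`. For a strip between the holes `i` and
`j` (`tentStrip`) the curve is homologous to `±(αᵢ - αⱼ)`, and the twist realizes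
`B = -(eᵢ - eⱼ)(eᵢ - eⱼ)ᵗ`. These matrices generate the group of symmetric integral matrices
(`realizable_of_isSymm`), and `B` is symmetric because the block matrix is symplectic.

Homology classes are detected by maps to the circle. A map from a space to the circle induces a
linear form on the first homology group, whose value on a closed curve is the degree of the composed
map (`cocycle_loopClass`). The map `discMap` collapses the complement of the family of discs over a
strip. For the straight strips its linear form counts intersections with a meridian, which is how
the hypothesis on the intersection numbers enters (`discClass_of_hasIntersectionNumber`). The map
`wallMap` collapses the complement of the wall of a hole, and its linear form takes the value `1` on
the meridian of this hole and `0` on the other meridians. The `2g` linear forms separate the points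
of the homology of the boundary (`eq_of_discClass_eq_of_wallClass_eq`). A homeomorphism of the
handlebody that is homotopic to the identity preserves the first kind of linear form, and the effect
of a twist on the second kind is computed in `exists_wallMap_twist`.
-/

noncomputable section

namespace Handlebody

/-! ### Lifts to the universal cover of the circle -/

section Lifts

theorem exists_circle_lift {A : Type} [TopologicalSpace A] [ContractibleSpace A]
    (φ : C(A, UnitAddCircle)) : ∃ L : C(A, ℝ), ∀ a, ((L a : ℝ) : UnitAddCircle) = φ a := by
  obtain ⟨a₀, ⟨H⟩⟩ := id_nullhomotopic A
  obtain ⟨x₀, hx₀⟩ := QuotientAddGroup.mk_surjective (φ a₀)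
  have cov : IsCoveringMap ((↑) : ℝ → UnitAddCircle) := AddCircle.isCoveringMap_coe 1
  let K : C(unitInterval × A, UnitAddCircle) := ⟨fun p => φ (H.symm p), by fun_prop⟩
  have hK : ∀ a, K (0, a) = ((ContinuousMap.const A x₀ a : ℝ) : UnitAddCircle) := fun a =>
    (congrArg φ (H.symm.apply_zero a)).trans hx₀.symm
  refine ⟨⟨fun a => cov.liftHomotopy K (ContinuousMap.const A x₀) hK (1, a), by fun_prop⟩,
    fun a => ?_⟩
  have h1 := congrFun (cov.liftHomotopy_lifts K (ContinuousMap.const A x₀) hK) (1, a)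
  refine h1.trans ?_
  exact congrArg φ (H.symm.apply_one a)

/-- Two lifts of the same map on a connected set have the same increments. -/
theorem lift_sub_eq {A : Type} [TopologicalSpace A] {s : Set A} (hs : IsPreconnected s)
    {L L' : A → ℝ} (hL : ContinuousOn L s) (hL' : ContinuousOn L' s)
    (h : ∀ a ∈ s, ((L a : ℝ) : UnitAddCircle) = (L' a : ℝ)) {a b : A} (ha : a ∈ s) (hb : b ∈ s) :
    L b - L a = L' b - L' a := by
  have hD : ContinuousOn (fun x => L x - L' x) s := hL.sub hL'
  have hint : ∀ x ∈ s, ∃ n : ℤ, (n : ℝ) = L x - L' x := fun x hx => by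
    have h0 : ((L x - L' x : ℝ) : UnitAddCircle) = 0 := by
      rw [AddCircle.coe_sub, h x hx, sub_self]
    obtain ⟨n, hn⟩ := (AddCircle.coe_eq_zero_iff (1 : ℝ)).1 h0
    exact ⟨n, by simpa using hn⟩
  have hpre := (hs.image _ hD)
  have hsub : ((fun x => L x - L' x) '' s) ⊆ Set.range ((↑) : ℤ → ℝ) := by
    rintro _ ⟨x, hx, rfl⟩
    exact hint x hx
  have htd : IsTotallyDisconnected (Set.range ((↑) : ℤ → ℝ)) :=
    (Set.countable_range _).isTotallyDisconnected
  have := htd _ hsub hpre (Set.mem_image_of_mem _ ha) (Set.mem_image_of_mem _ hb)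
  have h2 : L a - L' a = L b - L' b := this
  linarith

end Lifts

/-! ### The winding number as a functional on homology -/

section Winding

open CategoryTheory AlgebraicTopology Simplicial

instance (n : ℕ) : ContractibleSpace (stdSimplex ℝ (Fin (n + 1))) :=
  (convex_stdSimplex ℝ (Fin (n + 1))).contractibleSpace ⟨_, single_mem_stdSimplex ℝ 0⟩

/-- A lift to `ℝ` of a map from a contractible space to the circle. -/
def circleLift {A : Type} [TopologicalSpace A] [ContractibleSpace A]
    (φ : C(A, UnitAddCircle)) : C(A, ℝ) := (exists_circle_lift φ).choose

theorem circleLift_coe {A : Type} [TopologicalSpace A] [ContractibleSpace A]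
    (φ : C(A, UnitAddCircle)) (a : A) : ((circleLift φ a : ℝ) : UnitAddCircle) = φ a :=
  (exists_circle_lift φ).choose_spec a

/-- The underlying map of a singular simplex of the circle. -/
def circleSimplex {n : ℕ} (σ : (TopCat.toSSet.obj (TopCat.of UnitAddCircle)) _⦋n⦌) :
    C(stdSimplex ℝ (Fin (n + 1)), UnitAddCircle) :=
  (TopCat.of UnitAddCircle).toSSetObjEquiv (.op ⦋n⦌) σ

/-- The increment of a lift to `ℝ` along a singular 1-simplex of the circle. -/
def increment (σ : (TopCat.toSSet.obj (TopCat.of UnitAddCircle)) _⦋1⦌) : ℝ :=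
  circleLift (circleSimplex σ) (stdSimplex.vertex 1) -
    circleLift (circleSimplex σ) (stdSimplex.vertex 0)

theorem increment_eq (σ : (TopCat.toSSet.obj (TopCat.of UnitAddCircle)) _⦋1⦌)
    (L : C(stdSimplex ℝ (Fin 2), ℝ))
    (hL : ∀ t, ((L t : ℝ) : UnitAddCircle) = circleSimplex σ t) :
    increment σ = L (stdSimplex.vertex 1) - L (stdSimplex.vertex 0) :=
  lift_sub_eq isPreconnected_univ (circleLift (circleSimplex σ)).continuous.continuousOn
    L.continuous.continuousOn (fun a _ => (circleLift_coe _ a).trans (hL a).symm) trivial trivial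

/-- The increments along the faces of a 2-simplex add up to zero. -/
theorem increment_cocycle (τ : (TopCat.toSSet.obj (TopCat.of UnitAddCircle)) _⦋2⦌) :
    increment ((TopCat.toSSet.obj (TopCat.of UnitAddCircle)).δ 0 τ) -
      increment ((TopCat.toSSet.obj (TopCat.of UnitAddCircle)).δ 1 τ) +
      increment ((TopCat.toSSet.obj (TopCat.of UnitAddCircle)).δ 2 τ) = 0 := by
  let L := circleLift (circleSimplex τ)
  have key : ∀ i : Fin 3, increment ((TopCat.toSSet.obj (TopCat.of UnitAddCircle)).δ i τ) =
      L (stdSimplex.vertex (i.succAbove 1)) - L (stdSimplex.vertex (i.succAbove 0)) := by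
    intro i
    let L' : C(stdSimplex ℝ (Fin 2), ℝ) :=
      ⟨fun t => L (stdSimplex.map (S := ℝ) i.succAbove t),
        L.continuous.comp (stdSimplex.continuous_map _)⟩
    have h1 : ∀ t, ((L' t : ℝ) : UnitAddCircle) =
        circleSimplex ((TopCat.toSSet.obj (TopCat.of UnitAddCircle)).δ i τ) t := fun t =>
      circleLift_coe (circleSimplex τ) _
    rw [increment_eq _ L' h1]
    simp only [L', ContinuousMap.coe_mk, stdSimplex.map_vertex]
  rw [key, key, key]
  simp only [show (0 : Fin 3).succAbove (1 : Fin 2) = 2 from rfl,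
    show (0 : Fin 3).succAbove (0 : Fin 2) = 1 from rfl,
    show (1 : Fin 3).succAbove (1 : Fin 2) = 2 from rfl,
    show (1 : Fin 3).succAbove (0 : Fin 2) = 0 from rfl,
    show (2 : Fin 3).succAbove (1 : Fin 2) = 1 from rfl,
    show (2 : Fin 3).succAbove (0 : Fin 2) = 0 from rfl]
  ring

/-- The singular 1-cochain of the circle given by the increments of lifts. -/
def windingCochain : ((TopCat.toSSet.obj (TopCat.of UnitAddCircle)).chainComplex
    (ModuleCat.of ℚ ℚ)).X 1 ⟶ ModuleCat.of ℚ ℝ :=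
  Limits.Sigma.desc fun σ => ModuleCat.ofHom (LinearMap.toSpanSingleton ℚ ℝ (increment σ))

theorem ι_windingCochain (σ : (TopCat.toSSet.obj (TopCat.of UnitAddCircle)) _⦋1⦌) :
    (TopCat.toSSet.obj (TopCat.of UnitAddCircle)).ιChainComplex (R := ModuleCat.of ℚ ℚ) σ ≫
      windingCochain = ModuleCat.ofHom (LinearMap.toSpanSingleton ℚ ℝ (increment σ)) :=
  Limits.Sigma.ι_desc _ _

theorem windingCochain_boundary :
    ((TopCat.toSSet.obj (TopCat.of UnitAddCircle)).chainComplex (ModuleCat.of ℚ ℚ)).d 2 1 ≫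
      windingCochain = 0 := by
  apply SSet.chainComplex_hom_ext
  intro τ
  rw [SSet.ιChainComplex_d_assoc, Preadditive.sum_comp, Fin.sum_univ_three]
  simp only [Preadditive.zsmul_comp, ι_windingCochain]
  rw [Limits.comp_zero]
  have := increment_cocycle τ
  ext
  simp
  linarith

/-- The winding number functional `H₁(ℝ/ℤ; ℚ) → ℝ`. -/
def winding : H1 UnitAddCircle →ₗ[ℚ] ℝ :=
  (HomologicalComplex.homologyι
      ((TopCat.toSSet.obj (TopCat.of UnitAddCircle)).chainComplex (ModuleCat.of ℚ ℚ)) 1 ≫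
    HomologicalComplex.descOpcycles _ windingCochain 2 (by simp) windingCochain_boundary).hom

/-- The degree of a closed curve in the circle. -/
def deg (ψ : C(UnitAddCircle, UnitAddCircle)) : ℝ := winding (loopClass ψ)

theorem deg_eq_increment (ψ : C(UnitAddCircle, UnitAddCircle)) :
    deg ψ = increment (loopSimplex ψ) := by
  have : (HomologicalComplex.liftCycles
      ((TopCat.toSSet.obj (TopCat.of UnitAddCircle)).chainComplex (ModuleCat.of ℚ ℚ))
      ((TopCat.toSSet.obj (TopCat.of UnitAddCircle)).ιChainComplex (loopSimplex ψ)) 0 (by simp)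
      (loopSimplex_boundary ψ) ≫
    HomologicalComplex.homologyπ
      ((TopCat.toSSet.obj (TopCat.of UnitAddCircle)).chainComplex (ModuleCat.of ℚ ℚ)) 1) ≫
    (HomologicalComplex.homologyι
      ((TopCat.toSSet.obj (TopCat.of UnitAddCircle)).chainComplex (ModuleCat.of ℚ ℚ)) 1 ≫
    HomologicalComplex.descOpcycles _ windingCochain 2 (by simp) windingCochain_boundary) =
    ModuleCat.ofHom (LinearMap.toSpanSingleton ℚ ℝ (increment (loopSimplex ψ))) := by
    rw [Category.assoc, HomologicalComplex.homology_π_ι_assoc,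
      HomologicalComplex.p_descOpcycles, HomologicalComplex.liftCycles_i_assoc]
    exact ι_windingCochain _
  exact (congrArg (fun m => m.hom (1 : ℚ)) this).trans (one_smul ℚ _)

/-- The degree is the increment of any lift over one period. -/
theorem deg_eq (ψ : C(UnitAddCircle, UnitAddCircle)) (L : ℝ → ℝ)
    (hL : ContinuousOn L (Set.Icc 0 1))
    (h : ∀ t ∈ Set.Icc (0 : ℝ) 1, ((L t : ℝ) : UnitAddCircle) = ψ (t : UnitAddCircle)) :
    deg ψ = L 1 - L 0 := by
  have hmem : ∀ t : stdSimplex ℝ (Fin 2), (t.1 1 : ℝ) ∈ Set.Icc (0 : ℝ) 1 := fun t =>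
    ⟨t.2.1 1, stdSimplex.le_one t 1⟩
  let L' : C(stdSimplex ℝ (Fin 2), ℝ) := ⟨fun t => L (t.1 1), by
    exact hL.comp_continuous ((continuous_apply 1).comp continuous_subtype_val) hmem⟩
  rw [deg_eq_increment, increment_eq (loopSimplex ψ) L' (fun t => h _ (hmem t))]
  change L ((stdSimplex.vertex (S := ℝ) (1 : Fin 2)).1 1) -
    L ((stdSimplex.vertex (S := ℝ) (0 : Fin 2)).1 1) = _
  congr 2

theorem H1map_loopClass {X Y : Type} [TopologicalSpace X] [TopologicalSpace Y] (f : C(X, Y))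
    (γ : C(UnitAddCircle, X)) : H1map f (loopClass γ) = loopClass (f.comp γ) := by
  let φ := SSet.chainComplexMap (TopCat.toSSet.map (TopCat.ofHom f)) (ModuleCat.of ℚ ℚ)
  have : (HomologicalComplex.liftCycles
      ((TopCat.toSSet.obj (TopCat.of X)).chainComplex (ModuleCat.of ℚ ℚ))
      ((TopCat.toSSet.obj (TopCat.of X)).ιChainComplex (loopSimplex γ)) 0 (by simp)
      (loopSimplex_boundary γ) ≫ HomologicalComplex.homologyπ _ 1) ≫
      HomologicalComplex.homologyMap φ 1 =
    HomologicalComplex.liftCycles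
      ((TopCat.toSSet.obj (TopCat.of Y)).chainComplex (ModuleCat.of ℚ ℚ))
      ((TopCat.toSSet.obj (TopCat.of Y)).ιChainComplex (loopSimplex (f.comp γ))) 0 (by simp)
      (loopSimplex_boundary (f.comp γ)) ≫ HomologicalComplex.homologyπ _ 1 := by
    rw [Category.assoc, HomologicalComplex.homologyπ_naturality, ← Category.assoc]
    congr 1
    rw [← cancel_mono (HomologicalComplex.iCycles _ 1), Category.assoc,
      HomologicalComplex.cyclesMap_i, HomologicalComplex.liftCycles_i_assoc,
      HomologicalComplex.liftCycles_i, SSet.ι_chainComplexMap_f]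
    rfl
  exact congrArg (fun m => m.hom (1 : ℚ)) this

/-- The functional on `H₁(X; ℚ)` given by a map from `X` to the circle. -/
def cocycle {X : Type} [TopologicalSpace X] (q : C(X, UnitAddCircle)) : H1 X →ₗ[ℚ] ℝ :=
  winding ∘ₗ H1map q

theorem cocycle_loopClass {X : Type} [TopologicalSpace X] (q : C(X, UnitAddCircle))
    (γ : C(UnitAddCircle, X)) : cocycle q (loopClass γ) = deg (q.comp γ) := by
  unfold cocycle deg
  rw [LinearMap.comp_apply, H1map_loopClass]

end Winding

/-! ### Degrees of closed curves in the circle -/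

section Degree

open Filter Topology

/-- Every closed curve in the circle has a lift to `ℝ`, which grows by the degree over a period. -/
theorem exists_lift_deg (ψ : C(UnitAddCircle, UnitAddCircle)) :
    ∃ L : C(ℝ, ℝ), (∀ t, ((L t : ℝ) : UnitAddCircle) = ψ (t : UnitAddCircle)) ∧
      ∀ t, L (t + 1) = L t + deg ψ := by
  obtain ⟨L, hL⟩ := exists_circle_lift (A := ℝ)
    (ψ.comp ⟨fun t : ℝ => (t : UnitAddCircle), AddCircle.continuous_mk' 1⟩)
  replace hL : ∀ t, ((L t : ℝ) : UnitAddCircle) = ψ (t : UnitAddCircle) := hL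
  refine ⟨L, hL, fun t => ?_⟩
  have h1 := deg_eq ψ L L.continuous.continuousOn fun t _ => hL t
  have h2 := lift_sub_eq (s := Set.univ) isPreconnected_univ (L := fun t => L (t + 1)) (L' := L)
    (by fun_prop) (by fun_prop) (fun a _ => by rw [hL, hL, AddCircle.coe_add_period])
    (Set.mem_univ 0) (Set.mem_univ t)
  rw [zero_add] at h2
  linarith

theorem deg_add (ψ ψ' : C(UnitAddCircle, UnitAddCircle)) : deg (ψ + ψ') = deg ψ + deg ψ' := by
  obtain ⟨L, hL, -⟩ := exists_lift_deg ψ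
  obtain ⟨L', hL', -⟩ := exists_lift_deg ψ'
  rw [deg_eq ψ L L.continuous.continuousOn fun t _ => hL t,
    deg_eq ψ' L' L'.continuous.continuousOn fun t _ => hL' t,
    deg_eq (ψ + ψ') (fun t => L t + L' t) (by fun_prop) fun t _ => by
      rw [AddCircle.coe_add, hL, hL']; rfl]
  ring

/-- A closed curve in the circle which lifts to a closed curve in `ℝ` has degree zero. -/
theorem deg_eq_zero_of_real (ψ : C(UnitAddCircle, UnitAddCircle)) (G : C(UnitAddCircle, ℝ))
    (h : ∀ θ, ((G θ : ℝ) : UnitAddCircle) = ψ θ) : deg ψ = 0 := by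
  rw [deg_eq ψ (fun t => G (t : UnitAddCircle))
    (G.continuous.comp (AddCircle.continuous_mk' 1)).continuousOn fun t _ => h _]
  rw [show ((1 : ℝ) : UnitAddCircle) = ((0 : ℝ) : UnitAddCircle) by
    simp, sub_self]

theorem deg_zero : deg 0 = 0 := deg_eq_zero_of_real 0 0 fun _ => rfl

theorem deg_neg (ψ : C(UnitAddCircle, UnitAddCircle)) : deg (-ψ) = -deg ψ := by
  have h := deg_add ψ (-ψ)
  rw [add_neg_cancel, deg_zero] at h
  linarith

theorem deg_sub (ψ ψ' : C(UnitAddCircle, UnitAddCircle)) : deg (ψ - ψ') = deg ψ - deg ψ' := by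
  rw [sub_eq_add_neg, deg_add, deg_neg, sub_eq_add_neg]

/-- A closed curve of degree zero in the circle lifts to a closed curve in `ℝ`. -/
theorem exists_real_of_deg_eq_zero (ψ : C(UnitAddCircle, UnitAddCircle)) (h : deg ψ = 0) :
    ∃ G : C(UnitAddCircle, ℝ), ∀ θ, ((G θ : ℝ) : UnitAddCircle) = ψ θ := by
  obtain ⟨L, hL, hper⟩ := exists_lift_deg ψ
  have hp : Function.Periodic L 1 := fun t => by rw [hper, h, add_zero]
  refine ⟨⟨hp.lift, ?_⟩, fun θ => ?_⟩
  · exact L.continuous.quotient_lift _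
  · obtain ⟨t, rfl⟩ := QuotientAddGroup.mk_surjective θ
    exact hL t

theorem deg_homotopic {ψ ψ' : C(UnitAddCircle, UnitAddCircle)} (H : ψ.Homotopic ψ') :
    deg ψ = deg ψ' := by
  have h : ∀ χ : C(UnitAddCircle, UnitAddCircle),
      loopClass χ = H1map χ (loopClass (ContinuousMap.id _)) := fun χ => by
    rw [H1map_loopClass, ContinuousMap.comp_id]
  rw [deg, deg, h ψ, h ψ', H1map_homotopic H]

theorem deg_id : deg (ContinuousMap.id UnitAddCircle) = 1 := by
  rw [deg_eq _ (fun t => t) continuous_id.continuousOn fun t _ => rfl, sub_zero]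

theorem deg_comp_add_const (ψ : C(UnitAddCircle, UnitAddCircle)) (τ : ℝ) :
    deg (ψ.comp ⟨fun θ => θ + (τ : UnitAddCircle), by fun_prop⟩) = deg ψ := by
  obtain ⟨L, hL, hper⟩ := exists_lift_deg ψ
  rw [deg_eq _ (fun t => L (t + τ)) (by fun_prop) fun t _ => by
    rw [hL, AddCircle.coe_add]; rfl]
  rw [zero_add, add_comm, hper]
  ring

theorem coe_half_eq_iff {x : ℝ} :
    (x : UnitAddCircle) = ((1 / 2 : ℝ) : UnitAddCircle) ↔ ∃ m : ℤ, x = m - 1 / 2 := by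
  rw [← sub_eq_zero, ← AddCircle.coe_sub, AddCircle.coe_eq_zero_iff]
  constructor
  · rintro ⟨n, hn⟩
    refine ⟨n + 1, ?_⟩
    simp at hn
    push_cast
    linarith
  · rintro ⟨m, rfl⟩
    refine ⟨m - 1, ?_⟩
    simp
    ring

/-- A real number near `m - 1 / 2` which represents a point of the first half of the circle is
smaller than `m - 1 / 2`. -/
theorem lt_of_coe_mem_image_Ico {x : ℝ} {m : ℤ} (hx : |x - (m - 1 / 2)| < 1 / 2)
    (h : (x : UnitAddCircle) ∈ ((↑) : ℝ → UnitAddCircle) '' Set.Ico 0 (1 / 2)) :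
    x < m - 1 / 2 := by
  obtain ⟨y, ⟨hy0, hy1⟩, hy⟩ := h
  rw [eq_comm, ← sub_eq_zero, ← AddCircle.coe_sub, AddCircle.coe_eq_zero_iff] at hy
  obtain ⟨n, hn⟩ := hy
  simp at hn
  rw [abs_lt] at hx
  have h1 : (n : ℝ) < m := by linarith
  have h2 : (n : ℝ) ≤ m - 1 := by exact_mod_cast Int.le_sub_one_of_lt (by exact_mod_cast h1)
  linarith

theorem lt_of_coe_mem_image_Ioc {x : ℝ} {m : ℤ} (hx : |x - (m - 1 / 2)| < 1 / 2)
    (h : (x : UnitAddCircle) ∈ ((↑) : ℝ → UnitAddCircle) '' Set.Ioc (1 / 2) 1) :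
    (m : ℝ) - 1 / 2 < x := by
  obtain ⟨y, ⟨hy0, hy1⟩, hy⟩ := h
  rw [eq_comm, ← sub_eq_zero, ← AddCircle.coe_sub, AddCircle.coe_eq_zero_iff] at hy
  obtain ⟨n, hn⟩ := hy
  simp at hn
  rw [abs_lt] at hx
  have h1 : (m : ℝ) - 2 < n := by linarith
  have h2 : (m : ℝ) - 1 ≤ n := by
    have : m - 2 < n := by exact_mod_cast h1
    exact_mod_cast (by omega : m - 1 ≤ n)
  linarith

/-- The closed curve `ψ` in the circle passes the point `1 / 2` upwards at time `t`. -/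
def CrossesUp (ψ : C(UnitAddCircle, UnitAddCircle)) (t : ℝ) : Prop :=
  PassesAt ψ (((↑) : ℝ → UnitAddCircle) '' Set.Ico 0 (1 / 2))
    (((↑) : ℝ → UnitAddCircle) '' Set.Ioc (1 / 2) 1) t

/-- The closed curve `ψ` in the circle passes the point `1 / 2` downwards at time `t`. -/
def CrossesDown (ψ : C(UnitAddCircle, UnitAddCircle)) (t : ℝ) : Prop :=
  PassesAt ψ (((↑) : ℝ → UnitAddCircle) '' Set.Ioc (1 / 2) 1)
    (((↑) : ℝ → UnitAddCircle) '' Set.Ico 0 (1 / 2)) t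

theorem floor_sub_of_near {x y : ℝ} {m : ℤ} (hy : y = m - 1 / 2) (hx : |x - y| < 1 / 2) :
    (x < y → ⌊x + 1 / 2⌋ = m - 1) ∧ (y ≤ x → ⌊x + 1 / 2⌋ = m) := by
  rw [abs_lt] at hx
  constructor <;> intro h <;> rw [Int.floor_eq_iff] <;> push_cast <;> constructor <;> linarith

/-- The number of points of a finite set up to `s` changes only at the points of the set. -/
theorem eventually_mem_iff (P : Finset ℝ) (t : ℝ) :
    ∀ᶠ s in 𝓝 t, ∀ p ∈ P, p ≠ t → ((p ≤ s ↔ p ≤ t) ∧ (p < s ↔ p < t)) := by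
  rw [Finset.eventually_all]
  intro p _
  by_cases hp : p = t
  · exact Eventually.of_forall fun s h => absurd hp h
  · rcases lt_or_gt_of_ne hp with h | h
    · filter_upwards [lt_mem_nhds h] with s hs _
      exact ⟨⟨fun _ => h.le, fun _ => hs.le⟩, ⟨fun _ => h, fun _ => hs⟩⟩
    · filter_upwards [gt_mem_nhds h] with s hs _
      exact ⟨⟨fun h' => absurd h' hs.not_ge, fun h' => absurd h' h.not_ge⟩,
        ⟨fun h' => absurd h' hs.le.not_gt, fun h' => absurd h' h.le.not_gt⟩⟩

/-- Just before `t`, the number of points of `P` passed so far misses the point `t` of `P`. -/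
theorem sum_le_indicator {P : Finset ℝ} {s t : ℝ}
    (h : ∀ p ∈ P, p ≠ t → ((p ≤ s ↔ p ≤ t) ∧ (p < s ↔ p < t))) :
    (∑ p ∈ P, if p ≤ s then (1 : ℤ) else 0) =
      (∑ p ∈ P, if p ≤ t then 1 else 0) - if s < t ∧ t ∈ P then 1 else 0 := by
  by_cases ht : t ∈ P
  · have : (∑ p ∈ P.erase t, if p ≤ s then (1 : ℤ) else 0) =
        ∑ p ∈ P.erase t, if p ≤ t then 1 else 0 := by
      refine Finset.sum_congr rfl fun p hp => ?_
      simp [(h p (Finset.mem_of_mem_erase hp) (Finset.ne_of_mem_erase hp)).1]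
    rw [← Finset.add_sum_erase _ _ ht, ← Finset.add_sum_erase P _ ht, this]
    by_cases hs : s < t
    · simp [hs, ht, hs.not_ge]
    · simp [hs, not_lt.1 hs]
  · rw [if_neg fun h' => ht h'.2, sub_zero]
    refine Finset.sum_congr rfl fun p hp => ?_
    simp [(h p hp fun e => ht (e ▸ hp)).1]

/-- Just after `t`, the number of points of `P` strictly passed includes the point `t` of `P`. -/
theorem sum_lt_indicator {P : Finset ℝ} {s t : ℝ}
    (h : ∀ p ∈ P, p ≠ t → ((p ≤ s ↔ p ≤ t) ∧ (p < s ↔ p < t))) :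
    (∑ p ∈ P, if p < s then (1 : ℤ) else 0) =
      (∑ p ∈ P, if p < t then 1 else 0) + if t < s ∧ t ∈ P then 1 else 0 := by
  by_cases ht : t ∈ P
  · have : (∑ p ∈ P.erase t, if p < s then (1 : ℤ) else 0) =
        ∑ p ∈ P.erase t, if p < t then 1 else 0 := by
      refine Finset.sum_congr rfl fun p hp => ?_
      simp [(h p (Finset.mem_of_mem_erase hp) (Finset.ne_of_mem_erase hp)).2]
    rw [← Finset.add_sum_erase _ _ ht, ← Finset.add_sum_erase P _ ht, this]
    by_cases hs : t < s
    · simp [hs, ht, add_comm]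
    · simp [hs]
  · rw [if_neg fun h' => ht h'.2, add_zero]
    refine Finset.sum_congr rfl fun p hp => ?_
    simp [(h p hp fun e => ht (e ▸ hp)).2]

/-- The degree of a closed curve in the circle counts the passages through a point. -/
theorem deg_eq_card_sub_card (ψ : C(UnitAddCircle, UnitAddCircle)) (P N : Finset ℝ)
    (hPN : ∀ t : ℝ, t ∈ P ∪ N ↔
      t ∈ Set.Ico (0 : ℝ) 1 ∧ ψ (t : UnitAddCircle) = ((1 / 2 : ℝ) : UnitAddCircle))
    (hP : ∀ t ∈ P, CrossesUp ψ t) (hN : ∀ t ∈ N, CrossesDown ψ t) :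
    deg ψ = (P.card : ℝ) - N.card := by
  obtain ⟨L, hL, hper⟩ := exists_lift_deg ψ
  -- The behaviour of the lift near a passage.
  have near : ∀ t, ∀ᶠ s in 𝓝 t, |L s - L t| < 1 / 2 := fun t =>
    (L.continuous.tendsto t).eventually (Metric.ball_mem_nhds (L t) (by norm_num))
  have hm : ∀ t ∈ P ∪ N, ∃ m : ℤ, L t = m - 1 / 2 := fun t ht =>
    coe_half_eq_iff.1 ((hL t).trans ((hPN t).1 ht).2)
  have low : ∀ t ∈ P ∪ N, ∀ s, |L s - L t| < 1 / 2 →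
      ψ (s : UnitAddCircle) ∈ ((↑) : ℝ → UnitAddCircle) '' Set.Ico 0 (1 / 2) → L s < L t := by
    intro t ht s hs h
    obtain ⟨m, hm⟩ := hm t ht
    rw [hm] at hs ⊢
    exact lt_of_coe_mem_image_Ico hs (by rwa [hL])
  have high : ∀ t ∈ P ∪ N, ∀ s, |L s - L t| < 1 / 2 →
      ψ (s : UnitAddCircle) ∈ ((↑) : ℝ → UnitAddCircle) '' Set.Ioc (1 / 2) 1 → L t < L s := by
    intro t ht s hs h
    obtain ⟨m, hm⟩ := hm t ht
    rw [hm] at hs ⊢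
    exact lt_of_coe_mem_image_Ioc hs (by rwa [hL])
  have upl : ∀ t ∈ P, ∀ᶠ s in 𝓝[<] t, L s < L t := fun t ht => by
    filter_upwards [(hP t ht).1, nhdsWithin_le_nhds (near t)] with s h1 h2
    exact low t (Finset.mem_union_left _ ht) s h2 h1
  have upr : ∀ t ∈ P, ∀ᶠ s in 𝓝[>] t, L t < L s := fun t ht => by
    filter_upwards [(hP t ht).2, nhdsWithin_le_nhds (near t)] with s h1 h2
    exact high t (Finset.mem_union_left _ ht) s h2 h1
  have downl : ∀ t ∈ N, ∀ᶠ s in 𝓝[<] t, L t < L s := fun t ht => by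
    filter_upwards [(hN t ht).1, nhdsWithin_le_nhds (near t)] with s h1 h2
    exact high t (Finset.mem_union_right _ ht) s h2 h1
  have downr : ∀ t ∈ N, ∀ᶠ s in 𝓝[>] t, L s < L t := fun t ht => by
    filter_upwards [(hN t ht).2, nhdsWithin_le_nhds (near t)] with s h1 h2
    exact low t (Finset.mem_union_right _ ht) s h2 h1
  have disj : ∀ t ∈ P, t ∉ N := fun t h1 h2 => by
    obtain ⟨s, hs1, hs2⟩ := ((upl t h1).and (downl t h2)).exists
    exact lt_asymm hs1 hs2
  -- The rounded lift minus the number of passages so far is locally constant.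
  let n : ℝ → ℤ := fun t => ⌊L t + 1 / 2⌋
  let c : ℝ → ℤ := fun t =>
    (∑ p ∈ P, if p ≤ t then 1 else 0) - ∑ p ∈ N, if p < t then 1 else 0
  obtain ⟨δ, hδ0, hδ1, hδ⟩ : ∃ δ : ℝ, 0 < δ ∧ δ ≤ 1 ∧ ∀ p ∈ P ∪ N, p < 1 - δ := by
    have h : ∀ᶠ δ in 𝓝[>] (0 : ℝ), ∀ p ∈ P ∪ N, p < 1 - δ := by
      rw [Finset.eventually_all]
      intro p hp
      have h1 := ((hPN p).1 hp).1.2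
      have : Tendsto (fun δ : ℝ => 1 - δ) (𝓝 0) (𝓝 (1 - 0)) :=
        tendsto_const_nhds.sub tendsto_id
      rw [sub_zero] at this
      exact nhdsWithin_le_nhds (this.eventually (lt_mem_nhds h1))
    obtain ⟨δ, h1, h2, h3⟩ := (h.and (Ioc_mem_nhdsGT one_pos)).exists
    exact ⟨δ, h2, h3, h1⟩
  have loc : ∀ t ∈ Set.Icc (-δ) (1 - δ), ∀ᶠ s in 𝓝 t, n s - c s = n t - c t := by
    intro t ht
    by_cases hmem : t ∈ P ∪ N
    · obtain ⟨m, hm⟩ := hm t hmem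
      have hnt : n t = m := (floor_sub_of_near hm (x := L t) (by norm_num)).2 le_rfl
      have hev := (near t).and ((eventually_mem_iff P t).and (eventually_mem_iff N t))
      have hev : ∀ᶠ s in 𝓝 t, (s < t → t ∈ P → L s < L t) ∧ (t < s → t ∈ P → L t < L s) ∧
          (s < t → t ∈ N → L t < L s) ∧ (t < s → t ∈ N → L s < L t) := by
        have key : ∀ (S : Set ℝ) (M : Finset ℝ) (p : ℝ → Prop), (t ∈ M → ∀ᶠ s in 𝓝[S] t, p s) →
            ∀ᶠ s in 𝓝 t, s ∈ S → t ∈ M → p s := by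
          intro S M p h
          by_cases ht : t ∈ M
          · filter_upwards [eventually_nhdsWithin_iff.1 (h ht)] with s hs hsS _ using hs hsS
          · exact Eventually.of_forall fun s _ h' => absurd h' ht
        exact (key _ P _ (upl t)).and ((key _ P _ (upr t)).and
          ((key _ N _ (downl t)).and (key _ N _ (downr t))))
      filter_upwards [near t, eventually_mem_iff P t, eventually_mem_iff N t, hev]
        with s h1 h2 h3 ⟨h4, h5, h6, h7⟩
      obtain ⟨hlo, hhi⟩ := floor_sub_of_near hm h1
      change ⌊L s + 1 / 2⌋ - (_ - _) = n t - (_ - _)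
      rw [sum_le_indicator h2, sum_lt_indicator h3, hnt]
      rcases lt_trichotomy s t with hs | rfl | hs
      · rcases Finset.mem_union.1 hmem with hp | hp
        · rw [hlo (h4 hs hp), if_pos ⟨hs, hp⟩, if_neg fun h => hs.not_gt h.1]
          ring
        · have hp' : t ∉ P := fun h => disj t h hp
          rw [hhi (h6 hs hp).le, if_neg fun h => hp' h.2, if_neg fun h => hs.not_gt h.1]
          ring
      · rw [hhi le_rfl, if_neg fun h => lt_irrefl _ h.1, if_neg fun h => lt_irrefl _ h.1]
        ring
      · rcases Finset.mem_union.1 hmem with hp | hp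
        · rw [hhi (h5 hs hp).le, if_neg fun h => hs.not_gt h.1, if_neg fun h => disj t hp h.2]
          ring
        · rw [hlo (h7 hs hp), if_neg fun h => hs.not_gt h.1, if_pos ⟨hs, hp⟩]
          ring
    · have hne : ∀ m : ℤ, L t ≠ m - 1 / 2 := by
        intro m hm
        have hhalf : ψ (t : UnitAddCircle) = ((1 / 2 : ℝ) : UnitAddCircle) := by
          rw [← hL, coe_half_eq_iff]
          exact ⟨m, hm⟩
        rcases le_or_gt 0 t with h0 | h0
        · exact hmem ((hPN t).2 ⟨⟨h0, by linarith [ht.2]⟩, hhalf⟩)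
        · have h1 : t + 1 ∈ P ∪ N := (hPN (t + 1)).2
            ⟨⟨by linarith [ht.1, hδ1], by linarith⟩, by rwa [AddCircle.coe_add_period]⟩
          linarith [hδ _ h1, ht.1]
      have hfl : ∀ᶠ s in 𝓝 t, n s = n t := by
        have h1 : (⌊L t + 1 / 2⌋ : ℝ) < L t + 1 / 2 :=
          lt_of_le_of_ne (Int.floor_le _) fun h => hne ⌊L t + 1 / 2⌋ (by linarith)
        have h2 := Int.lt_floor_add_one (L t + 1 / 2)
        have hc : Tendsto (fun s => L s + 1 / 2) (𝓝 t) (𝓝 (L t + 1 / 2)) :=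
          (L.continuous.add continuous_const).tendsto t
        filter_upwards [hc.eventually (lt_mem_nhds h1), hc.eventually (gt_mem_nhds h2)]
          with s h3 h4
        exact Int.floor_eq_iff.2 ⟨h3.le, h4⟩
      have hPt : t ∉ P := fun h => hmem (Finset.mem_union_left _ h)
      have hNt : t ∉ N := fun h => hmem (Finset.mem_union_right _ h)
      filter_upwards [hfl, eventually_mem_iff P t, eventually_mem_iff N t] with s h1 h2 h3
      change n s - (_ - _) = n t - (_ - _)
      rw [h1, sum_le_indicator h2, sum_lt_indicator h3]
      simp [hPt, hNt]
  have hcont : ContinuousOn (fun t => n t - c t) (Set.Icc (-δ) (1 - δ)) := fun t ht =>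
    (continuousAt_const.congr ((loc t ht).mono fun s hs => hs.symm)).continuousWithinAt
  have heq := isPreconnected_Icc.constant hcont (Set.left_mem_Icc.2 (by linarith : -δ ≤ 1 - δ))
    (Set.right_mem_Icc.2 (by linarith : -δ ≤ 1 - δ))
  -- Comparison of the two ends of the interval `[-δ, 1 - δ]`.
  have hc0 : c (-δ) = 0 := by
    have h1 : ∀ p ∈ P ∪ N, 0 ≤ p := fun p hp => ((hPN p).1 hp).1.1
    simp only [c]
    rw [Finset.sum_eq_zero, Finset.sum_eq_zero, sub_zero]
    · intro p hp
      exact if_neg (by linarith [h1 p (Finset.mem_union_right _ hp)])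
    · intro p hp
      exact if_neg (by linarith [h1 p (Finset.mem_union_left _ hp)])
  have hc1 : c (1 - δ) = P.card - N.card := by
    simp only [c]
    rw [Finset.sum_congr rfl fun p hp => if_pos (hδ p (Finset.mem_union_left _ hp)).le,
      Finset.sum_congr rfl fun p hp => if_pos (hδ p (Finset.mem_union_right _ hp))]
    simp
  have hdeg : ∃ k : ℤ, deg ψ = k := by
    have h1 : ((deg ψ : ℝ) : UnitAddCircle) = 0 := by
      have h2 := hper 0
      rw [show deg ψ = L (0 + 1) - L 0 by linarith, AddCircle.coe_sub, hL, hL,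
        AddCircle.coe_add_period, sub_self]
    obtain ⟨k, hk⟩ := (AddCircle.coe_eq_zero_iff (1 : ℝ)).1 h1
    exact ⟨k, by simpa using hk.symm⟩
  obtain ⟨k, hk⟩ := hdeg
  have hn : n (1 - δ) = n (-δ) + k := by
    have h1 := hper (-δ)
    rw [show -δ + 1 = 1 - δ by ring, hk] at h1
    simp only [n]
    rw [h1, add_right_comm, Int.floor_add_intCast]
  simp only [hc0, hc1, hn] at heq
  rw [hk]
  have : k = (P.card : ℤ) - N.card := by linarith
  rw [this]
  push_cast
  ring

end Degree

/-! ### Rotations of the square -/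

section Square

open Topology

/-- The sup norm on `ℂ = ℝ²`. -/
def supNorm (v : ℂ) : ℝ := max |v.re| |v.im|

theorem continuous_supNorm : Continuous supNorm := by
  unfold supNorm
  fun_prop

theorem supNorm_smul (r : ℝ) (v : ℂ) : supNorm ((r : ℂ) * v) = |r| * supNorm v := by
  simp [supNorm, abs_mul, mul_max_of_nonneg]

theorem supNorm_nonneg (v : ℂ) : 0 ≤ supNorm v := (abs_nonneg _).trans (le_max_left _ _)

theorem supNorm_eq_zero {v : ℂ} : supNorm v = 0 ↔ v = 0 := by
  constructor
  · intro h
    have h1 : |v.re| ≤ supNorm v := le_max_left _ _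
    have h2 : |v.im| ≤ supNorm v := le_max_right _ _
    rw [h, abs_nonpos_iff] at h1 h2
    exact Complex.ext h1 h2
  · rintro rfl
    simp [supNorm]

/-- The position of a point of the plane relative to the centre of the unit square. -/
def squareVec (q : ℝ × ℝ) : ℂ := ⟨q.1 - 1 / 2, q.2 - 1 / 2⟩

/-- The inverse of `squareVec`. -/
def squarePt (v : ℂ) : ℝ × ℝ := (1 / 2 + v.re, 1 / 2 + v.im)

theorem continuous_squareVec : Continuous squareVec :=
  (Complex.equivRealProdCLM.symm.continuous.comp
    (f := fun q : ℝ × ℝ => (q.1 - 1 / 2, q.2 - 1 / 2)) (by fun_prop))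

theorem continuous_squarePt : Continuous squarePt := by
  unfold squarePt
  fun_prop

@[simp] theorem squareVec_squarePt (v : ℂ) : squareVec (squarePt v) = v := by
  apply Complex.ext <;> simp [squareVec, squarePt]

@[simp] theorem squarePt_squareVec (q : ℝ × ℝ) : squarePt (squareVec q) = q := by
  ext <;> simp [squareVec, squarePt]

/-- The rotation by `τ` along the concentric squares: the sup norm is preserved, and the
direction is turned by the angle `τ`. -/
def turn (τ : UnitAddCircle) (v : ℂ) : ℂ :=
  ((supNorm v / supNorm (AddCircle.toCircle τ * v) : ℝ) : ℂ) * (AddCircle.toCircle τ * v)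

theorem toCircle_mul_ne_zero (τ : UnitAddCircle) {v : ℂ} (hv : v ≠ 0) :
    (AddCircle.toCircle τ : ℂ) * v ≠ 0 := mul_ne_zero (Circle.coe_ne_zero _) hv

@[simp] theorem turn_apply_zero (τ : UnitAddCircle) : turn τ 0 = 0 := by simp [turn]

theorem supNorm_turn (τ : UnitAddCircle) (v : ℂ) : supNorm (turn τ v) = supNorm v := by
  by_cases hv : v = 0
  · simp [hv]
  · have h : supNorm (AddCircle.toCircle τ * v) ≠ 0 := fun h =>
      toCircle_mul_ne_zero τ hv (supNorm_eq_zero.1 h)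
    rw [turn, supNorm_smul, abs_of_nonneg (div_nonneg (supNorm_nonneg _) (supNorm_nonneg _)),
      div_mul_cancel₀ _ h]

theorem turn_zero (v : ℂ) : turn 0 v = v := by
  by_cases hv : v = 0
  · simp [hv]
  · have h : supNorm v ≠ 0 := fun h => hv (supNorm_eq_zero.1 h)
    simp [turn, div_self h]

/-- A turn of a vector is determined by its direction and its sup norm. -/
theorem turn_smul (τ : UnitAddCircle) {r : ℝ} (hr : 0 < r) (v : ℂ) :
    turn τ ((r : ℂ) * v) = (r : ℂ) * turn τ v := by
  unfold turn
  rw [mul_left_comm _ (r : ℂ) v, supNorm_smul, supNorm_smul, abs_of_pos hr,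
    mul_div_mul_left _ _ hr.ne']
  ring

theorem turn_turn (τ τ' : UnitAddCircle) (v : ℂ) : turn τ (turn τ' v) = turn (τ + τ') v := by
  by_cases hv : v = 0
  · simp [hv]
  · have hv' := toCircle_mul_ne_zero τ' hv
    have hpos : 0 < supNorm v / supNorm (AddCircle.toCircle τ' * v) :=
      div_pos ((supNorm_nonneg _).lt_of_ne fun h => hv (supNorm_eq_zero.1 h.symm))
        ((supNorm_nonneg _).lt_of_ne fun h => hv' (supNorm_eq_zero.1 h.symm))
    have h2 : supNorm (AddCircle.toCircle τ' * v) ≠ 0 := fun h => hv' (supNorm_eq_zero.1 h)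
    rw [turn.eq_1 τ' v, turn_smul τ hpos, turn, turn, AddCircle.toCircle_add, Circle.coe_mul,
      ← mul_assoc, ← Complex.ofReal_mul, mul_assoc (AddCircle.toCircle τ : ℂ)]
    congr 2
    field_simp

theorem continuous_turn : Continuous fun p : UnitAddCircle × ℂ => turn p.1 p.2 := by
  rw [continuous_iff_continuousAt]
  rintro ⟨τ, v⟩
  have hc : Continuous fun p : UnitAddCircle × ℂ => (AddCircle.toCircle p.1 : ℂ) * p.2 :=
    (continuous_subtype_val.comp (AddCircle.continuous_toCircle.comp continuous_fst)).mul
      continuous_snd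
  by_cases hv : v = 0
  · subst hv
    rw [ContinuousAt, turn_apply_zero, tendsto_zero_iff_norm_tendsto_zero]
    have hlim : Filter.Tendsto (fun p : UnitAddCircle × ℂ => √2 * supNorm p.2) (𝓝 (τ, 0))
        (𝓝 0) := by
      have : Continuous fun p : UnitAddCircle × ℂ => √2 * supNorm p.2 :=
        continuous_const.mul (continuous_supNorm.comp continuous_snd)
      have h0 := this.tendsto (τ, 0)
      simpa [supNorm_eq_zero.2 rfl] using h0
    refine squeeze_zero (fun _ => norm_nonneg _) (fun p => ?_) hlim
    calc ‖turn p.1 p.2‖ ≤ √2 * supNorm (turn p.1 p.2) := Complex.norm_le_sqrt_two_mul_max _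
      _ = √2 * supNorm p.2 := by rw [supNorm_turn]
  · have h : supNorm (AddCircle.toCircle τ * v) ≠ 0 := fun h =>
      toCircle_mul_ne_zero τ hv (supNorm_eq_zero.1 h)
    unfold turn
    refine ContinuousAt.mul ?_ hc.continuousAt
    refine Complex.continuous_ofReal.continuousAt.comp ?_
    exact (continuous_supNorm.comp continuous_snd).continuousAt.div
      (continuous_supNorm.comp hc).continuousAt h

/-- The rotation of the unit square by the angle `τ`. -/
def squareRot (τ : UnitAddCircle) (q : ℝ × ℝ) : ℝ × ℝ := squarePt (turn τ (squareVec q))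

theorem squareRot_zero (q : ℝ × ℝ) : squareRot 0 q = q := by
  rw [squareRot, turn_zero, squarePt_squareVec]

theorem squareRot_squareRot (τ τ' : UnitAddCircle) (q : ℝ × ℝ) :
    squareRot τ (squareRot τ' q) = squareRot (τ + τ') q := by
  rw [squareRot, squareRot, squareVec_squarePt, turn_turn, squareRot]

theorem continuous_squareRot : Continuous fun p : UnitAddCircle × (ℝ × ℝ) => squareRot p.1 p.2 :=
  continuous_squarePt.comp (continuous_turn.comp
    (continuous_fst.prodMk (continuous_squareVec.comp continuous_snd)))

/-- The closed unit square. -/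
def square : Set (ℝ × ℝ) := Set.Icc 0 1 ×ˢ Set.Icc 0 1

/-- The boundary of the unit square. -/
def squareBdry : Set (ℝ × ℝ) := {q | q ∈ square ∧ (q.1 = 0 ∨ q.1 = 1 ∨ q.2 = 0 ∨ q.2 = 1)}

theorem mem_square {q : ℝ × ℝ} : q ∈ square ↔ supNorm (squareVec q) ≤ 1 / 2 := by
  simp only [square, Set.mem_prod, Set.mem_Icc, supNorm, squareVec, max_le_iff, abs_le]
  constructor
  · rintro ⟨⟨h1, h2⟩, h3, h4⟩
    exact ⟨⟨by linarith, by linarith⟩, by linarith, by linarith⟩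
  · rintro ⟨⟨h1, h2⟩, h3, h4⟩
    exact ⟨⟨by linarith, by linarith⟩, by linarith, by linarith⟩

theorem mem_squareBdry {q : ℝ × ℝ} : q ∈ squareBdry ↔ supNorm (squareVec q) = 1 / 2 := by
  have key : ∀ a : ℝ, |a - 1 / 2| = 1 / 2 ↔ a = 0 ∨ a = 1 := fun a => by
    rw [abs_eq (by norm_num), or_comm]
    constructor <;> rintro (h | h)
    · left; linarith
    · right; linarith
    · left; linarith
    · right; linarith
  constructor
  · rintro ⟨hq, h⟩
    refine le_antisymm (mem_square.1 hq) ?_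
    rw [← or_assoc] at h
    rcases h with h | h
    · exact ((key _).2 h).ge.trans (le_max_left _ _)
    · exact ((key _).2 h).ge.trans (le_max_right _ _)
  · intro h
    refine ⟨mem_square.2 h.le, ?_⟩
    rw [← or_assoc, ← key, ← key]
    rcases max_choice |q.1 - 1 / 2| |q.2 - 1 / 2| with h' | h'
    · exact Or.inl (h'.symm.trans h)
    · exact Or.inr (h'.symm.trans h)

theorem squareRot_mem_square {τ : UnitAddCircle} {q : ℝ × ℝ} (hq : q ∈ square) :
    squareRot τ q ∈ square := by
  rw [mem_square] at hq ⊢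
  rwa [squareRot, squareVec_squarePt, supNorm_turn]

theorem squareRot_mem_squareBdry {τ : UnitAddCircle} {q : ℝ × ℝ} (hq : q ∈ squareBdry) :
    squareRot τ q ∈ squareBdry := by
  rw [mem_squareBdry] at hq ⊢
  rwa [squareRot, squareVec_squarePt, supNorm_turn]

theorem convex_square : Convex ℝ square := (convex_Icc _ _).prod (convex_Icc _ _)

theorem squareVec_squareLoop (θ : UnitAddCircle) :
    squareVec (squareLoop θ) = ((1 / (2 * supRadius θ) : ℝ) : ℂ) * AddCircle.toCircle θ := by
  apply Complex.ext <;> simp [squareVec, squareLoop] <;> ring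

theorem squareLoop_mem_squareBdry (θ : UnitAddCircle) : squareLoop θ ∈ squareBdry :=
  squareLoop_mem θ

theorem squareRot_squareLoop (τ θ : UnitAddCircle) :
    squareRot τ (squareLoop θ) = squareLoop (τ + θ) := by
  have h := supRadius_pos θ
  have h' := supRadius_pos (τ + θ)
  have e : ∀ θ, supNorm (AddCircle.toCircle θ : ℂ) = supRadius θ := fun _ => rfl
  rw [← squarePt_squareVec (squareLoop (τ + θ)), squareRot, squareVec_squareLoop,
    squareVec_squareLoop, turn_smul τ (by positivity), turn, ← Circle.coe_mul,
    ← AddCircle.toCircle_add, e, e, ← mul_assoc, ← Complex.ofReal_mul]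
  congr 3
  field_simp

theorem squareLoop_injective : Function.Injective squareLoop := by
  intro θ θ' h
  have h1 := congrArg squareVec h
  rw [squareVec_squareLoop, squareVec_squareLoop] at h1
  have p := supRadius_pos θ
  have p' := supRadius_pos θ'
  have h2 := congrArg norm h1
  simp only [norm_mul, Circle.norm_coe, mul_one, Complex.norm_real, Real.norm_eq_abs] at h2
  rw [abs_of_pos (by positivity), abs_of_pos (by positivity)] at h2
  rw [h2] at h1
  have h3 : ((1 / (2 * supRadius θ') : ℝ) : ℂ) ≠ 0 :=
    Complex.ofReal_ne_zero.2 (by positivity)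
  exact AddCircle.injective_toCircle one_ne_zero (Circle.coe_injective (mul_left_cancel₀ h3 h1))

theorem exists_squareLoop_eq {q : ℝ × ℝ} (hq : q ∈ squareBdry) : ∃ θ, squareLoop θ = q := by
  rw [mem_squareBdry] at hq
  have hv : squareVec q ≠ 0 := fun h => by
    rw [supNorm_eq_zero.2 h] at hq
    norm_num at hq
  have hn : (0 : ℝ) < ‖squareVec q‖ := norm_pos_iff.2 hv
  obtain ⟨θ, hθ⟩ : ∃ θ : UnitAddCircle, (AddCircle.toCircle θ : ℂ) =
      ((1 / ‖squareVec q‖ : ℝ) : ℂ) * squareVec q := by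
    obtain ⟨θ, hθ⟩ := (AddCircle.homeomorphCircle (one_ne_zero : (1 : ℝ) ≠ 0)).surjective
      ⟨((1 / ‖squareVec q‖ : ℝ) : ℂ) * squareVec q, by
        refine mem_sphere_zero_iff_norm.2 ?_
        rw [norm_mul, Complex.norm_real, Real.norm_eq_abs, abs_of_pos (by positivity), one_div,
          inv_mul_cancel₀ hn.ne']⟩
    exact ⟨θ, (congrArg Subtype.val
      (AddCircle.homeomorphCircle_apply (one_ne_zero : (1 : ℝ) ≠ 0) θ)).symm.trans
        (congrArg Subtype.val hθ)⟩
  refine ⟨θ, ?_⟩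
  have hr : supRadius θ = 1 / ‖squareVec q‖ * (1 / 2) := by
    have : supRadius θ = supNorm (AddCircle.toCircle θ : ℂ) := rfl
    rw [this, hθ, supNorm_smul, hq, abs_of_pos (by positivity)]
  rw [← squarePt_squareVec (squareLoop θ), squareVec_squareLoop, hθ, hr, ← mul_assoc,
    ← Complex.ofReal_mul]
  have : 1 / (2 * (1 / ‖squareVec q‖ * (1 / 2))) * (1 / ‖squareVec q‖) = 1 := by
    field_simp
  rw [this, Complex.ofReal_one, one_mul, squarePt_squareVec]

/-- The circle is homeomorphic to the boundary of the square, by `squareLoop`. -/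
def squareLoopHomeo : UnitAddCircle ≃ₜ squareBdry :=
  Continuous.homeoOfEquivCompactToT2
    (f := Equiv.ofBijective (fun θ => (⟨squareLoop θ, squareLoop_mem_squareBdry θ⟩ : squareBdry))
      ⟨fun _ _ h => squareLoop_injective (congrArg Subtype.val h), fun q =>
        (exists_squareLoop_eq q.2).imp fun _ h => Subtype.ext h⟩)
    (continuous_squareLoop.subtype_mk _)

open Classical in
/-- The angular coordinate on the boundary of the square, with junk value `0` elsewhere. -/
def squareAngle (q : ℝ × ℝ) : UnitAddCircle :=
  if hq : q ∈ squareBdry then squareLoopHomeo.symm ⟨q, hq⟩ else 0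

theorem squareAngle_squareLoop (θ : UnitAddCircle) : squareAngle (squareLoop θ) = θ := by
  rw [squareAngle, dif_pos (squareLoop_mem_squareBdry θ)]
  exact squareLoopHomeo.symm_apply_apply θ

theorem squareLoop_squareAngle {q : ℝ × ℝ} (hq : q ∈ squareBdry) :
    squareLoop (squareAngle q) = q := by
  obtain ⟨θ, rfl⟩ := exists_squareLoop_eq hq
  rw [squareAngle_squareLoop]

theorem continuousOn_squareAngle : ContinuousOn squareAngle squareBdry := by
  rw [continuousOn_iff_continuous_domRestrict]
  refine squareLoopHomeo.symm.continuous.congr fun q => ?_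
  rw [Set.domRestrict_apply, squareAngle, dif_pos q.2]

theorem squareAngle_squareRot (τ : UnitAddCircle) {q : ℝ × ℝ} (hq : q ∈ squareBdry) :
    squareAngle (squareRot τ q) = τ + squareAngle q := by
  obtain ⟨θ, rfl⟩ := exists_squareLoop_eq hq
  rw [squareRot_squareLoop, squareAngle_squareLoop, squareAngle_squareLoop]

end Square

/-! ### Collapsing maps to the circle -/

section Collapse

open Classical in
/-- The map to the circle which sends a point `x` of `A` to the class of `w x`, and all other
points to `0`. -/
def collapse {X : Type} (A : Set X) (w : X → ℝ) (x : X) : UnitAddCircle :=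
  if x ∈ A then (w x : UnitAddCircle) else 0

theorem collapse_of_mem {X : Type} {A : Set X} {w : X → ℝ} {x : X} (hx : x ∈ A) :
    collapse A w x = (w x : UnitAddCircle) := if_pos hx

theorem collapse_of_notMem {X : Type} {A : Set X} {w : X → ℝ} {x : X} (hx : x ∉ A) :
    collapse A w x = 0 := if_neg hx

theorem coe_eq_zero_of_eq_zero_or_one {x : ℝ} (h : x = 0 ∨ x = 1) : (x : UnitAddCircle) = 0 := by
  rcases h with rfl | rfl
  · rfl
  · exact AddCircle.coe_period 1

theorem frontier_subset_of_open {X : Type} [TopologicalSpace X] {A U : Set X} (hA : IsClosed A)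
    (hU : IsOpen U) (hUA : U ⊆ A) {x : X} (hx : x ∈ frontier A) : x ∈ A ∧ x ∉ U := by
  rw [hA.frontier_eq] at hx
  exact ⟨hx.1, fun h => hx.2 (interior_maximal hUA hU h)⟩

/-- A collapsing map is continuous if `w` is a continuous coordinate on `A` with values in
`[0, 1]` and the part of `A` with `0 < w < 1` is open. -/
theorem continuous_collapse {X : Type} [TopologicalSpace X] {A U : Set X} {w : X → ℝ}
    (hA : IsClosed A) (hw : ContinuousOn w A) (hU : IsOpen U) (hUA : U ⊆ A)
    (h01 : ∀ x ∈ A, x ∉ U → w x = 0 ∨ w x = 1) : Continuous (collapse A w) := by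
  classical
  refine continuous_if (fun x hx => ?_) ?_ continuousOn_const
  · obtain ⟨h1, h2⟩ := frontier_subset_of_open hA hU hUA hx
    exact coe_eq_zero_of_eq_zero_or_one (h01 x h1 h2)
  · change ContinuousOn _ (closure A)
    rw [hA.closure_eq]
    exact (AddCircle.continuous_mk' 1).comp_continuousOn hw

end Collapse

/-! ### The sides of the square -/

section Sides

open Filter Topology

/-- The map from the circle to itself which runs through the side `{1} × [0, 1]` of the square
and collapses the other sides. -/
def rightSide : C(UnitAddCircle, UnitAddCircle) where
  toFun := collapse {θ | (squareLoop θ).1 = 1} fun θ => (squareLoop θ).2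
  continuous_toFun := by
    have c1 : Continuous fun θ => (squareLoop θ).1 := continuous_fst.comp continuous_squareLoop
    have c2 : Continuous fun θ => (squareLoop θ).2 := continuous_snd.comp continuous_squareLoop
    refine continuous_collapse
      (U := {θ | 1 / 2 < (squareLoop θ).1 ∧ 0 < (squareLoop θ).2 ∧ (squareLoop θ).2 < 1})
      (isClosed_eq c1 continuous_const) c2.continuousOn ?_ ?_ ?_
    · exact (isOpen_lt continuous_const c1).inter
        ((isOpen_lt continuous_const c2).inter (isOpen_lt c2 continuous_const))
    · rintro θ ⟨h1, h2, h3⟩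
      rcases (squareLoop_mem θ).2 with h | h | h | h
      · linarith
      · exact h
      · linarith
      · linarith
    · intro θ hθ hU
      by_contra! hc
      obtain ⟨⟨-, h0, h1⟩, -⟩ := squareLoop_mem θ
      refine hU ⟨?_, lt_of_le_of_ne h0 hc.1.symm, lt_of_le_of_ne h1 hc.2⟩
      rw [Set.mem_ofPred_eq] at hθ
      linarith

theorem rightSide_of_eq {θ : UnitAddCircle} (h : (squareLoop θ).1 = 1) :
    rightSide θ = ((squareLoop θ).2 : UnitAddCircle) :=
  collapse_of_mem (A := {θ | (squareLoop θ).1 = 1}) (w := fun θ => (squareLoop θ).2) h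

theorem rightSide_of_ne {θ : UnitAddCircle} (h : (squareLoop θ).1 ≠ 1) : rightSide θ = 0 :=
  collapse_of_notMem (A := {θ | (squareLoop θ).1 = 1}) (w := fun θ => (squareLoop θ).2) h

theorem squareLoop_coe (t : ℝ) : squareLoop (t : UnitAddCircle) =
    (1 / 2 + Real.cos (2 * Real.pi * t) / (2 * supRadius t),
      1 / 2 + Real.sin (2 * Real.pi * t) / (2 * supRadius t)) := by
  have h : (AddCircle.toCircle (t : UnitAddCircle) : ℂ) =
      Complex.exp ((2 * Real.pi * t : ℝ) * Complex.I) := by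
    rw [AddCircle.toCircle_apply_mk, Circle.coe_exp, div_one]
  rw [squareLoop, h, Complex.exp_ofReal_mul_I_re, Complex.exp_ofReal_mul_I_im]

theorem squareLoop_zero : squareLoop 0 = (1, 1 / 2) := by
  have h := squareLoop_coe 0
  have hr : supRadius ((0 : ℝ) : UnitAddCircle) = 1 := by
    simp [supRadius]
  rw [hr] at h
  simp at h
  rw [h]
  norm_num

theorem eq_half_of_coe_eq {x : ℝ} (h0 : 0 ≤ x) (h1 : x ≤ 1)
    (h : (x : UnitAddCircle) = ((1 / 2 : ℝ) : UnitAddCircle)) : x = 1 / 2 := by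
  obtain ⟨m, rfl⟩ := coe_half_eq_iff.1 h
  have h2 : (0 : ℝ) < m := by linarith
  have h3 : (m : ℝ) < 2 := by linarith
  have h4 : m = 1 := by
    have h2' : 0 < m := by exact_mod_cast h2
    have h3' : m < 2 := by exact_mod_cast h3
    omega
  subst h4
  norm_num

theorem zero_ne_coe_half : (0 : UnitAddCircle) ≠ ((1 / 2 : ℝ) : UnitAddCircle) := fun h => by
  have := eq_half_of_coe_eq le_rfl zero_le_one h
  norm_num at this

theorem eq_zero_of_mem_Ico {t : ℝ} (ht : t ∈ Set.Ico (0 : ℝ) 1) (h : (t : UnitAddCircle) = 0) :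
    t = 0 := by
  obtain ⟨n, hn⟩ := (AddCircle.coe_eq_zero_iff (1 : ℝ)).1 h
  simp at hn
  subst hn
  have h0 : (n : ℝ) < 1 := ht.2
  have h1 : (0 : ℝ) ≤ n := ht.1
  have : n = 0 := by
    have h0' : n < 1 := by exact_mod_cast h0
    have h1' : 0 ≤ n := by exact_mod_cast h1
    omega
  simp [this]

theorem deg_rightSide : deg rightSide = 1 := by
  rw [deg_eq_card_sub_card rightSide {0} ∅]
  · simp
  · intro t
    rw [Finset.union_empty, Finset.mem_singleton]
    constructor
    · rintro rfl
      refine ⟨⟨le_rfl, zero_lt_one⟩, ?_⟩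
      rw [show ((0 : ℝ) : UnitAddCircle) = 0 from rfl]
      rw [rightSide_of_eq, squareLoop_zero]
      rw [squareLoop_zero]
    · rintro ⟨ht, h⟩
      by_cases h1 : (squareLoop t).1 = 1
      · have h2 := (rightSide_of_eq h1).symm.trans h
        obtain ⟨⟨-, h3, h4⟩, -⟩ := squareLoop_mem t
        have h5 := eq_half_of_coe_eq h3 h4 h2
        have h6 : squareLoop t = squareLoop 0 := by
          rw [squareLoop_zero]
          exact Prod.ext h1 h5
        exact eq_zero_of_mem_Ico ht (squareLoop_injective h6)
      · have h2 := (rightSide_of_ne h1).symm.trans h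
        exact absurd h2 zero_ne_coe_half
  · intro t ht
    rw [Finset.mem_singleton] at ht
    subst ht
    constructor
    · filter_upwards [Ioo_mem_nhdsLT (show (-(1 / 2) : ℝ) < 0 by norm_num)] with s hs
      by_cases h1 : (squareLoop s).1 = 1
      · refine ⟨(squareLoop s).2, ⟨(squareLoop_mem s).1.2.1, ?_⟩, (rightSide_of_eq h1).symm⟩
        rw [squareLoop_coe]
        have h2 := Real.sin_neg_of_neg_of_neg_pi_lt (x := 2 * Real.pi * s)
          (by nlinarith [Real.pi_pos, hs.2]) (by nlinarith [Real.pi_pos, hs.1])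
        have h3 := supRadius_pos s
        have := div_neg_of_neg_of_pos h2 (by positivity : 0 < 2 * supRadius s)
        simp only
        linarith
      · exact ⟨0, ⟨le_rfl, by norm_num⟩, (rightSide_of_ne h1).symm⟩
    · filter_upwards [Ioo_mem_nhdsGT (show (0 : ℝ) < 1 / 2 by norm_num)] with s hs
      by_cases h1 : (squareLoop s).1 = 1
      · refine ⟨(squareLoop s).2, ⟨?_, (squareLoop_mem s).1.2.2⟩, (rightSide_of_eq h1).symm⟩
        rw [squareLoop_coe]
        have h2 := Real.sin_pos_of_pos_of_lt_pi (x := 2 * Real.pi * s)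
          (by nlinarith [Real.pi_pos, hs.1]) (by nlinarith [Real.pi_pos, hs.2])
        have h3 := supRadius_pos s
        have := div_pos h2 (by positivity : 0 < 2 * supRadius s)
        simp only
        linarith
      · exact ⟨1, ⟨by norm_num, le_rfl⟩, (AddCircle.coe_period 1).trans
          (rightSide_of_ne h1).symm⟩
  · simp

theorem squareLoop_add_half (θ : UnitAddCircle) : squareLoop (θ + ((1 / 2 : ℝ) : UnitAddCircle)) =
    (1 - (squareLoop θ).1, 1 - (squareLoop θ).2) := by
  have h : (AddCircle.toCircle (θ + ((1 / 2 : ℝ) : UnitAddCircle)) : ℂ) =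
      -AddCircle.toCircle θ := by
    rw [AddCircle.toCircle_add, Circle.coe_mul, AddCircle.toCircle_apply_mk, Circle.coe_exp]
    rw [show ((2 * Real.pi / 1 * (1 / 2) : ℝ) : ℂ) * Complex.I = Real.pi * Complex.I by
      push_cast; ring, Complex.exp_pi_mul_I]
    ring
  have hr : supRadius (θ + ((1 / 2 : ℝ) : UnitAddCircle)) = supRadius θ := by
    simp only [supRadius, h, Complex.neg_re, Complex.neg_im, abs_neg]
  rw [squareLoop, squareLoop, hr, h]
  ext <;> simp <;> ring

/-- The map from the circle to itself which runs through the side `{0} × [0, 1]` of the square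
and collapses the other sides. -/
def leftSide : C(UnitAddCircle, UnitAddCircle) :=
  -rightSide.comp ⟨fun θ => θ + ((1 / 2 : ℝ) : UnitAddCircle), by fun_prop⟩

theorem leftSide_apply (θ : UnitAddCircle) :
    leftSide θ = -rightSide (θ + ((1 / 2 : ℝ) : UnitAddCircle)) := rfl

theorem leftSide_of_eq {θ : UnitAddCircle} (h : (squareLoop θ).1 = 0) :
    leftSide θ = ((squareLoop θ).2 : UnitAddCircle) := by
  rw [leftSide_apply, rightSide_of_eq (by rw [squareLoop_add_half, h, sub_zero]),
    squareLoop_add_half, AddCircle.coe_sub, AddCircle.coe_period]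
  simp

theorem leftSide_of_ne {θ : UnitAddCircle} (h : (squareLoop θ).1 ≠ 0) : leftSide θ = 0 := by
  rw [leftSide_apply, rightSide_of_ne (by rw [squareLoop_add_half]; simpa using h), neg_zero]

theorem deg_leftSide : deg leftSide = -1 := by
  rw [leftSide, deg_neg, deg_comp_add_const, deg_rightSide]

/-- Up to a map with a lift to `ℝ`, running through one side of the square is the same as running
around the whole boundary. -/
theorem exists_rightSide_lift :
    ∃ η : C(UnitAddCircle, ℝ), ∀ θ, rightSide θ = θ + (η θ : UnitAddCircle) := by
  obtain ⟨η, hη⟩ := exists_real_of_deg_eq_zero (rightSide - ContinuousMap.id _) (by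
    rw [deg_sub, deg_rightSide, deg_id, sub_self])
  exact ⟨η, fun θ => by rw [hη]; simp⟩

theorem exists_leftSide_lift :
    ∃ η : C(UnitAddCircle, ℝ), ∀ θ, leftSide θ = -θ + (η θ : UnitAddCircle) := by
  obtain ⟨η, hη⟩ := exists_real_of_deg_eq_zero (leftSide + ContinuousMap.id _) (by
    rw [deg_add, deg_leftSide, deg_id, neg_add_cancel])
  exact ⟨η, fun θ => by rw [hη]; simp⟩

end Sides

/-! ### The planar domain and the boundary of the standard handlebody -/

section Planar

open Topology

/-- The planar domain `P`, for which the standard handlebody is `P × [0, 1]`. -/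
def planar (g : ℕ) : Set (ℝ × ℝ) :=
  {p | p.1 ∈ Set.Icc (0 : ℝ) (2 * g + 1) ∧ p.2 ∈ Set.Icc (0 : ℝ) 3 ∧
    ∀ i : Fin g, ¬ (p.1 ∈ Set.Ioo (2 * (i : ℝ) + 1) (2 * i + 2) ∧ p.2 ∈ Set.Ioo (1 : ℝ) 2)}

/-- The closure of the `k`-th hole of the planar domain. -/
def hole (k : ℕ) : Set (ℝ × ℝ) := Set.Icc (2 * (k : ℝ) + 1) (2 * k + 2) ×ˢ Set.Icc 1 2

/-- The points of the plane on the sides of the outer rectangle (extended to lines) or in a closed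
hole. Within the planar domain these are the points of its boundary. -/
def rim (g : ℕ) : Set (ℝ × ℝ) :=
  {p | p.1 = 0 ∨ p.1 = 2 * g + 1 ∨ p.2 = 0 ∨ p.2 = 3 ∨ ∃ k : Fin g, p ∈ hole k}

/-- The projection of `ℝ³` to the plane that contains the planar domain. -/
def flat (p : ℝ × ℝ × ℝ) : ℝ × ℝ := (p.1, p.2.1)

theorem continuous_flat : Continuous flat := by
  unfold flat
  fun_prop

theorem isClosed_hole (k : ℕ) : IsClosed (hole k) := isClosed_Icc.prod isClosed_Icc

theorem mem_model {g : ℕ} {p : ℝ × ℝ × ℝ} :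
    p ∈ model g ↔ flat p ∈ planar g ∧ p.2.2 ∈ Set.Icc (0 : ℝ) 1 := by
  constructor
  · rintro ⟨h1, h2, h3, h4⟩
    exact ⟨⟨h1, h2, h4⟩, h3⟩
  · rintro ⟨⟨h1, h2, h4⟩, h3⟩
    exact ⟨h1, h2, h3, h4⟩

/-- A point from which a ray leaves a set at once is not in the interior of the set. -/
theorem notMem_interior_of_ray {s : Set (ℝ × ℝ × ℝ)} {p : ℝ × ℝ × ℝ} (v : ℝ × ℝ × ℝ)
    (h : ∀ t ∈ Set.Ioo (0 : ℝ) 1, p + t • v ∉ s) : p ∉ interior s := by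
  intro hp
  have hc : Filter.Tendsto (fun t : ℝ => p + t • v) (𝓝 0) (𝓝 (p + (0 : ℝ) • v)) :=
    Continuous.tendsto (by fun_prop) 0
  rw [zero_smul, add_zero] at hc
  have h1 : ∀ᶠ t in 𝓝[>] (0 : ℝ), p + t • v ∈ s :=
    nhdsWithin_le_nhds (hc.eventually (mem_interior_iff_mem_nhds.1 hp))
  obtain ⟨t, ht, ht'⟩ := (h1.and (Ioo_mem_nhdsGT zero_lt_one)).exists
  exact h t ht' ht

theorem mem_frontier_model {g : ℕ} {p : ℝ × ℝ × ℝ} (hp : p ∈ model g) :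
    p ∈ frontier (model g) ↔ flat p ∈ rim g ∨ p.2.2 = 0 ∨ p.2.2 = 1 := by
  have hfr : p ∈ frontier (model g) ↔ p ∉ interior (model g) :=
    ⟨fun h => h.2, fun h => ⟨subset_closure hp, h⟩⟩
  rw [hfr]
  constructor
  · intro h
    by_contra! hc
    obtain ⟨hr, hz0, hz1⟩ := hc
    have hr' : ¬ (p.1 = 0 ∨ p.1 = 2 * g + 1 ∨ p.2.1 = 0 ∨ p.2.1 = 3 ∨
      ∃ k : Fin g, flat p ∈ hole k) := hr
    push Not at hr'
    obtain ⟨hx0, hx1, hy0, hy1, hk⟩ := hr'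
    refine h (interior_maximal (s := model g) (t := {q | q.1 ∈ Set.Ioo (0 : ℝ) (2 * g + 1)} ∩
      ({q | q.2.1 ∈ Set.Ioo (0 : ℝ) 3} ∩ ({q | q.2.2 ∈ Set.Ioo (0 : ℝ) 1} ∩
        ⋂ k : Fin g, {q | flat q ∈ (hole k)ᶜ}))) ?_ ?_ ?_)
    · rintro q ⟨h1, h2, h3, h4⟩
      refine ⟨Set.Ioo_subset_Icc_self h1, Set.Ioo_subset_Icc_self h2,
        Set.Ioo_subset_Icc_self h3, fun i hi => ?_⟩
      exact Set.mem_iInter.1 h4 i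
        ⟨Set.Ioo_subset_Icc_self hi.1, Set.Ioo_subset_Icc_self hi.2⟩
    · refine (isOpen_Ioo.preimage (by fun_prop)).inter ((isOpen_Ioo.preimage (by fun_prop)).inter
        ((isOpen_Ioo.preimage (by fun_prop)).inter (isOpen_iInter_of_finite fun k => ?_)))
      exact (isClosed_hole k).isOpen_compl.preimage continuous_flat
    · obtain ⟨h1, h2, h3, -⟩ := hp
      exact ⟨⟨lt_of_le_of_ne h1.1 hx0.symm, lt_of_le_of_ne h1.2 hx1⟩,
        ⟨lt_of_le_of_ne h2.1 hy0.symm, lt_of_le_of_ne h2.2 hy1⟩,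
        ⟨lt_of_le_of_ne h3.1 hz0.symm, lt_of_le_of_ne h3.2 hz1⟩, Set.mem_iInter.2 hk⟩
  · rintro ((h | h | h | h | ⟨k, h1, h2⟩) | h | h)
    · refine notMem_interior_of_ray (-1, 0, 0) fun t ht hm => ?_
      have := hm.1.1
      simp only [flat] at h
      simp [h] at this
      linarith [ht.1]
    · refine notMem_interior_of_ray (1, 0, 0) fun t ht hm => ?_
      have := hm.1.2
      simp only [flat] at h
      simp [h] at this
      linarith [ht.1]
    · refine notMem_interior_of_ray (0, -1, 0) fun t ht hm => ?_
      have := hm.2.1.1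
      simp only [flat] at h
      simp [h] at this
      linarith [ht.1]
    · refine notMem_interior_of_ray (0, 1, 0) fun t ht hm => ?_
      have := hm.2.1.2
      simp only [flat] at h
      simp [h] at this
      linarith [ht.1]
    · -- The ray towards the centre of the hole.
      refine notMem_interior_of_ray (2 * k + 3 / 2 - p.1, 3 / 2 - p.2.1, 0) fun t ht hm => ?_
      simp only [flat] at h1 h2
      obtain ⟨t0, t1⟩ := ht
      refine hm.2.2.2 k ⟨⟨?_, ?_⟩, ?_, ?_⟩ <;> simp <;> nlinarith [h1.1, h1.2, h2.1, h2.2]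
    · refine notMem_interior_of_ray (0, 0, -1) fun t ht hm => ?_
      have := hm.2.2.1.1
      simp [h] at this
      linarith [ht.1]
    · refine notMem_interior_of_ray (0, 0, 1) fun t ht hm => ?_
      have := hm.2.2.1.2
      simp [h] at this
      linarith [ht.1]

/-- The boundary surface of the standard handlebody. -/
abbrev Surface (g : ℕ) : Type := {p : model g // (p : ℝ × ℝ × ℝ) ∈ frontier (model g)}

end Planar

/-! ### Strips in the planar domain -/

section Strip

/-- A strip in the planar domain: a band `[0, 1] × [0, 1]` embedded in `P` by `param`, with inverse
`coord`, which meets the boundary of `P` in the two ends where the second coordinate is `0` or `1`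
and the rest of `P` in the two sides where the first coordinate is `0` or `1`. The end at `0` lies
on the boundary of the hole `lo`, and the end at `1` on the boundary of the hole `hi`; the value
`none` stands for the outer boundary of `P`. -/
structure Strip (g : ℕ) where
  /-- The set of points of the strip. -/
  carrier : Set (ℝ × ℝ)
  /-- An open set of the plane which cuts out of `P` the strip without its sides. -/
  nhd : Set (ℝ × ℝ)
  /-- The coordinates on the strip: across the strip, and along the strip. -/
  coord : ℝ × ℝ → ℝ × ℝ
  /-- The point of the strip with given coordinates. -/
  param : ℝ × ℝ → ℝ × ℝ
  /-- The hole at the beginning of the strip. -/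
  lo : Option (Fin g)
  /-- The hole at the end of the strip. -/
  hi : Option (Fin g)
  isClosed_carrier : IsClosed carrier
  isOpen_nhd : IsOpen nhd
  continuousOn_coord : ContinuousOn coord carrier
  continuous_param : Continuous param
  subset : carrier ⊆ planar g
  coord_mem : ∀ p ∈ carrier, coord p ∈ square
  param_mem : ∀ q ∈ square, param q ∈ carrier
  coord_param : ∀ q ∈ square, coord (param q) = q
  param_coord : ∀ p ∈ carrier, param (coord p) = p
  nhd_subset : ∀ p ∈ nhd, p ∈ planar g → p ∈ carrier
  side : ∀ p ∈ carrier, p ∉ nhd → (coord p).1 = 0 ∨ (coord p).1 = 1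
  mem_rim : ∀ p ∈ carrier, p ∈ rim g ↔ (coord p).2 = 0 ∨ (coord p).2 = 1
  mem_hole_lo : ∀ p ∈ carrier, (coord p).2 = 0 → ∀ k : Fin g, p ∈ hole k ↔ lo = some k
  mem_hole_hi : ∀ p ∈ carrier, (coord p).2 = 1 → ∀ k : Fin g, p ∈ hole k ↔ hi = some k

namespace Strip

variable {g : ℕ} (T : Strip g)

/-- The points of the handlebody over the strip. -/
def slab : Set (ℝ × ℝ × ℝ) := flat ⁻¹' T.carrier

/-- The coordinate across the strip. -/
def width (p : ℝ × ℝ × ℝ) : ℝ := (T.coord (flat p)).1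

/-- The position in the square `{w} × [0, 1] × [0, 1]`: the coordinate along the strip and the
height. -/
def cross (p : ℝ × ℝ × ℝ) : ℝ × ℝ := ((T.coord (flat p)).2, p.2.2)

/-- The point over the strip with given coordinates. -/
def place (w : ℝ) (q : ℝ × ℝ) : ℝ × ℝ × ℝ :=
  ((T.param (w, q.1)).1, (T.param (w, q.1)).2, q.2)

theorem continuous_place : Continuous fun a : ℝ × (ℝ × ℝ) => T.place a.1 a.2 := by
  have := T.continuous_param
  unfold place
  fun_prop

theorem continuousOn_width : ContinuousOn T.width T.slab :=
  continuous_fst.comp_continuousOn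
    (T.continuousOn_coord.comp continuous_flat.continuousOn fun _ h => h)

theorem continuousOn_cross : ContinuousOn T.cross T.slab :=
  (continuous_snd.comp_continuousOn
    (T.continuousOn_coord.comp continuous_flat.continuousOn fun _ h => h)).prodMk
      (by fun_prop)

theorem isClosed_slab : IsClosed T.slab := T.isClosed_carrier.preimage continuous_flat

variable {T}

theorem width_mem {p : ℝ × ℝ × ℝ} (hp : p ∈ T.slab) : T.width p ∈ Set.Icc (0 : ℝ) 1 :=
  (T.coord_mem _ hp).1

theorem cross_mem {p : ℝ × ℝ × ℝ} (hp : p ∈ T.slab) (hm : p ∈ model g) : T.cross p ∈ square :=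
  ⟨(T.coord_mem _ hp).2, (mem_model.1 hm).2⟩

theorem place_coord {p : ℝ × ℝ × ℝ} (hp : p ∈ T.slab) :
    T.place (T.width p) (T.cross p) = p := by
  have h := T.param_coord _ hp
  unfold place width cross
  rw [h]
  rfl

theorem place_mem_slab {w : ℝ} (hw : w ∈ Set.Icc (0 : ℝ) 1) {q : ℝ × ℝ} (hq : q ∈ square) :
    T.place w q ∈ T.slab := T.param_mem _ ⟨hw, hq.1⟩

theorem place_mem_model {w : ℝ} (hw : w ∈ Set.Icc (0 : ℝ) 1) {q : ℝ × ℝ} (hq : q ∈ square) :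
    T.place w q ∈ model g :=
  mem_model.2 ⟨T.subset (place_mem_slab hw hq), hq.2⟩

theorem width_place {w : ℝ} (hw : w ∈ Set.Icc (0 : ℝ) 1) {q : ℝ × ℝ} (hq : q ∈ square) :
    T.width (T.place w q) = w := congrArg Prod.fst (T.coord_param (w, q.1) ⟨hw, hq.1⟩)

theorem cross_place {w : ℝ} (hw : w ∈ Set.Icc (0 : ℝ) 1) {q : ℝ × ℝ} (hq : q ∈ square) :
    T.cross (T.place w q) = q :=
  Prod.ext (congrArg Prod.snd (T.coord_param (w, q.1) ⟨hw, hq.1⟩)) rfl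

theorem mem_frontier_iff {p : ℝ × ℝ × ℝ} (hp : p ∈ T.slab) (hm : p ∈ model g) :
    p ∈ frontier (model g) ↔ T.cross p ∈ squareBdry := by
  rw [mem_frontier_model hm, T.mem_rim _ hp, or_assoc]
  exact ⟨fun h => ⟨cross_mem hp hm, h⟩, fun h => h.2⟩

variable (T) in
open Classical in
/-- The self-map of the handlebody which applies the map `Φ w` to each square
`{w} × [0, 1] × [0, 1]` over the strip, and fixes the points outside the strip. -/
def fiberMap (Φ : ℝ → ℝ × ℝ → ℝ × ℝ) (p : ℝ × ℝ × ℝ) : ℝ × ℝ × ℝ :=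
  if p ∈ T.slab then T.place (T.width p) (Φ (T.width p) (T.cross p)) else p

theorem fiberMap_of_mem {Φ : ℝ → ℝ × ℝ → ℝ × ℝ} {p : ℝ × ℝ × ℝ} (hp : p ∈ T.slab) :
    T.fiberMap Φ p = T.place (T.width p) (Φ (T.width p) (T.cross p)) := if_pos hp

theorem fiberMap_of_notMem {Φ : ℝ → ℝ × ℝ → ℝ × ℝ} {p : ℝ × ℝ × ℝ} (hp : p ∉ T.slab) :
    T.fiberMap Φ p = p := if_neg hp

theorem fiberMap_mem_model {Φ : ℝ → ℝ × ℝ → ℝ × ℝ} (h : ∀ w, ∀ q ∈ square, Φ w q ∈ square)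
    {p : ℝ × ℝ × ℝ} (hm : p ∈ model g) : T.fiberMap Φ p ∈ model g := by
  by_cases hp : p ∈ T.slab
  · rw [fiberMap_of_mem hp]
    exact place_mem_model (width_mem hp) (h _ _ (cross_mem hp hm))
  · rwa [fiberMap_of_notMem hp]

theorem fiberMap_mem_frontier {Φ : ℝ → ℝ × ℝ → ℝ × ℝ}
    (h : ∀ w, ∀ q ∈ squareBdry, Φ w q ∈ squareBdry)
    {p : ℝ × ℝ × ℝ} (hm : p ∈ model g) (hf : p ∈ frontier (model g)) :
    T.fiberMap Φ p ∈ frontier (model g) := by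
  by_cases hp : p ∈ T.slab
  · have h1 := h (T.width p) _ ((mem_frontier_iff hp hm).1 hf)
    rw [fiberMap_of_mem hp, mem_frontier_iff (place_mem_slab (width_mem hp) h1.1)
      (place_mem_model (width_mem hp) h1.1), cross_place (width_mem hp) h1.1]
    exact h1
  · rwa [fiberMap_of_notMem hp]

theorem fiberMap_fiberMap {Φ Ψ : ℝ → ℝ × ℝ → ℝ × ℝ} (h : ∀ w, ∀ q ∈ square, Ψ w q ∈ square)
    {p : ℝ × ℝ × ℝ} (hm : p ∈ model g) :
    T.fiberMap Φ (T.fiberMap Ψ p) = T.fiberMap (fun w q => Φ w (Ψ w q)) p := by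
  by_cases hp : p ∈ T.slab
  · have h1 := h (T.width p) _ (cross_mem hp hm)
    have hw := width_mem hp
    rw [fiberMap_of_mem (p := p) hp, fiberMap_of_mem (p := p) hp,
      fiberMap_of_mem (place_mem_slab hw h1), width_place hw h1, cross_place hw h1]
  · rw [fiberMap_of_notMem hp, fiberMap_of_notMem hp, fiberMap_of_notMem hp]

theorem fiberMap_eq_self {Φ : ℝ → ℝ × ℝ → ℝ × ℝ} {p : ℝ × ℝ × ℝ}
    (h : p ∈ T.slab → Φ (T.width p) (T.cross p) = T.cross p) : T.fiberMap Φ p = p := by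
  by_cases hp : p ∈ T.slab
  · rw [fiberMap_of_mem hp, h hp, place_coord hp]
  · rw [fiberMap_of_notMem hp]

theorem width_eq_of_notMem_nhd {p : ℝ × ℝ × ℝ} (hp : p ∈ T.slab) (h : flat p ∉ T.nhd) :
    T.width p = 0 ∨ T.width p = 1 := T.side _ hp h

/-- A continuous family of maps of the squares over the strip, trivial over its sides, gives a
continuous family of self-maps of the handlebody. -/
theorem continuous_fiberMap {Y : Type} [TopologicalSpace Y] {Φ : Y → ℝ → ℝ × ℝ → ℝ × ℝ}
    (hΦ : Continuous fun a : Y × ℝ × (ℝ × ℝ) => Φ a.1 a.2.1 a.2.2)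
    (h0 : ∀ y w q, w = 0 ∨ w = 1 → Φ y w q = q) :
    Continuous fun a : Y × model g => T.fiberMap (Φ a.1) a.2 := by
  classical
  have hA : IsClosed {a : Y × model g | (a.2 : ℝ × ℝ × ℝ) ∈ T.slab} :=
    T.isClosed_slab.preimage (by fun_prop)
  have hU : IsOpen {a : Y × model g | flat a.2 ∈ T.nhd} :=
    T.isOpen_nhd.preimage (continuous_flat.comp (by fun_prop))
  have hUA : {a : Y × model g | flat a.2 ∈ T.nhd} ⊆
      {a : Y × model g | (a.2 : ℝ × ℝ × ℝ) ∈ T.slab} := fun a ha =>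
    T.nhd_subset _ ha (mem_model.1 a.2.2).1
  refine continuous_if (p := fun a : Y × model g => (a.2 : ℝ × ℝ × ℝ) ∈ T.slab)
    (fun a ha => ?_) ?_ (by fun_prop)
  · obtain ⟨h1, h2⟩ := frontier_subset_of_open hA hU hUA ha
    rw [h0 _ _ _ (width_eq_of_notMem_nhd h1 h2), place_coord h1]
  · change ContinuousOn _ (closure {a : Y × model g | (a.2 : ℝ × ℝ × ℝ) ∈ T.slab})
    rw [hA.closure_eq]
    have c2 : ContinuousOn (fun a : Y × model g => (a.2 : ℝ × ℝ × ℝ))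
        {a : Y × model g | (a.2 : ℝ × ℝ × ℝ) ∈ T.slab} := by fun_prop
    have cw := T.continuousOn_width.comp c2 fun a ha => ha
    have cq := T.continuousOn_cross.comp c2 fun a ha => ha
    exact T.continuous_place.comp_continuousOn (cw.prodMk
      (hΦ.comp_continuousOn (continuous_fst.continuousOn.prodMk (cw.prodMk cq))))

end Strip

end Strip

/-! ### Isotopies of embedded discs -/

section Isotopy

theorem DiscIsotopic.map {S S' : Type} [TopologicalSpace S] [TopologicalSpace S']
    {a b : C(Disc, S)} (f : S ≃ₜ S') (h : DiscIsotopic a b) :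
    DiscIsotopic ((f : C(S, S')).comp a) ((f : C(S, S')).comp b) := by
  obtain ⟨H, hH, h0, h1⟩ := h
  exact ⟨(f : C(S, S')).comp H, fun t => f.isEmbedding.comp (hH t),
    fun z => congrArg f (h0 z), fun z => congrArg f (h1 z)⟩

theorem isEmbedding_of_injective {S : Type} [TopologicalSpace S] [T2Space S] {f : Disc → S}
    (hf : Continuous f) (hi : Function.Injective f) : Topology.IsEmbedding f :=
  (hf.isClosedEmbedding hi).isEmbedding

/-- An embedded disc which is not contained in the closed set `K` can be shrunk, through embedded
discs, until it is disjoint from `K`. -/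
theorem exists_isotopic_compl {S : Type} [TopologicalSpace S] {K : Set S} (hK : IsClosed K)
    {d : C(Disc, S)} (hd : Topology.IsEmbedding d) {z₁ : Disc} (hz : d z₁ ∉ K) :
    ∃ d' : C(Disc, S), DiscIsotopic d d' ∧ ∀ z, d' z ∉ K := by
  obtain ⟨ε, hε, hball⟩ := Metric.isOpen_iff.1 (hK.isOpen_compl.preimage d.continuous) z₁ hz
  obtain ⟨η, hη0, hη1, hη⟩ : ∃ η : ℝ, 0 < η ∧ η ≤ 1 ∧ 2 * η < ε :=
    ⟨min 1 (ε / 3), by positivity, min_le_left _ _, by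
      have := min_le_right 1 (ε / 3)
      linarith⟩
  -- At time `t`, the disc is shrunk towards `z₁` by the factor `1 - t * (1 - η)`.
  let c : unitInterval → ℝ := fun t => 1 - t * (1 - η)
  have hc : ∀ t, 0 < c t ∧ c t ≤ 1 := fun t => by
    have h0 := t.2.1
    have h1 := t.2.2
    simp only [c]
    constructor <;> nlinarith
  have hmem : ∀ (t : unitInterval) (z : Disc), (c t) • (z : ℂ) + (1 - c t) • (z₁ : ℂ) ∈
      Metric.closedBall (0 : ℂ) 1 := fun t z =>
    (convex_closedBall (0 : ℂ) 1) z.2 z₁.2 (hc t).1.le (by linarith [(hc t).2]) (by ring)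
  let s : C(unitInterval × Disc, Disc) :=
    ⟨fun p => ⟨(c p.1) • (p.2 : ℂ) + (1 - c p.1) • (z₁ : ℂ), hmem p.1 p.2⟩,
      Continuous.subtype_mk (by simp only [c]; fun_prop) _⟩
  have hs : ∀ t, Topology.IsEmbedding fun z => s (t, z) := fun t => by
    refine isEmbedding_of_injective (by fun_prop) fun z z' h => Subtype.ext ?_
    have h1 := add_right_cancel (congrArg Subtype.val h)
    exact smul_right_injective ℂ (hc t).1.ne' h1
  let e : C(Disc, Disc) := ⟨fun z => s (1, z), by fun_prop⟩
  refine ⟨d.comp e, ⟨d.comp s, fun t => hd.comp (hs t), fun z => ?_, fun z => rfl⟩, fun z => ?_⟩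
  · refine congrArg d (Subtype.ext ?_)
    change (c 0) • (z : ℂ) + (1 - c 0) • (z₁ : ℂ) = z
    simp [c]
  · refine hball (Metric.mem_ball.2 (lt_of_le_of_lt ?_ hη))
    rw [Subtype.dist_eq, dist_eq_norm]
    change ‖(c 1) • (z : ℂ) + (1 - c 1) • (z₁ : ℂ) - z₁‖ ≤ 2 * η
    have h1 : c 1 = η := by simp [c]
    have h2 : (c 1) • (z : ℂ) + (1 - c 1) • (z₁ : ℂ) - z₁ = η • ((z : ℂ) - z₁) := by
      rw [h1, smul_sub, sub_smul, one_smul]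
      ring
    have hz0 := mem_closedBall_zero_iff.1 z.2
    have hz1 := mem_closedBall_zero_iff.1 z₁.2
    rw [h2, norm_smul, Real.norm_eq_abs, abs_of_pos hη0]
    have := norm_sub_le (z : ℂ) z₁
    nlinarith

/-- A homeomorphism supported in a closed set `K` preserves the orientation if every embedded disc
contained in `K` is isotopic to one on which the homeomorphism is the identity. -/
theorem mem_homeoPlus_of_support {S : Type} [TopologicalSpace S] (f : S ≃ₜ S) {K : Set S}
    (hK : IsClosed K) (hf : ∀ x, x ∉ K → f x = x)
    (h : ∀ d : C(Disc, S), Topology.IsEmbedding d → (∀ z, d z ∈ K) →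
      ∃ d' : C(Disc, S), DiscIsotopic d d' ∧ ∀ z, f (d' z) = d' z) : f ∈ homeoPlus S := by
  intro d hd
  obtain ⟨d', h1, h2⟩ : ∃ d' : C(Disc, S), DiscIsotopic d d' ∧ ∀ z, f (d' z) = d' z := by
    by_cases hdK : ∀ z, d z ∈ K
    · exact h d hd hdK
    · push Not at hdK
      obtain ⟨z₁, hz⟩ := hdK
      obtain ⟨d', h1, h2⟩ := exists_isotopic_compl hK hd hz
      exact ⟨d', h1, fun z => hf _ (h2 z)⟩
  have h3 : (f : C(S, S)).comp d' = d' := ContinuousMap.ext h2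
  have h4 := h1.map f
  rw [h3] at h4
  exact h1.trans h4.symm

/-- Conjugation by a homeomorphism preserves orientation preserving homeomorphisms. -/
theorem conj_mem_homeoPlus {S S' : Type} [TopologicalSpace S] [TopologicalSpace S'] (k : S ≃ₜ S')
    {f : S ≃ₜ S} (hf : f ∈ homeoPlus S) : (k.symm.trans f).trans k ∈ homeoPlus S' := by
  intro d hd
  have h1 := (hf ((k.symm : C(S', S)).comp d) (k.symm.isEmbedding.comp hd)).map k
  have h2 : (k : C(S, S')).comp ((k.symm : C(S', S)).comp d) = d :=
    ContinuousMap.ext fun z => k.apply_symm_apply _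
  rwa [h2] at h1

end Isotopy

/-! ### The twist along a strip -/

namespace Strip

variable {g : ℕ} (T : Strip g)

/-- The function which increases linearly from `0` to `1` on `[1/3, 2/3]`. -/
def ramp (w : ℝ) : ℝ := max 0 (min 1 (3 * w - 1))

theorem continuous_ramp : Continuous ramp := by
  unfold ramp
  fun_prop

theorem ramp_of_le {w : ℝ} (h : w ≤ 1 / 3) : ramp w = 0 :=
  max_eq_left ((min_le_right _ _).trans (by linarith))

theorem ramp_of_ge {w : ℝ} (h : 2 / 3 ≤ w) : ramp w = 1 := by
  rw [ramp, min_eq_left (by linarith), max_eq_right zero_le_one]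

theorem ramp_mem (w : ℝ) : ramp w ∈ Set.Icc (0 : ℝ) 1 :=
  ⟨le_max_left _ _, max_le zero_le_one (min_le_left _ _)⟩

theorem coe_ramp_of_end {w : ℝ} (h : w = 0 ∨ w = 1) : (ramp w : UnitAddCircle) = 0 := by
  apply coe_eq_zero_of_eq_zero_or_one
  rcases h with rfl | rfl
  · exact Or.inl (ramp_of_le (by norm_num))
  · exact Or.inr (ramp_of_ge (by norm_num))

/-- The fibrewise rotation whose angle grows from `0` to one full turn across the strip. -/
def twistFiber (w : ℝ) (q : ℝ × ℝ) : ℝ × ℝ := squareRot (ramp w : UnitAddCircle) q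

/-- The inverse of `twistFiber`. -/
def untwistFiber (w : ℝ) (q : ℝ × ℝ) : ℝ × ℝ := squareRot (-(ramp w : UnitAddCircle)) q

theorem continuous_coe_ramp : Continuous fun w => (ramp w : UnitAddCircle) :=
  (AddCircle.continuous_mk' 1).comp continuous_ramp

theorem continuous_twistFiber : Continuous fun a : ℝ × (ℝ × ℝ) => twistFiber a.1 a.2 := by
  have h : Continuous fun a : ℝ × (ℝ × ℝ) => (ramp a.1 : UnitAddCircle) :=
    continuous_coe_ramp.comp continuous_fst
  exact continuous_squareRot.comp₂ h continuous_snd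

theorem continuous_untwistFiber : Continuous fun a : ℝ × (ℝ × ℝ) => untwistFiber a.1 a.2 := by
  have h : Continuous fun a : ℝ × (ℝ × ℝ) => (ramp a.1 : UnitAddCircle) :=
    continuous_coe_ramp.comp continuous_fst
  exact continuous_squareRot.comp₂ h.neg continuous_snd

theorem twistFiber_mem (w : ℝ) (q : ℝ × ℝ) (hq : q ∈ square) : twistFiber w q ∈ square :=
  squareRot_mem_square hq

theorem untwistFiber_mem (w : ℝ) (q : ℝ × ℝ) (hq : q ∈ square) : untwistFiber w q ∈ square :=
  squareRot_mem_square hq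

theorem twistFiber_end {w : ℝ} (h : w = 0 ∨ w = 1) (q : ℝ × ℝ) : twistFiber w q = q := by
  rw [twistFiber, coe_ramp_of_end h, squareRot_zero]

theorem untwistFiber_end {w : ℝ} (h : w = 0 ∨ w = 1) (q : ℝ × ℝ) : untwistFiber w q = q := by
  rw [untwistFiber, coe_ramp_of_end h, neg_zero, squareRot_zero]

/-- The twist of the handlebody along the discs over the strip. -/
def twist : model g ≃ₜ model g where
  toFun p := ⟨T.fiberMap twistFiber p, fiberMap_mem_model twistFiber_mem p.2⟩
  invFun p := ⟨T.fiberMap untwistFiber p,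
    fiberMap_mem_model untwistFiber_mem p.2⟩
  left_inv p := Subtype.ext <| by
    change T.fiberMap untwistFiber (T.fiberMap twistFiber p) = p
    rw [fiberMap_fiberMap twistFiber_mem p.2]
    refine fiberMap_eq_self fun _ => ?_
    rw [untwistFiber, twistFiber, squareRot_squareRot, neg_add_cancel, squareRot_zero]
  right_inv p := Subtype.ext <| by
    change T.fiberMap twistFiber (T.fiberMap untwistFiber p) = p
    rw [fiberMap_fiberMap untwistFiber_mem p.2]
    refine fiberMap_eq_self fun _ => ?_
    rw [untwistFiber, twistFiber, squareRot_squareRot, add_neg_cancel, squareRot_zero]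
  continuous_toFun := Continuous.subtype_mk
    ((continuous_fiberMap (T := T) (Y := Unit) (Φ := fun _ => twistFiber)
      (continuous_twistFiber.comp continuous_snd) fun _ _ q h => twistFiber_end h q).comp
        (Continuous.prodMk_right ())) _
  continuous_invFun := Continuous.subtype_mk
    ((continuous_fiberMap (T := T) (Y := Unit) (Φ := fun _ => untwistFiber)
      (continuous_untwistFiber.comp continuous_snd) fun _ _ q h => untwistFiber_end h q).comp
        (Continuous.prodMk_right ())) _

/-- The twist is homotopic to the identity, since the square is convex. -/
theorem twist_homotopic : (T.twist : C(model g, model g)).Homotopic (ContinuousMap.id _) := by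
  let Φ : unitInterval → ℝ → ℝ × ℝ → ℝ × ℝ := fun t w q =>
    (1 - (t : ℝ)) • twistFiber w q + (t : ℝ) • q
  have hmem : ∀ t w, ∀ q ∈ square, Φ t w q ∈ square := fun t w q hq =>
    convex_square (twistFiber_mem w q hq) hq (by linarith [t.2.2]) t.2.1 (by ring)
  have hcont : Continuous fun a : unitInterval × model g => T.fiberMap (Φ a.1) a.2 := by
    refine continuous_fiberMap ?_ fun t w q h => ?_
    · have h1 : Continuous fun a : unitInterval × ℝ × (ℝ × ℝ) => twistFiber a.2.1 a.2.2 :=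
        continuous_twistFiber.comp continuous_snd
      simp only [Φ]
      fun_prop
    · simp only [Φ]
      rw [twistFiber_end h, ← add_smul, sub_add_cancel, one_smul]
  refine ⟨⟨⟨fun a => ⟨T.fiberMap (Φ a.1) a.2, fiberMap_mem_model (hmem a.1) a.2.2⟩,
    hcont.subtype_mk _⟩, fun p => Subtype.ext ?_, fun p => Subtype.ext ?_⟩⟩
  · change T.fiberMap (Φ 0) p = T.fiberMap twistFiber p
    congr 1
    funext w q
    simp [Φ]
  · exact fiberMap_eq_self fun _ => by simp [Φ]

theorem twist_mem_frontier (p : model g) :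
    (p : ℝ × ℝ × ℝ) ∈ frontier (model g) ↔ (T.twist p : ℝ × ℝ × ℝ) ∈ frontier (model g) := by
  refine ⟨fun h => fiberMap_mem_frontier (fun _ _ h => squareRot_mem_squareBdry h) p.2 h,
    fun h => ?_⟩
  have h1 : (T.twist.symm (T.twist p) : ℝ × ℝ × ℝ) ∈ frontier (model g) :=
    fiberMap_mem_frontier (Φ := untwistFiber) (fun _ _ h => squareRot_mem_squareBdry h)
      (T.twist p).2 h
  rwa [T.twist.symm_apply_apply] at h1

/-- The twist of the boundary surface. -/
def surfaceTwist : Surface g ≃ₜ Surface g := T.twist.subtype T.twist_mem_frontier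

theorem surfaceTwist_coe (p : Surface g) :
    ((T.surfaceTwist p).1 : ℝ × ℝ × ℝ) = T.fiberMap twistFiber p.1 := rfl

theorem surfaceTwist_eq_self {p : Surface g}
    (h : (p.1 : ℝ × ℝ × ℝ) ∈ T.slab → T.width p.1 ≤ 1 / 3 ∨ 2 / 3 ≤ T.width p.1) :
    T.surfaceTwist p = p := by
  refine Subtype.ext (Subtype.ext ?_)
  rw [surfaceTwist_coe]
  refine fiberMap_eq_self fun hp => ?_
  have : (ramp (T.width p.1) : UnitAddCircle) = 0 := by
    apply coe_eq_zero_of_eq_zero_or_one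
    rcases h hp with h | h
    · exact Or.inl (ramp_of_le h)
    · exact Or.inr (ramp_of_ge h)
  rw [twistFiber, this, squareRot_zero]

/-- The twist preserves the orientation: a disc inside the support `1/3 ≤ w ≤ 2/3` of the twist
slides off the support in the direction of `w`. -/
theorem surfaceTwist_mem_homeoPlus : T.surfaceTwist ∈ homeoPlus (Surface g) := by
  let ι : Surface g → ℝ × ℝ × ℝ := fun p => p.1
  have hι : Continuous ι := continuous_subtype_val.comp continuous_subtype_val
  refine mem_homeoPlus_of_support T.surfaceTwist
    (K := {p : Surface g | ι p ∈ T.slab ∩ T.width ⁻¹' Set.Icc (1 / 3) (2 / 3)})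
    ((T.continuousOn_width.preimage_isClosed_of_isClosed T.isClosed_slab isClosed_Icc).preimage hι)
    (fun p hp => ?_) fun d hd hK => ?_
  · refine T.surfaceTwist_eq_self fun hs => ?_
    by_contra! hc
    exact hp ⟨hs, hc.1.le, hc.2.le⟩
  · have hw : ∀ (t : unitInterval) (z : Disc),
        T.width (ι (d z)) + t / 3 ∈ Set.Icc (0 : ℝ) 1 := fun t z => by
      have h1 := (hK z).2
      constructor <;> linarith [t.2.1, t.2.2, h1.1, h1.2]
    have hb : ∀ z, T.cross (ι (d z)) ∈ squareBdry := fun z =>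
      (mem_frontier_iff (hK z).1 (d z).1.2).1 (d z).2
    have hm : ∀ (t : unitInterval) (z : Disc),
        T.place (T.width (ι (d z)) + t / 3) (T.cross (ι (d z))) ∈ model g := fun t z =>
      place_mem_model (hw t z) (hb z).1
    have hfr : ∀ (t : unitInterval) (z : Disc),
        T.place (T.width (ι (d z)) + t / 3) (T.cross (ι (d z))) ∈ frontier (model g) :=
      fun t z => by
        rw [mem_frontier_iff (place_mem_slab (hw t z) (hb z).1) (hm t z),
          cross_place (hw t z) (hb z).1]
        exact hb z
    have cw : Continuous fun z : Disc => T.width (ι (d z)) :=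
      T.continuousOn_width.comp_continuous (hι.comp d.continuous) fun z => (hK z).1
    have cq : Continuous fun z : Disc => T.cross (ι (d z)) :=
      T.continuousOn_cross.comp_continuous (hι.comp d.continuous) fun z => (hK z).1
    let H : C(unitInterval × Disc, Surface g) :=
      ⟨fun a => ⟨⟨_, hm a.1 a.2⟩, hfr a.1 a.2⟩, by
        refine Continuous.subtype_mk (Continuous.subtype_mk ?_ _) _
        exact T.continuous_place.comp (((cw.comp continuous_snd).add (by fun_prop)).prodMk
          (cq.comp continuous_snd))⟩
    have hH : ∀ a, ι (H a) = T.place (T.width (ι (d a.2)) + a.1 / 3) (T.cross (ι (d a.2))) :=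
      fun a => rfl
    refine ⟨⟨fun z => H (1, z), by fun_prop⟩, ⟨H, fun t => ?_, fun z => ?_, fun z => rfl⟩,
      fun z => ?_⟩
    · refine isEmbedding_of_injective (by fun_prop) fun z z' h => hd.injective ?_
      have h1 : ι (H (t, z)) = ι (H (t, z')) := congrArg ι h
      rw [hH, hH] at h1
      have h2 := congrArg T.width h1
      have h3 := congrArg T.cross h1
      rw [width_place (hw t z) (hb z).1, width_place (hw t z') (hb z').1] at h2
      rw [cross_place (hw t z) (hb z).1, cross_place (hw t z') (hb z').1] at h3
      refine Subtype.ext (Subtype.ext ?_)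
      change ι (d z) = ι (d z')
      rw [← place_coord (hK z).1, ← place_coord (hK z').1, h3, add_right_cancel h2]
    · refine Subtype.ext (Subtype.ext ?_)
      change ι (H (0, z)) = ι (d z)
      rw [hH]
      simp only [Set.Icc.coe_zero, zero_div, add_zero]
      exact place_coord (hK z).1
    · refine T.surfaceTwist_eq_self fun _ => Or.inr ?_
      change 2 / 3 ≤ T.width (ι (H (1, z)))
      rw [hH, width_place (hw 1 z) (hb z).1]
      have h1 := (hK z).2.1
      simp only [Set.Icc.coe_one]
      linarith

end Strip

/-! ### The strips used for the twists -/

section Strips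

theorem hole_index {x : ℝ} {i k : ℕ} (h1 : 2 * (i : ℝ) + 1 ≤ x) (h2 : x ≤ 2 * i + 2)
    (h3 : 2 * (k : ℝ) + 1 ≤ x) (h4 : x ≤ 2 * k + 2) : i = k := by
  have h5 : (2 * i + 1 : ℝ) ≤ 2 * k + 2 := h1.trans h4
  have h6 : (2 * k + 1 : ℝ) ≤ 2 * i + 2 := h3.trans h2
  have h5' : 2 * i + 1 ≤ 2 * k + 2 := by exact_mod_cast h5
  have h6' : 2 * k + 1 ≤ 2 * i + 2 := by exact_mod_cast h6
  omega

theorem fin_bounds {g : ℕ} (i : Fin g) : (0 : ℝ) ≤ (i : ℕ) ∧ ((i : ℕ) : ℝ) + 1 ≤ g :=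
  ⟨Nat.cast_nonneg _, by exact_mod_cast i.2⟩

/-- The straight strip `[2i + 1, 2i + 2] × [0, 1]` from the outer boundary to the `i`-th hole. The
discs over it are parallel to the `i`-th meridian disc. -/
def boxStrip {g : ℕ} (i : Fin g) : Strip g where
  carrier := Set.Icc (2 * (i : ℝ) + 1) (2 * i + 2) ×ˢ Set.Icc 0 1
  nhd := Set.Ioo (2 * (i : ℝ) + 1) (2 * i + 2) ×ˢ Set.Iio 2
  coord p := (p.1 - (2 * i + 1), p.2)
  param q := (2 * i + 1 + q.1, q.2)
  lo := none
  hi := some i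
  isClosed_carrier := isClosed_Icc.prod isClosed_Icc
  isOpen_nhd := isOpen_Ioo.prod isOpen_Iio
  continuousOn_coord := by fun_prop
  continuous_param := by fun_prop
  subset := by
    rintro p ⟨⟨h1, h2⟩, h3, h4⟩
    obtain ⟨hi0, hi⟩ := fin_bounds i
    refine ⟨⟨by linarith, by linarith⟩, ⟨h3, by linarith⟩, ?_⟩
    rintro k ⟨-, h5, -⟩
    linarith
  coord_mem := by
    rintro p ⟨⟨h1, h2⟩, h3, h4⟩
    exact ⟨⟨by simp only; linarith, by simp only; linarith⟩, h3, h4⟩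
  param_mem := by
    rintro p ⟨⟨h1, h2⟩, h3, h4⟩
    exact ⟨⟨by simp only; linarith, by simp only; linarith⟩, h3, h4⟩
  coord_param := by
    rintro p -
    ext <;> simp
  param_coord := by
    rintro p -
    ext <;> simp
  nhd_subset := by
    rintro p ⟨hx, hy⟩ hp
    refine ⟨Set.Ioo_subset_Icc_self hx, hp.2.1.1, ?_⟩
    by_contra hc
    exact hp.2.2 i ⟨hx, not_le.1 hc, hy⟩
  side := by
    rintro p ⟨⟨h1, h2⟩, h3, h4⟩ hp
    simp only
    by_contra! hc
    refine hp ⟨⟨lt_of_le_of_ne h1 fun h => hc.1 (by linarith),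
      lt_of_le_of_ne h2 fun h => hc.2 (by linarith)⟩, lt_of_le_of_lt h4 one_lt_two⟩
  mem_rim := by
    rintro p ⟨⟨h1, h2⟩, h3, h4⟩
    obtain ⟨hi0, hi⟩ := fin_bounds i
    constructor
    · rintro (h | h | h | h | ⟨k, -, h, -⟩)
      · linarith
      · linarith
      · exact Or.inl h
      · linarith
      · exact Or.inr (le_antisymm h4 h)
    · rintro (h | h)
      · exact Or.inr (Or.inr (Or.inl h))
      · have h : p.2 = 1 := h
        exact Or.inr (Or.inr (Or.inr (Or.inr ⟨i, ⟨h1, h2⟩, h.ge, by linarith⟩)))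
  mem_hole_lo := by
    rintro p - h k
    have h : p.2 = 0 := h
    refine ⟨fun hp => ?_, fun hn => by cases hn⟩
    have := hp.2.1
    linarith
  mem_hole_hi := by
    rintro p ⟨⟨h1, h2⟩, -⟩ h k
    have h : p.2 = 1 := h
    constructor
    · rintro ⟨⟨h3, h4⟩, -⟩
      exact congrArg some (Fin.ext (hole_index h1 h2 h3 h4))
    · intro hk
      cases hk
      exact ⟨⟨h1, h2⟩, h.ge, by linarith⟩

/-- Half the distance between the centres of the `i`-th and the `j`-th hole. -/
def tentRadius (i j : ℕ) : ℝ := j - i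

/-- The first coordinate of the midpoint between the `i`-th and the `j`-th hole. -/
def tentCentre (i j : ℕ) : ℝ := i + j + 3 / 2

/-- The function whose level lines in `2 ≤ y` are the tents over the midpoint between the `i`-th
and the `j`-th hole. -/
def tentHeight (i j : ℕ) (p : ℝ × ℝ) : ℝ :=
  |p.1 - tentCentre i j| + (tentRadius i j + 1) * (p.2 - 2)

theorem continuous_tentHeight (i j : ℕ) : Continuous (tentHeight i j) := by
  unfold tentHeight
  fun_prop

/-- The points of the tent-shaped strip from the `i`-th to the `j`-th hole. -/
def tentSet (i j : ℕ) : Set (ℝ × ℝ) :=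
  {p | 2 ≤ p.2 ∧ tentRadius i j - 1 / 2 ≤ tentHeight i j p ∧
    tentHeight i j p ≤ tentRadius i j + 1 / 2}

/-- The coordinates on the tent-shaped strip. -/
def tentCoord (i j : ℕ) (p : ℝ × ℝ) : ℝ × ℝ :=
  (tentHeight i j p - (tentRadius i j - 1 / 2),
    (1 + (p.1 - tentCentre i j) / tentHeight i j p) / 2)

/-- The parametrization of the tent-shaped strip. -/
def tentParam (i j : ℕ) (q : ℝ × ℝ) : ℝ × ℝ :=
  (tentCentre i j + (q.1 + (tentRadius i j - 1 / 2)) * (2 * q.2 - 1),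
    2 + (q.1 + (tentRadius i j - 1 / 2)) * (1 - |2 * q.2 - 1|) / (tentRadius i j + 1))

section Tent

variable {i j : ℕ}

theorem one_le_tentRadius (hij : i < j) : 1 ≤ tentRadius i j := by
  have : (i : ℝ) + 1 ≤ j := by exact_mod_cast hij
  unfold tentRadius
  linarith

theorem tentHeight_pos (hij : i < j) {p : ℝ × ℝ} (hp : p ∈ tentSet i j) :
    0 < tentHeight i j p := by
  have := one_le_tentRadius hij
  linarith [hp.2.1]

theorem abs_le_tentHeight (hij : i < j) {p : ℝ × ℝ} (hp : p ∈ tentSet i j) :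
    |p.1 - tentCentre i j| ≤ tentHeight i j p := by
  have h1 := one_le_tentRadius hij
  have h2 := hp.1
  unfold tentHeight
  nlinarith

theorem tentHeight_tentParam (hij : i < j) {q : ℝ × ℝ} (hq : q ∈ square) :
    tentHeight i j (tentParam i j q) = q.1 + (tentRadius i j - 1 / 2) := by
  have h1 := one_le_tentRadius hij
  obtain ⟨⟨h2, h3⟩, h4, h5⟩ := hq
  have hr : 0 ≤ q.1 + (tentRadius i j - 1 / 2) := by linarith
  have hK : tentRadius i j + 1 ≠ 0 := by linarith
  simp only [tentHeight, tentParam, add_sub_cancel_left]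
  rw [abs_mul, abs_of_nonneg hr, mul_div_cancel₀ _ hK]
  ring

/-- With `c` the centre and `R` the height of a point `(x, y)`, the ends of the tent-shaped strip
are given by `x = c - R` and `x = c + R`. Since `|x - c| = R` only for `y = 2`, they lie on the upper
sides of the two holes. -/
theorem tentCoord_end (hij : i < j) {p : ℝ × ℝ} (hp : p ∈ tentSet i j) :
    ((tentCoord i j p).2 = 0 ↔ p.1 = tentCentre i j - tentHeight i j p) ∧
      ((tentCoord i j p).2 = 1 ↔ p.1 = tentCentre i j + tentHeight i j p) := by
  have hR := tentHeight_pos hij hp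
  have h1 : (p.1 - tentCentre i j) / tentHeight i j p = -1 ↔
      p.1 = tentCentre i j - tentHeight i j p := by
    rw [div_eq_iff hR.ne']
    constructor <;> intro h <;> linarith
  have h2 : (p.1 - tentCentre i j) / tentHeight i j p = 1 ↔
      p.1 = tentCentre i j + tentHeight i j p := by
    rw [div_eq_iff hR.ne']
    constructor <;> intro h <;> linarith
  rw [← h1, ← h2]
  simp only [tentCoord]
  refine ⟨⟨fun h => by linarith, fun h => by linarith⟩, fun h => by linarith, fun h => by linarith⟩

theorem tent_snd_eq_two (hij : i < j) {p : ℝ × ℝ}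
    (h : |p.1 - tentCentre i j| = tentHeight i j p) : p.2 = 2 := by
  have h1 := one_le_tentRadius hij
  unfold tentHeight at h
  have h2 : (tentRadius i j + 1) * (p.2 - 2) = 0 := by linarith
  rcases mul_eq_zero.1 h2 with h3 | h3 <;> linarith

theorem tent_lo (hij : i < j) {p : ℝ × ℝ} (hp : p ∈ tentSet i j)
    (h : p.1 = tentCentre i j - tentHeight i j p) : p ∈ hole i := by
  have hR := tentHeight_pos hij hp
  have hy : p.2 = 2 := tent_snd_eq_two hij (by
    rw [abs_of_nonpos (by linarith)]
    linarith)
  obtain ⟨-, h2, h3⟩ := hp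
  simp only [tentRadius, tentCentre] at *
  exact ⟨⟨by linarith, by linarith⟩, by linarith, by linarith⟩

theorem tent_hi (hij : i < j) {p : ℝ × ℝ} (hp : p ∈ tentSet i j)
    (h : p.1 = tentCentre i j + tentHeight i j p) : p ∈ hole j := by
  have hR := tentHeight_pos hij hp
  have hy : p.2 = 2 := tent_snd_eq_two hij (by
    rw [abs_of_nonneg (by linarith)]
    linarith)
  obtain ⟨-, h2, h3⟩ := hp
  simp only [tentRadius, tentCentre] at *
  exact ⟨⟨by linarith, by linarith⟩, by linarith, by linarith⟩

theorem tent_snd_lt_three (hij : i < j) {p : ℝ × ℝ} (hp : p ∈ tentSet i j) : p.2 < 3 := by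
  have h1 := one_le_tentRadius hij
  have h2 := hp.2.2
  have h3 := abs_nonneg (p.1 - tentCentre i j)
  unfold tentHeight at h2
  by_contra! hc
  nlinarith

theorem tent_fst_mem (hij : i < j) {p : ℝ × ℝ} (hp : p ∈ tentSet i j) :
    2 * (i : ℝ) + 1 ≤ p.1 ∧ p.1 ≤ 2 * j + 2 := by
  have h1 := abs_le.1 ((abs_le_tentHeight hij hp).trans hp.2.2)
  simp only [tentRadius, tentCentre] at h1
  constructor <;> linarith [h1.1, h1.2]

end Tent

/-- The tent-shaped strip from the `i`-th to the `j`-th hole. It passes above the holes in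
between. -/
def tentStrip {g : ℕ} (i j : Fin g) (hij : (i : ℕ) < j) : Strip g where
  carrier := tentSet i j
  nhd := {p | 1 < p.2 ∧
    tentRadius i j - 1 / 2 < |p.1 - tentCentre i j| + (tentRadius i j + 1) * max (p.2 - 2) 0 ∧
    |p.1 - tentCentre i j| + (tentRadius i j + 1) * max (p.2 - 2) 0 < tentRadius i j + 1 / 2}
  coord := tentCoord i j
  param := tentParam i j
  lo := some i
  hi := some j
  isClosed_carrier := by
    have h := continuous_tentHeight i j
    exact (isClosed_le continuous_const continuous_snd).inter
      ((isClosed_le continuous_const h).inter (isClosed_le h continuous_const))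
  isOpen_nhd := by
    have h : Continuous fun p : ℝ × ℝ =>
        |p.1 - tentCentre i j| + (tentRadius i j + 1) * max (p.2 - 2) 0 := by fun_prop
    exact (isOpen_lt continuous_const continuous_snd).inter
      ((isOpen_lt continuous_const h).inter (isOpen_lt h continuous_const))
  continuousOn_coord := by
    have h := continuous_tentHeight i j
    have h2 : ContinuousOn (fun p : ℝ × ℝ => (p.1 - tentCentre i j) / tentHeight i j p)
        (tentSet i j) :=
      ContinuousOn.div (by fun_prop) h.continuousOn fun p hp => (tentHeight_pos hij hp).ne'
    exact (h.sub continuous_const).continuousOn.prodMk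
      ((continuousOn_const.add h2).div_const 2)
  continuous_param := by
    unfold tentParam
    fun_prop
  subset := by
    intro p hp
    have h1 := tent_fst_mem hij hp
    have hi := fin_bounds i
    have hj := fin_bounds j
    refine ⟨⟨by linarith, by linarith⟩, ⟨by linarith [hp.1], (tent_snd_lt_three hij hp).le⟩, ?_⟩
    rintro k ⟨-, -, h5⟩
    linarith [hp.1]
  coord_mem := by
    intro p hp
    have h1 := abs_le_tentHeight hij hp
    have hR := tentHeight_pos hij hp
    have h2 : |(p.1 - tentCentre i j) / tentHeight i j p| ≤ 1 := by
      rw [abs_div, abs_of_pos hR, div_le_one hR]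
      exact h1
    obtain ⟨h3, h4⟩ := abs_le.1 h2
    obtain ⟨-, h5, h6⟩ := hp
    refine ⟨⟨?_, ?_⟩, ?_, ?_⟩ <;> simp only [tentCoord] <;> linarith
  param_mem := by
    intro q hq
    have h := tentHeight_tentParam hij hq
    have h1 := one_le_tentRadius hij
    obtain ⟨⟨h2, h3⟩, h4, h5⟩ := hq
    refine ⟨?_, by rw [h]; linarith, by rw [h]; linarith⟩
    have h6 : |2 * q.2 - 1| ≤ 1 := abs_le.2 ⟨by linarith, by linarith⟩
    have h7 : 0 ≤ (q.1 + (tentRadius i j - 1 / 2)) * (1 - |2 * q.2 - 1|) :=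
      mul_nonneg (by linarith) (by linarith)
    have h8 := div_nonneg h7 (by linarith : 0 ≤ tentRadius i j + 1)
    simp only [tentParam]
    linarith
  coord_param := by
    intro q hq
    have h := tentHeight_tentParam hij hq
    have h1 := one_le_tentRadius hij
    have hr : q.1 + (tentRadius i j - 1 / 2) ≠ 0 := by
      have := hq.1.1
      linarith
    refine Prod.ext ?_ ?_
    · simp only [tentCoord, h]
      ring
    · simp only [tentCoord, h]
      simp only [tentParam, add_sub_cancel_left]
      rw [mul_div_cancel_left₀ _ hr]
      ring
  param_coord := by
    intro p hp
    have hR := tentHeight_pos hij hp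
    have h1 := one_le_tentRadius hij
    have hK : tentRadius i j + 1 ≠ 0 := by linarith
    have e1 : (tentCoord i j p).1 + (tentRadius (i : ℕ) j - 1 / 2) = tentHeight i j p := by
      simp [tentCoord]
    have e2 : 2 * (tentCoord i j p).2 - 1 = (p.1 - tentCentre i j) / tentHeight i j p := by
      simp only [tentCoord]
      ring
    refine Prod.ext ?_ ?_
    · simp only [tentParam]
      rw [e1, e2, mul_div_cancel₀ _ hR.ne']
      ring
    · simp only [tentParam]
      rw [e1, e2, abs_div, abs_of_pos hR, mul_sub, mul_div_cancel₀ _ hR.ne', mul_one]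
      simp only [tentHeight, add_sub_cancel_left]
      rw [mul_div_cancel_left₀ _ hK]
      ring
  nhd_subset := by
    rintro p ⟨hy, h1, h2⟩ hp
    rcases le_or_gt 2 p.2 with h | h
    · rw [max_eq_left (by linarith)] at h1 h2
      exact ⟨h, h1.le, h2.le⟩
    · exfalso
      rw [max_eq_right (by linarith), mul_zero, add_zero] at h1 h2
      simp only [tentRadius, tentCentre] at h1 h2
      rcases abs_cases (p.1 - ((i : ℕ) + (j : ℕ) + 3 / 2 : ℝ)) with ⟨h3, -⟩ | ⟨h3, -⟩
      · rw [h3] at h1 h2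
        exact hp.2.2 j ⟨⟨by linarith, by linarith⟩, hy, h⟩
      · rw [h3] at h1 h2
        exact hp.2.2 i ⟨⟨by linarith, by linarith⟩, hy, h⟩
  side := by
    rintro p ⟨h1, h2, h3⟩ hn
    by_contra! hc
    simp only [tentCoord] at hc
    have h2' := lt_of_le_of_ne h2 fun h => hc.1 (by linarith)
    have h3' := lt_of_le_of_ne h3 fun h => hc.2 (by linarith)
    refine hn ⟨by linarith, ?_, ?_⟩ <;> rw [max_eq_left (by linarith)]
    · exact h2'
    · exact h3'
  mem_rim := by
    intro p hp
    obtain ⟨h0, h1⟩ := tentCoord_end hij hp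
    rw [h0, h1]
    have hx := tent_fst_mem hij hp
    have hi := fin_bounds i
    have hj := fin_bounds j
    have hy := tent_snd_lt_three hij hp
    constructor
    · rintro (h | h | h | h | ⟨k, -, -, h⟩)
      · linarith
      · linarith
      · linarith [hp.1]
      · linarith
      · have h2 : p.2 = 2 := le_antisymm h hp.1
        have h3 : tentHeight i j p = |p.1 - tentCentre i j| := by
          rw [tentHeight, h2, sub_self, mul_zero, add_zero]
        rw [h3]
        rcases abs_choice (p.1 - tentCentre i j) with h4 | h4 <;> rw [h4]
        · right; ring
        · left; ring
    · rintro (h | h)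
      · exact Or.inr (Or.inr (Or.inr (Or.inr ⟨i, tent_lo hij hp h⟩)))
      · exact Or.inr (Or.inr (Or.inr (Or.inr ⟨j, tent_hi hij hp h⟩)))
  mem_hole_lo := by
    intro p hp h k
    have h1 := tent_lo hij hp ((tentCoord_end hij hp).1.1 h)
    constructor
    · intro h2
      exact congrArg some (Fin.ext (hole_index h1.1.1 h1.1.2 h2.1.1 h2.1.2))
    · intro hk
      cases hk
      exact h1
  mem_hole_hi := by
    intro p hp h k
    have h1 := tent_hi hij hp ((tentCoord_end hij hp).2.1 h)
    constructor
    · intro h2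
      exact congrArg some (Fin.ext (hole_index h1.1.1 h1.1.2 h2.1.1 h2.1.2))
    · intro hk
      cases hk
      exact h1

end Strips

/-! ### Maps from the handlebody and its boundary to the circle -/

section CircleMaps

open Strip

variable {g : ℕ}

theorem ramp_one_sub (w : ℝ) : ramp (1 - w) = 1 - ramp w := by
  unfold ramp
  rcases max_cases 0 (min 1 (3 * w - 1)) with h1 | h1 <;>
    rcases max_cases 0 (min 1 (3 * (1 - w) - 1)) with h2 | h2 <;>
    rcases min_cases 1 (3 * w - 1) with h3 | h3 <;>
    rcases min_cases 1 (3 * (1 - w) - 1) with h4 | h4 <;> linarith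

/-- The map from the handlebody to the circle which is dual to the discs over a strip: the discs
sweep out the circle in the direction of the first coordinate of the strip. -/
def discMap (T : Strip g) : C(model g, UnitAddCircle) where
  toFun := collapse {p | (p : ℝ × ℝ × ℝ) ∈ T.slab} fun p => ramp (T.width p)
  continuous_toFun := by
    refine continuous_collapse (U := {p : model g | flat p ∈ T.nhd})
      (T.isClosed_slab.preimage continuous_subtype_val)
      (continuous_ramp.comp_continuousOn
        (T.continuousOn_width.comp continuous_subtype_val.continuousOn fun _ h => h))
      (T.isOpen_nhd.preimage (continuous_flat.comp continuous_subtype_val))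
      (fun p hp => T.nhd_subset _ hp (mem_model.1 p.2).1) fun p hp hn => ?_
    rcases width_eq_of_notMem_nhd hp hn with h | h <;> simp only [h]
    · exact Or.inl (ramp_of_le (by norm_num))
    · exact Or.inr (ramp_of_ge (by norm_num))

theorem discMap_of_mem {T : Strip g} {p : model g} (hp : (p : ℝ × ℝ × ℝ) ∈ T.slab) :
    discMap T p = (ramp (T.width p) : UnitAddCircle) :=
  collapse_of_mem (A := {p : model g | (p : ℝ × ℝ × ℝ) ∈ T.slab})
    (w := fun p => ramp (T.width p)) hp

theorem discMap_of_notMem {T : Strip g} {p : model g} (hp : (p : ℝ × ℝ × ℝ) ∉ T.slab) :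
    discMap T p = 0 :=
  collapse_of_notMem (A := {p : model g | (p : ℝ × ℝ × ℝ) ∈ T.slab})
    (w := fun p => ramp (T.width p)) hp

/-- The inclusion of the boundary surface in the handlebody. -/
def surfaceIncl (g : ℕ) : C(Surface g, model g) := ⟨Subtype.val, continuous_subtype_val⟩

/-- The map from the boundary surface to the circle which is given by the height on the wall of the
`k`-th hole. It is dual to the closed curve that runs around the wall. -/
def wallMap (k : Fin g) : C(Surface g, UnitAddCircle) where
  toFun := collapse {p | flat p.1 ∈ hole k} fun p => (p.1 : ℝ × ℝ × ℝ).2.2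
  continuous_toFun := by
    have hc : Continuous fun p : Surface g => (p.1 : ℝ × ℝ × ℝ) :=
      continuous_subtype_val.comp continuous_subtype_val
    refine continuous_collapse (U := {p : Surface g |
        flat p.1 ∈ Set.Ioo (2 * (k : ℝ) + 1 / 2) (2 * k + 5 / 2) ×ˢ Set.Ioo (1 / 2) (5 / 2) ∧
        (p.1 : ℝ × ℝ × ℝ).2.2 ∈ Set.Ioo (0 : ℝ) 1})
      ((isClosed_hole k).preimage (continuous_flat.comp hc)) (by fun_prop)
      (((isOpen_Ioo.prod isOpen_Ioo).preimage (continuous_flat.comp hc)).inter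
        (isOpen_Ioo.preimage (continuous_snd.comp (continuous_snd.comp hc)))) ?_ ?_
    · rintro p ⟨⟨⟨hx0, hx1⟩, hy0, hy1⟩, hz0, hz1⟩
      obtain ⟨hk0, hk1⟩ := fin_bounds k
      rcases (mem_frontier_model p.1.2).1 p.2 with (h | h | h | h | ⟨l, h⟩) | h | h
      · linarith
      · linarith
      · linarith
      · linarith
      · have hkl : (l : ℕ) = k := by
          obtain ⟨⟨h1, h2⟩, -⟩ := h
          have h3 : (2 * l + 1 : ℝ) < 2 * k + 3 := by linarith
          have h4 : (2 * k : ℝ) < 2 * l + 2 := by linarith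
          have h3' : 2 * (l : ℕ) + 1 < 2 * k + 3 := by exact_mod_cast h3
          have h4' : 2 * (k : ℕ) < 2 * l + 2 := by exact_mod_cast h4
          omega
        exact hkl ▸ h
      · linarith
      · linarith
    · intro p hp hU
      have hz := (mem_model.1 p.1.2).2
      by_contra! hc
      refine hU ⟨⟨⟨?_, ?_⟩, ?_, ?_⟩, lt_of_le_of_ne hz.1 hc.1.symm, lt_of_le_of_ne hz.2 hc.2⟩ <;>
        linarith [hp.1.1, hp.1.2, hp.2.1, hp.2.2]

theorem wallMap_of_mem {k : Fin g} {p : Surface g} (hp : flat p.1 ∈ hole k) :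
    wallMap k p = ((p.1 : ℝ × ℝ × ℝ).2.2 : UnitAddCircle) :=
  collapse_of_mem (A := {p : Surface g | flat p.1 ∈ hole k})
    (w := fun p => (p.1 : ℝ × ℝ × ℝ).2.2) hp

theorem wallMap_of_notMem {k : Fin g} {p : Surface g} (hp : flat p.1 ∉ hole k) :
    wallMap k p = 0 :=
  collapse_of_notMem (A := {p : Surface g | flat p.1 ∈ hole k})
    (w := fun p => (p.1 : ℝ × ℝ × ℝ).2.2) hp

theorem cross_mem_squareBdry {T : Strip g} {p : Surface g} (hp : (p.1 : ℝ × ℝ × ℝ) ∈ T.slab) :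
    T.cross p.1 ∈ squareBdry := (mem_frontier_iff hp p.1.2).1 p.2

/-- On the boundary of a disc over a strip, the height on the wall of a hole is given by the side
of the square which lies on that wall. -/
theorem wallMap_slab {T : Strip g} (k : Fin g) {p : Surface g}
    (hp : (p.1 : ℝ × ℝ × ℝ) ∈ T.slab) :
    wallMap k p = (if T.lo = some k then leftSide (squareAngle (T.cross p.1)) else 0) +
      if T.hi = some k then rightSide (squareAngle (T.cross p.1)) else 0 := by
  have hb := cross_mem_squareBdry hp
  have hloop := squareLoop_squareAngle hb
  by_cases h0 : (T.cross p.1).1 = 0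
  · have hr : rightSide (squareAngle (T.cross p.1)) = 0 :=
      rightSide_of_ne (by rw [hloop, h0]; exact zero_ne_one)
    have hl := leftSide_of_eq (by rw [hloop, h0] : (squareLoop (squareAngle (T.cross p.1))).1 = 0)
    rw [hloop] at hl
    have hh := T.mem_hole_lo _ hp h0 k
    rw [hr, hl, ite_self, add_zero]
    split_ifs with h
    · exact wallMap_of_mem (hh.2 h)
    · exact wallMap_of_notMem fun h' => h (hh.1 h')
  · have hl : leftSide (squareAngle (T.cross p.1)) = 0 :=
      leftSide_of_ne (by rw [hloop]; exact h0)
    by_cases h1 : (T.cross p.1).1 = 1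
    · have hr := rightSide_of_eq
        (by rw [hloop, h1] : (squareLoop (squareAngle (T.cross p.1))).1 = 1)
      rw [hloop] at hr
      have hh := T.mem_hole_hi _ hp h1 k
      rw [hr, hl, ite_self, zero_add]
      split_ifs with h
      · exact wallMap_of_mem (hh.2 h)
      · exact wallMap_of_notMem fun h' => h (hh.1 h')
    · have hr : rightSide (squareAngle (T.cross p.1)) = 0 :=
        rightSide_of_ne (by rw [hloop]; exact h1)
      rw [hl, hr, ite_self, ite_self, add_zero]
      refine wallMap_of_notMem fun h => ?_
      rcases (T.mem_rim _ hp).1 (Or.inr (Or.inr (Or.inr (Or.inr ⟨k, h⟩)))) with h' | h'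
      · exact h0 h'
      · exact h1 h'

/-- The degree of `wallMap k` on the boundary curve of a disc over the strip: the curve runs up the
wall at the end of the strip and down the wall at its beginning. -/
def endSign (T : Strip g) (k : Fin g) : ℤ :=
  (if T.hi = some k then 1 else 0) - if T.lo = some k then 1 else 0

theorem surfaceTwist_of_mem {T : Strip g} {p : Surface g} (hp : (p.1 : ℝ × ℝ × ℝ) ∈ T.slab) :
    ((T.surfaceTwist p).1 : ℝ × ℝ × ℝ) ∈ T.slab ∧
      squareAngle (T.cross (T.surfaceTwist p).1) =
        (ramp (T.width p.1) : UnitAddCircle) + squareAngle (T.cross p.1) := by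
  have hb := cross_mem_squareBdry hp
  have hm : twistFiber (T.width p.1) (T.cross p.1) ∈ square := twistFiber_mem _ _ hb.1
  rw [surfaceTwist_coe, fiberMap_of_mem hp, cross_place (width_mem hp) hm]
  exact ⟨place_mem_slab (width_mem hp) hm, squareAngle_squareRot _ hb⟩

/-- The effect of a twist on the dual map of a wall: up to a map with a lift to `ℝ`, a multiple of
the dual map of the discs is added. -/
theorem exists_wallMap_twist (T : Strip g) (k : Fin g) :
    ∃ G : C(Surface g, ℝ), ∀ p, wallMap k (T.surfaceTwist p) =
      wallMap k p + endSign T k • discMap T p.1 + (G p : UnitAddCircle) := by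
  classical
  obtain ⟨ηl, hl⟩ := exists_leftSide_lift
  obtain ⟨ηr, hr⟩ := exists_rightSide_lift
  let θ : Surface g → UnitAddCircle := fun p => squareAngle (T.cross p.1)
  let ρ : Surface g → UnitAddCircle := fun p => (ramp (T.width p.1) : UnitAddCircle)
  let η : UnitAddCircle → ℝ := fun θ =>
    (if T.lo = some k then ηl θ else 0) + if T.hi = some k then ηr θ else 0
  have cη : Continuous η := by
    refine Continuous.add ?_ ?_ <;> split_ifs <;> fun_prop
  have hA : IsClosed {p : Surface g | (p.1 : ℝ × ℝ × ℝ) ∈ T.slab} :=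
    T.isClosed_slab.preimage (continuous_subtype_val.comp continuous_subtype_val)
  have cp : ContinuousOn (fun p : Surface g => (p.1 : ℝ × ℝ × ℝ))
      {p : Surface g | (p.1 : ℝ × ℝ × ℝ) ∈ T.slab} :=
    (continuous_subtype_val.comp continuous_subtype_val).continuousOn
  have cθ : ContinuousOn θ {p : Surface g | (p.1 : ℝ × ℝ × ℝ) ∈ T.slab} :=
    continuousOn_squareAngle.comp (T.continuousOn_cross.comp cp fun _ h => h)
      fun p hp => cross_mem_squareBdry hp
  have cρ : ContinuousOn ρ {p : Surface g | (p.1 : ℝ × ℝ × ℝ) ∈ T.slab} :=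
    continuous_coe_ramp.comp_continuousOn (T.continuousOn_width.comp cp fun _ h => h)
  -- On the strip, `wallMap k` is a multiple of the angle `θ` plus `η θ`, and the twist adds `ρ` to
  -- the angle.
  let G : Surface g → ℝ := fun p =>
    if (p.1 : ℝ × ℝ × ℝ) ∈ T.slab then η (ρ p + θ p) - η (θ p) else 0
  have cG : Continuous G := by
    refine continuous_if (p := fun p : Surface g => (p.1 : ℝ × ℝ × ℝ) ∈ T.slab)
      (fun p hp => ?_) ?_ (by fun_prop)
    · obtain ⟨h1, h2⟩ := frontier_subset_of_open hA
        (U := {p : Surface g | flat p.1 ∈ T.nhd})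
        (T.isOpen_nhd.preimage (continuous_flat.comp
          (continuous_subtype_val.comp continuous_subtype_val)))
        (fun p hp => T.nhd_subset _ hp (mem_model.1 p.1.2).1) hp
      have : ρ p = 0 := coe_ramp_of_end (width_eq_of_notMem_nhd h1 h2)
      rw [this, zero_add, sub_self]
    · change ContinuousOn _ (closure {p : Surface g | (p.1 : ℝ × ℝ × ℝ) ∈ T.slab})
      rw [hA.closure_eq]
      exact (cη.comp_continuousOn (cρ.add cθ)).sub (cη.comp_continuousOn cθ)
  refine ⟨⟨G, cG⟩, fun p => ?_⟩
  by_cases hp : (p.1 : ℝ × ℝ × ℝ) ∈ T.slab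
  · obtain ⟨h1, h2⟩ := surfaceTwist_of_mem hp
    have hG : G p = η (ρ p + θ p) - η (θ p) := if_pos hp
    rw [wallMap_slab k h1, wallMap_slab k hp, h2, discMap_of_mem hp]
    change (if T.lo = some k then leftSide (ρ p + θ p) else 0) +
      (if T.hi = some k then rightSide (ρ p + θ p) else 0) =
      (if T.lo = some k then leftSide (θ p) else 0) +
      (if T.hi = some k then rightSide (θ p) else 0) + endSign T k • ρ p +
      (G p : UnitAddCircle)
    rw [hG]
    simp only [η, endSign, hl, hr]
    split_ifs <;> simp <;> abel
  · have hG : G p = 0 := if_neg hp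
    have h1 : T.surfaceTwist p = p := T.surfaceTwist_eq_self fun h => absurd h hp
    rw [h1, discMap_of_notMem hp]
    change _ = _ + _ + (G p : UnitAddCircle)
    rw [hG]
    simp

/-- The dual map of the discs over the straight strip at the `i`-th hole. -/
theorem discMap_boxStrip (i : Fin g) {p : model g} : discMap (boxStrip i) p =
    if (p : ℝ × ℝ × ℝ).2.1 ≤ 1 then
      (ramp ((p : ℝ × ℝ × ℝ).1 - (2 * i + 1)) : UnitAddCircle) else 0 := by
  by_cases hp : (p : ℝ × ℝ × ℝ) ∈ (boxStrip i).slab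
  · have hy : (p : ℝ × ℝ × ℝ).2.1 ≤ 1 := hp.2.2
    rw [discMap_of_mem hp, if_pos hy]
    rfl
  · rw [discMap_of_notMem hp]
    split_ifs with hy
    · refine (coe_eq_zero_of_eq_zero_or_one ?_).symm
      by_contra! hc
      refine hp ⟨⟨?_, ?_⟩, p.2.2.1.1, hy⟩
      · by_contra! hx
        exact hc.1 (ramp_of_le (by simp only [flat] at hx; linarith))
      · by_contra! hx
        exact hc.2 (ramp_of_ge (by simp only [flat] at hx; linarith))
    · rfl

/-- The discs over a tent-shaped strip are homologous to the difference of two meridian discs. -/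
theorem exists_discMap_tentStrip (i j : Fin g) (hij : (i : ℕ) < j) :
    ∃ G : C(model g, ℝ), ∀ p, discMap (tentStrip i j hij) p =
      discMap (boxStrip i) p - discMap (boxStrip j) p + (G p : UnitAddCircle) := by
  let R : model g → ℝ := fun p => |(p : ℝ × ℝ × ℝ).1 - tentCentre i j| +
    (tentRadius i j + 1) * max ((p : ℝ × ℝ × ℝ).2.1 - 2) 0
  have hd := one_le_tentRadius hij
  have cR : Continuous R := by
    have : Continuous fun p : model g => (p : ℝ × ℝ × ℝ) := continuous_subtype_val
    simp only [R]
    fun_prop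
  refine ⟨⟨fun p => ramp (R p - (tentRadius i j - 1 / 2)) - 1,
    (continuous_ramp.comp (cR.sub continuous_const)).sub continuous_const⟩, fun p => ?_⟩
  change _ = _ - _ + ((ramp (R p - (tentRadius i j - 1 / 2)) - 1 : ℝ) : UnitAddCircle)
  rw [discMap_boxStrip, discMap_boxStrip, AddCircle.coe_sub, AddCircle.coe_period,
    sub_zero]
  rcases le_or_gt (2 : ℝ) (p : ℝ × ℝ × ℝ).2.1 with hy | hy
  · -- Above the holes.
    have hR : R p = tentHeight i j (flat p) := by
      simp only [R]
      rw [max_eq_left (by linarith)]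
      rfl
    rw [if_neg (by linarith), if_neg (by linarith), sub_zero, zero_add, hR]
    by_cases hp : (p : ℝ × ℝ × ℝ) ∈ (tentStrip i j hij).slab
    · rw [discMap_of_mem hp]
      rfl
    · rw [discMap_of_notMem hp]
      refine (coe_eq_zero_of_eq_zero_or_one ?_).symm
      by_contra! hc
      refine hp ⟨hy, ?_, ?_⟩
      · by_contra! hx
        exact hc.1 (ramp_of_le (by linarith))
      · by_contra! hx
        exact hc.2 (ramp_of_ge (by linarith))
  · have hp : (p : ℝ × ℝ × ℝ) ∉ (tentStrip i j hij).slab := fun h => absurd h.1 hy.not_ge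
    have hR : R p = |(p : ℝ × ℝ × ℝ).1 - tentCentre i j| := by
      simp only [R]
      rw [max_eq_right (by linarith), mul_zero, add_zero]
    rw [discMap_of_notMem hp, hR]
    rcases le_or_gt (p : ℝ × ℝ × ℝ).2.1 1 with hy1 | hy1
    · -- Below the holes the two sides are given by the same real function, up to the constant 1.
      rw [if_pos hy1, if_pos hy1, ← AddCircle.coe_sub, ← AddCircle.coe_add]
      refine (coe_eq_zero_of_eq_zero_or_one (Or.inr ?_)).symm
      simp only [tentCentre, tentRadius] at *
      rcases le_total (p : ℝ × ℝ × ℝ).1 ((i : ℕ) + (j : ℕ) + 3 / 2) with hx | hx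
      · rw [abs_of_nonpos (by linarith), ramp_of_le (w := _ - (2 * ((j : ℕ) : ℝ) + 1))
          (by linarith), sub_zero, show -((p : ℝ × ℝ × ℝ).1 - ((i : ℕ) + (j : ℕ) + 3 / 2)) -
            (((j : ℕ) : ℝ) - (i : ℕ) - 1 / 2) =
              1 - ((p : ℝ × ℝ × ℝ).1 - (2 * ((i : ℕ) : ℝ) + 1)) by ring, ramp_one_sub]
        ring
      · rw [abs_of_nonneg (by linarith), ramp_of_ge (w := _ - (2 * ((i : ℕ) : ℝ) + 1))
          (by linarith), sub_add, sub_eq_self, sub_eq_zero]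
        congr 1
        ring
    · -- Between the holes the width is outside of `(0, 1)`.
      rw [if_neg (by linarith), if_neg (by linarith), sub_zero, zero_add]
      refine (coe_eq_zero_of_eq_zero_or_one ?_).symm
      by_contra! hc
      simp only [tentCentre, tentRadius] at *
      have h1 : (((j : ℕ) : ℝ) - (i : ℕ)) - 1 / 2 <
          |(p : ℝ × ℝ × ℝ).1 - ((i : ℕ) + (j : ℕ) + 3 / 2)| := by
        by_contra! hx
        exact hc.1 (ramp_of_le (by linarith))
      have h2 : |(p : ℝ × ℝ × ℝ).1 - ((i : ℕ) + (j : ℕ) + 3 / 2)| <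
          (((j : ℕ) : ℝ) - (i : ℕ)) + 1 / 2 := by
        by_contra! hx
        exact hc.2 (ramp_of_ge (by linarith))
      rcases abs_cases ((p : ℝ × ℝ × ℝ).1 - ((i : ℕ) + (j : ℕ) + 3 / 2 : ℝ)) with h3 | h3
      · rw [h3.1] at h1 h2
        exact p.2.2.2.2 j ⟨⟨by linarith, by linarith⟩, hy1, hy⟩
      · rw [h3.1] at h1 h2
        exact p.2.2.2.2 i ⟨⟨by linarith, by linarith⟩, hy1, hy⟩

end CircleMaps

/-! ### Maps homotopic to the identity -/

section FundamentalGroup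

open CategoryTheory

/-- The trace of a base point under a homotopy from the identity to `F` is a path along which `F`
acts as the change of base point. -/
theorem actsTriviallyOnPi1_of_homotopic {V : Type} [TopologicalSpace V] (F : V ≃ₜ V)
    (H : (F : C(V, V)).Homotopic (ContinuousMap.id V)) : ActsTriviallyOnPi1 F := by
  obtain ⟨H⟩ := H.symm
  intro x
  refine ⟨H.evalAt x, fun γ => ?_⟩
  have hnat := (FundamentalGroupoidFunctor.homotopicMapsNatIso H).naturality
    (X := FundamentalGroupoid.mk x) (Y := FundamentalGroupoid.mk x) γ
  have hid : (FundamentalGroupoid.map (ContinuousMap.id V)).map γ = γ := by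
    obtain ⟨p, rfl⟩ := Path.Homotopic.Quotient.mk_surjective γ
    rfl
  let α := (Groupoid.isoEquivHom (FundamentalGroupoid.mk x) (FundamentalGroupoid.mk (F x))).symm
    ⟦H.evalAt x⟧
  change (FundamentalGroupoid.map (F : C(V, V))).map γ = α.inv ≫ γ ≫ α.hom
  refine (Iso.eq_inv_comp α).2 ?_
  rw [hid] at hnat
  exact hnat.symm

end FundamentalGroup

/-! ### Realizing symmetric matrices by products of twists -/

section Realizable

open Strip

variable {g : ℕ}

/-- The integral matrix `N` is realizable if there is a homeomorphism of the standard handlebody,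
homotopic to the identity and orientation-preserving on the boundary, which adds to the degree of
a closed curve over the `k`-th wall the combination of its degrees over the meridian discs with the
coefficients in the `k`-th row of `N`. -/
def Realizable (N : Matrix (Fin g) (Fin g) ℤ) : Prop :=
  ∃ (F : model g ≃ₜ model g) (f : Surface g ≃ₜ Surface g),
    (∀ p, F p.1 = (f p).1) ∧ f ∈ homeoPlus (Surface g) ∧
    (F : C(model g, model g)).Homotopic (ContinuousMap.id _) ∧
    ∀ (γ : C(UnitAddCircle, Surface g)) (k : Fin g),
      deg ((wallMap k).comp ((f : C(Surface g, Surface g)).comp γ)) =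
        deg ((wallMap k).comp γ) +
          ∑ l, (N k l : ℝ) * deg ((discMap (boxStrip l)).comp ((surfaceIncl g).comp γ))

/-- A homeomorphism of the handlebody that is homotopic to the identity does not change the degree
of a closed curve over a disc. -/
theorem deg_discMap_comp {F : model g ≃ₜ model g} {f : Surface g ≃ₜ Surface g}
    (hF : ∀ p, F p.1 = (f p).1) (H : (F : C(model g, model g)).Homotopic (ContinuousMap.id _))
    (T : Strip g) (γ : C(UnitAddCircle, Surface g)) :
    deg ((discMap T).comp ((surfaceIncl g).comp ((f : C(Surface g, Surface g)).comp γ))) =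
      deg ((discMap T).comp ((surfaceIncl g).comp γ)) := by
  have h1 : (surfaceIncl g).comp ((f : C(Surface g, Surface g)).comp γ) =
      (F : C(model g, model g)).comp ((surfaceIncl g).comp γ) := by
    ext t : 1
    exact (hF (γ t)).symm
  rw [h1]
  refine deg_homotopic ?_
  exact (ContinuousMap.Homotopic.refl (discMap T)).comp
    (H.comp (ContinuousMap.Homotopic.refl ((surfaceIncl g).comp γ)))

theorem realizable_zero : Realizable (0 : Matrix (Fin g) (Fin g) ℤ) :=
  ⟨Homeomorph.refl _, Homeomorph.refl _, fun _ => rfl, one_mem _, ContinuousMap.Homotopic.refl _,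
    fun γ k => by
      simp⟩

theorem Realizable.add {N N' : Matrix (Fin g) (Fin g) ℤ} (h : Realizable N)
    (h' : Realizable N') : Realizable (N + N') := by
  obtain ⟨F, f, hF, hf, H, hd⟩ := h
  obtain ⟨F', f', hF', hf', H', hd'⟩ := h'
  refine ⟨F'.trans F, f'.trans f, fun p => ?_, mul_mem hf hf', H.comp H', fun γ k => ?_⟩
  · rw [Homeomorph.trans_apply, hF', hF, Homeomorph.trans_apply]
  · have h1 : ((f'.trans f : Surface g ≃ₜ Surface g) : C(Surface g, Surface g)).comp γ =
        (f : C(Surface g, Surface g)).comp ((f' : C(Surface g, Surface g)).comp γ) := rfl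
    rw [h1, hd, hd', add_assoc, ← Finset.sum_add_distrib]
    congr 1
    refine Finset.sum_congr rfl fun l _ => ?_
    rw [deg_discMap_comp hF' H', Matrix.add_apply]
    push_cast
    ring

theorem Realizable.neg {N : Matrix (Fin g) (Fin g) ℤ} (h : Realizable N) : Realizable (-N) := by
  obtain ⟨F, f, hF, hf, H, hd⟩ := h
  have hF' : ∀ p, F.symm p.1 = (f.symm p).1 := fun p => by
    rw [F.symm_apply_eq, hF, f.apply_symm_apply]
  have H' : (F.symm : C(model g, model g)).Homotopic (ContinuousMap.id _) := by
    have h1 := (H.comp (ContinuousMap.Homotopic.refl (F.symm : C(model g, model g)))).symm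
    have h2 : (F : C(model g, model g)).comp (F.symm : C(model g, model g)) =
        ContinuousMap.id _ := by
      ext p : 1
      exact F.apply_symm_apply p
    rwa [h2] at h1
  refine ⟨F.symm, f.symm, hF', inv_mem hf, H', fun γ k => ?_⟩
  have h1 := hd ((f.symm : C(Surface g, Surface g)).comp γ) k
  have h2 : (f : C(Surface g, Surface g)).comp ((f.symm : C(Surface g, Surface g)).comp γ) = γ := by
    ext t : 1
    exact f.apply_symm_apply _
  rw [h2] at h1
  simp only [deg_discMap_comp hF' H'] at h1
  rw [h1, add_assoc, ← Finset.sum_add_distrib, Finset.sum_eq_zero fun l _ => ?_, add_zero]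
  rw [Matrix.neg_apply]
  push_cast
  ring

/-- The realizable matrices form a group. -/
def realizable (g : ℕ) : AddSubgroup (Matrix (Fin g) (Fin g) ℤ) where
  carrier := {N | Realizable N}
  zero_mem' := realizable_zero
  add_mem' := Realizable.add
  neg_mem' := Realizable.neg

theorem deg_zsmul (n : ℤ) (ψ : C(UnitAddCircle, UnitAddCircle)) : deg (n • ψ) = n * deg ψ := by
  let φ : C(UnitAddCircle, UnitAddCircle) →+ ℝ := ⟨⟨deg, deg_zero⟩, deg_add⟩
  exact (map_zsmul φ n ψ).trans (zsmul_eq_mul _ _)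

/-- A twist realizes a matrix of rank one. -/
theorem realizable_twist (T : Strip g) (u : Fin g → ℤ)
    (hu : ∀ γ : C(UnitAddCircle, Surface g),
      deg ((discMap T).comp ((surfaceIncl g).comp γ)) =
        ∑ l, (u l : ℝ) * deg ((discMap (boxStrip l)).comp ((surfaceIncl g).comp γ))) :
    Matrix.of (fun k l => endSign T k * u l) ∈ realizable g := by
  refine ⟨T.twist, T.surfaceTwist, fun _ => rfl, T.surfaceTwist_mem_homeoPlus, T.twist_homotopic,
    fun γ k => ?_⟩
  obtain ⟨G, hG⟩ := exists_wallMap_twist T k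
  let ψ : C(UnitAddCircle, UnitAddCircle) := ⟨fun t => (G (γ t) : UnitAddCircle),
    (AddCircle.continuous_mk' 1).comp (G.continuous.comp γ.continuous)⟩
  have h1 : (wallMap k).comp ((T.surfaceTwist : C(Surface g, Surface g)).comp γ) =
      (wallMap k).comp γ +
        endSign T k • (discMap T).comp ((surfaceIncl g).comp γ) + ψ := by
    ext t : 1
    exact hG (γ t)
  rw [h1, deg_add, deg_add, deg_zsmul, deg_eq_zero_of_real ψ (G.comp γ) fun _ => rfl, add_zero, hu,
    Finset.mul_sum]
  congr 1
  refine Finset.sum_congr rfl fun l _ => ?_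
  rw [Matrix.of_apply]
  push_cast
  ring

/-- The twist along the straight strip at the `i`-th hole realizes `E_ii`. -/
theorem single_mem_realizable (i : Fin g) : Matrix.single i i 1 ∈ realizable g := by
  convert realizable_twist (boxStrip i) (Pi.single i 1) fun γ => ?_ using 1
  · ext k l
    rw [Matrix.of_apply, Matrix.single_apply, endSign, Pi.single_apply]
    change _ = ((if some i = some k then 1 else 0) - if none = some k then 1 else 0) * _
    by_cases h1 : i = k <;> by_cases h2 : i = l <;> simp [h1, h2, eq_comm]
  · simp [Pi.single_apply]

/-- The twist along the strip between the holes `i` and `j` realizes `-(eᵢ - eⱼ)(eᵢ - eⱼ)ᵗ`. -/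
theorem tent_mem_realizable (i j : Fin g) (hij : (i : ℕ) < j) :
    Matrix.of (fun k l => (((if j = k then 1 else 0) - if i = k then 1 else 0) *
      ((if i = l then 1 else 0) - if j = l then 1 else 0) : ℤ)) ∈ realizable g := by
  convert realizable_twist (tentStrip i j hij)
    (fun l => (if i = l then 1 else 0) - if j = l then 1 else 0) fun γ => ?_ using 1
  · ext k l
    rw [Matrix.of_apply, Matrix.of_apply, endSign]
    change _ = ((if some j = some k then 1 else 0) - if some i = some k then 1 else 0) * _
    simp
  · obtain ⟨G, hG⟩ := exists_discMap_tentStrip i j hij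
    let ψ : C(UnitAddCircle, UnitAddCircle) := ⟨fun t => (G (γ t).1 : UnitAddCircle),
      (AddCircle.continuous_mk' 1).comp (G.continuous.comp
        (continuous_subtype_val.comp γ.continuous))⟩
    have h1 : (discMap (tentStrip i j hij)).comp ((surfaceIncl g).comp γ) =
        (discMap (boxStrip i)).comp ((surfaceIncl g).comp γ) -
          (discMap (boxStrip j)).comp ((surfaceIncl g).comp γ) + ψ := by
      ext t : 1
      exact hG (γ t).1
    rw [h1, deg_add, deg_sub, deg_eq_zero_of_real ψ (G.comp ((surfaceIncl g).comp γ)) fun _ => rfl]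
    simp [sub_mul, Finset.sum_sub_distrib]

theorem single_add_single_mem_realizable (i j : Fin g) (hij : (i : ℕ) < j) :
    Matrix.single i j 1 + Matrix.single j i 1 ∈ realizable g := by
  -- `E_ij + E_ji = E_ii + E_jj - (eᵢ - eⱼ)(eᵢ - eⱼ)ᵗ`
  convert add_mem (add_mem (single_mem_realizable i) (single_mem_realizable j))
    (tent_mem_realizable i j hij) using 1
  ext k l
  have hne : i ≠ j := fun h => hij.ne (congrArg Fin.val h)
  simp only [Matrix.add_apply, Matrix.single_apply, Matrix.of_apply]
  by_cases h1 : i = k <;> by_cases h2 : j = k <;> by_cases h3 : i = l <;> by_cases h4 : j = l <;>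
    simp_all

/-- The matrices `E_ii` and `E_ij + E_ji` generate the group of symmetric integral matrices. -/
theorem realizable_of_isSymm {B : Matrix (Fin g) (Fin g) ℤ} (hB : B.IsSymm) : Realizable B := by
  have h1 : B = ∑ i, ∑ j, if i = j then B i i • Matrix.single i i 1 else
      if i < j then B i j • (Matrix.single i j 1 + Matrix.single j i 1) else 0 := by
    ext k l
    have h2 : ∀ i j, (if i = j then B i i • Matrix.single i i 1 else
        if i < j then B i j • (Matrix.single i j 1 + Matrix.single j i 1) else 0 :
          Matrix (Fin g) (Fin g) ℤ) k l =
        (if i = k then if j = l then if k ≤ l then B k l else 0 else 0 else 0) +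
          if i = l then if j = k then if l < k then B k l else 0 else 0 else 0 := by
      intro i j
      have h3 := hB.apply k l
      split_ifs <;> simp_all <;> grind
    simp only [Matrix.sum_apply, h2, Finset.sum_add_distrib, Finset.sum_ite_irrel,
      Finset.sum_const_zero, Finset.sum_ite_eq', Finset.mem_univ, if_true]
    have h3 := hB.apply k l
    split_ifs <;> grind
  change B ∈ realizable g
  rw [h1]
  refine sum_mem fun i _ => sum_mem fun j _ => ?_
  split_ifs with h2 h3
  · exact zsmul_mem (single_mem_realizable i) _
  · exact zsmul_mem (single_add_single_mem_realizable i j h3) _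
  · exact zero_mem _

end Realizable

/-! ### Coordinates on the homology of the boundary -/

section Coordinates

open Strip

variable {g : ℕ} {V : Type} [TopologicalSpace V] (h : model g ≃ₜ V)

/-- The identification of the boundary of a handlebody with the standard surface. -/
def toSurface : Boundary h ≃ₜ Surface g := h.symm.subtype fun _ => Iff.rfl

/-- The cohomology class of the boundary that is dual to the `k`-th meridian. -/
def discClass (k : Fin g) : H1 (Boundary h) →ₗ[ℚ] ℝ :=
  cocycle ((discMap (boxStrip k)).comp ((surfaceIncl g).comp
    (toSurface h : C(Boundary h, Surface g))))

/-- The cohomology class of the boundary that is dual to a closed curve around the wall of the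
`k`-th hole. -/
def wallClass (k : Fin g) : H1 (Boundary h) →ₗ[ℚ] ℝ :=
  cocycle ((wallMap k).comp (toSurface h : C(Boundary h, Surface g)))

theorem discClass_loopClass (k : Fin g) (γ : C(UnitAddCircle, Boundary h)) :
    discClass h k (loopClass γ) = deg ((discMap (boxStrip k)).comp ((surfaceIncl g).comp
      ((toSurface h : C(Boundary h, Surface g)).comp γ))) := cocycle_loopClass _ _

theorem wallClass_loopClass (k : Fin g) (γ : C(UnitAddCircle, Boundary h)) :
    wallClass h k (loopClass γ) =
      deg ((wallMap k).comp ((toSurface h : C(Boundary h, Surface g)).comp γ)) :=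
  cocycle_loopClass _ _

theorem toSurface_meridianAnnulus (i : Fin g) (q : UnitAddCircle × Set.Icc (-1 : ℝ) 1) :
    ((toSurface h (meridianAnnulus h i q)).1 : ℝ × ℝ × ℝ) = collarPoint i q :=
  congrArg Subtype.val (h.symm_apply_apply ⟨collarPoint i q, collarPoint_mem i q⟩)

theorem discMap_meridianAnnulus (k i : Fin g) (q : UnitAddCircle × Set.Icc (-1 : ℝ) 1) :
    discMap (boxStrip k) (toSurface h (meridianAnnulus h i q)).1 =
      (ramp (2 * (i : ℝ) + 3 / 2 + q.2 / 2 - (2 * k + 1)) : UnitAddCircle) := by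
  rw [discMap_boxStrip, toSurface_meridianAnnulus]
  exact if_pos (squareLoop_mem q.1).1.1.2

theorem discClass_meridian (k i : Fin g) : discClass h k (loopClass (meridian h i)) = 0 := by
  rw [discClass_loopClass]
  exact deg_eq_zero_of_real _ (ContinuousMap.const _
    (ramp (2 * (i : ℝ) + 3 / 2 + 0 / 2 - (2 * k + 1))))
    fun θ => (discMap_meridianAnnulus h k i (θ, ⟨0, by norm_num⟩)).symm

theorem wallClass_meridian (k i : Fin g) :
    wallClass h k (loopClass (meridian h i)) = if i = k then 1 else 0 := by
  rw [wallClass_loopClass]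
  have h1 : ∀ θ, wallMap k (toSurface h (meridian h i θ)) =
      if i = k then rightSide θ else 0 := by
    intro θ
    have h2 := toSurface_meridianAnnulus h i (θ, ⟨0, by norm_num⟩)
    have h3 : ((toSurface h (meridian h i θ)).1 : ℝ × ℝ × ℝ) = collarPoint i _ := h2
    have h4 : ((toSurface h (meridian h i θ)).1 : ℝ × ℝ × ℝ) ∈ (boxStrip i).slab := by
      rw [h3]
      refine ⟨⟨?_, ?_⟩, (squareLoop_mem θ).1.1⟩ <;> simp only [flat, collarPoint] <;> linarith
    have h5 : (boxStrip i).cross (toSurface h (meridian h i θ)).1 = squareLoop θ := by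
      rw [h3]
      rfl
    rw [wallMap_slab k h4, h5, squareAngle_squareLoop]
    change (if none = some k then _ else 0) + (if some i = some k then _ else 0) = _
    simp
  split_ifs at h1 ⊢ with hik
  · refine Eq.trans (congrArg deg ?_) deg_rightSide
    ext θ : 1
    exact h1 θ
  · exact deg_eq_zero_of_real _ 0 fun θ => (h1 θ).symm

/-- A point of the boundary is mapped to `1 / 2` by the dual map of a meridian disc if and only
if it lies on the meridian. -/
theorem discMap_eq_half_iff (i : Fin g) (s : Boundary h) :
    discMap (boxStrip i) (toSurface h s).1 = ((1 / 2 : ℝ) : UnitAddCircle) ↔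
      s ∈ Set.range (meridian h i) := by
  constructor
  · intro hs
    rw [discMap_boxStrip] at hs
    split_ifs at hs with hy
    swap
    · exact absurd hs zero_ne_coe_half
    have h1 := eq_half_of_coe_eq (ramp_mem _).1 (ramp_mem _).2 hs
    have hx : ((toSurface h s).1 : ℝ × ℝ × ℝ).1 = 2 * (i : ℝ) + 3 / 2 := by
      unfold ramp at h1
      rcases max_cases 0 (min 1 (3 * (((toSurface h s).1 : ℝ × ℝ × ℝ).1 - (2 * (i : ℝ) + 1)) - 1))
        with h2 | h2 <;>
      rcases min_cases 1 (3 * (((toSurface h s).1 : ℝ × ℝ × ℝ).1 - (2 * (i : ℝ) + 1)) - 1)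
        with h3 | h3 <;> linarith
    have hslab : ((toSurface h s).1 : ℝ × ℝ × ℝ) ∈ (boxStrip i).slab := by
      refine ⟨⟨?_, ?_⟩, (toSurface h s).1.2.2.1.1, hy⟩ <;> simp only [flat] <;> linarith
    obtain ⟨θ, hθ⟩ := exists_squareLoop_eq (cross_mem_squareBdry hslab)
    refine ⟨θ, (toSurface h).injective (Subtype.ext (Subtype.ext ?_))⟩
    refine (toSurface_meridianAnnulus h i _).trans (Prod.ext ?_ hθ)
    rw [hx]
    simp [collarPoint]
  · rintro ⟨θ, rfl⟩
    refine (discMap_meridianAnnulus h i i _).trans ?_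
    congr 1
    norm_num [ramp]

/-- The value of the class dual to a meridian on a closed curve is the algebraic intersection number
of the meridian with the curve. -/
theorem discClass_of_hasIntersectionNumber {i : Fin g} {β : C(UnitAddCircle, Boundary h)} {n : ℤ}
    (hβ : HasIntersectionNumber (meridianAnnulus h i) β n) :
    discClass h i (loopClass β) = n := by
  obtain ⟨P, N, hPN, hP, hN, rfl⟩ := hβ
  have hneg : ∀ s ∈ negSide (meridianAnnulus h i), discMap (boxStrip i) (toSurface h s).1 ∈
      ((↑) : ℝ → UnitAddCircle) '' Set.Ico 0 (1 / 2) := by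
    rintro _ ⟨⟨θ, u⟩, hu : (u : ℝ) < 0, rfl⟩
    refine ⟨_, ⟨(ramp_mem _).1, ?_⟩, (discMap_meridianAnnulus h i i _).symm⟩
    refine max_lt (by norm_num) ((min_le_right _ _).trans_lt ?_)
    simp only
    linarith
  have hpos : ∀ s ∈ posSide (meridianAnnulus h i), discMap (boxStrip i) (toSurface h s).1 ∈
      ((↑) : ℝ → UnitAddCircle) '' Set.Ioc (1 / 2) 1 := by
    rintro _ ⟨⟨θ, u⟩, hu : 0 < (u : ℝ), rfl⟩
    refine ⟨_, ⟨?_, (ramp_mem _).2⟩, (discMap_meridianAnnulus h i i _).symm⟩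
    refine lt_max_of_lt_right (lt_min (by norm_num) ?_)
    simp only
    linarith
  rw [discClass_loopClass, deg_eq_card_sub_card _ P N]
  · push_cast
    rfl
  · intro t
    rw [hPN]
    exact and_congr_right fun _ => (discMap_eq_half_iff h i _).symm
  · exact fun t ht => ⟨(hP t ht).1.mono fun s hs => hneg _ hs,
      (hP t ht).2.mono fun s hs => hpos _ hs⟩
  · exact fun t ht => ⟨(hN t ht).1.mono fun s hs => hpos _ hs,
      (hN t ht).2.mono fun s hs => hneg _ hs⟩

variable {h}

/-- The classes dual to the meridians and to the walls separate the points of the homology of the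
boundary. -/
theorem eq_of_discClass_eq_of_wallClass_eq
    (e : Module.Basis (Fin g ⊕ Fin g) ℚ (H1 (Boundary h)))
    (ha : ∀ i k, discClass h k (e (Sum.inl i)) = 0)
    (ha' : ∀ i k, wallClass h k (e (Sum.inl i)) = if i = k then 1 else 0)
    (hb : ∀ j k, discClass h k (e (Sum.inr j)) = if k = j then 1 else 0)
    {x y : H1 (Boundary h)} (hd : ∀ k, discClass h k x = discClass h k y)
    (hw : ∀ k, wallClass h k x = wallClass h k y) : x = y := by
  have hsum : ∀ (φ : H1 (Boundary h) →ₗ[ℚ] ℝ) z,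
      φ z = ∑ i, (e.repr z i : ℝ) * φ (e i) := by
    intro φ z
    conv_lhs => rw [← e.sum_repr z, map_sum]
    exact Finset.sum_congr rfl fun i _ => (map_smul φ _ _).trans (Rat.smul_def _ _)
  have hdisc : ∀ z k, discClass h k z = (e.repr z (Sum.inr k) : ℝ) := by
    intro z k
    rw [hsum, Fintype.sum_sum_type]
    simp [ha, hb]
  have hwall : ∀ z k, wallClass h k z = (e.repr z (Sum.inl k) : ℝ) +
      ∑ j, (e.repr z (Sum.inr j) : ℝ) * wallClass h k (e (Sum.inr j)) := by
    intro z k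
    rw [hsum, Fintype.sum_sum_type]
    simp [ha']
  have h1 : ∀ k, e.repr x (Sum.inr k) = e.repr y (Sum.inr k) := fun k => by
    have := hd k
    rw [hdisc, hdisc] at this
    exact_mod_cast this
  refine e.repr.injective (Finsupp.ext fun k => ?_)
  rcases k with k | k
  · have := hw k
    rw [hwall, hwall y, Finset.sum_congr rfl fun j _ => by rw [h1 j]] at this
    exact_mod_cast add_right_cancel this
  · exact h1 k

end Coordinates

/-! ### Symplectic block matrices -/

theorem isSymm_of_fromBlocks_mem_symplecticGroup {g : ℕ} {B : Matrix (Fin g) (Fin g) ℤ}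
    (hB : Matrix.fromBlocks 1 B 0 1 ∈ Matrix.symplecticGroup (Fin g) ℤ) : B.IsSymm := by
  simpa [Matrix.IsSymm] using SymplecticGroup.fromBlocks_mem_iff.1 hB

/-! ### Transport to the given handlebody -/

section Transport

variable {g : ℕ} {V : Type} [TopologicalSpace V] (h : model g ≃ₜ V)

/-- The homeomorphism of the handlebody `V` given by one of the standard handlebody. -/
def transport (F : model g ≃ₜ model g) : V ≃ₜ V := (h.symm.trans F).trans h

/-- The homeomorphism of the boundary of `V` given by one of the standard surface. -/
def transportSurface (f : Surface g ≃ₜ Surface g) : Boundary h ≃ₜ Boundary h :=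
  ((toSurface h).trans f).trans (toSurface h).symm

theorem extends_transport {F : model g ≃ₜ model g} {f : Surface g ≃ₜ Surface g}
    (hF : ∀ p, F p.1 = (f p).1) : Extends h (transport h F) (transportSurface h f) :=
  fun s => congrArg h (hF (toSurface h s))

theorem transportSurface_mem_homeoPlus {f : Surface g ≃ₜ Surface g}
    (hf : f ∈ homeoPlus (Surface g)) : transportSurface h f ∈ homeoPlus (Boundary h) :=
  conj_mem_homeoPlus (toSurface h).symm hf

theorem transport_homotopic {F : model g ≃ₜ model g}
    (H : (F : C(model g, model g)).Homotopic (ContinuousMap.id _)) :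
    (transport h F : C(V, V)).Homotopic (ContinuousMap.id V) := by
  have h1 := (ContinuousMap.Homotopic.refl (h : C(model g, V))).comp
    (H.comp (ContinuousMap.Homotopic.refl (h.symm : C(V, model g))))
  have h2 : (h : C(model g, V)).comp ((ContinuousMap.id _).comp (h.symm : C(V, model g))) =
      ContinuousMap.id V := by
    ext v : 1
    exact h.apply_symm_apply v
  rwa [h2] at h1

theorem toSurface_transportSurface (f : Surface g ≃ₜ Surface g) (γ : C(UnitAddCircle, Boundary h)) :
    (toSurface h : C(Boundary h, Surface g)).comp
      ((transportSurface h f : C(Boundary h, Boundary h)).comp γ) =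
    (f : C(Surface g, Surface g)).comp ((toSurface h : C(Boundary h, Surface g)).comp γ) := by
  ext t : 1
  exact (toSurface h).apply_symm_apply _

/-- A homeomorphism that is homotopic to the identity in the handlebody preserves intersection
numbers with meridians. -/
theorem discClass_transportSurface {F : model g ≃ₜ model g} {f : Surface g ≃ₜ Surface g}
    (hF : ∀ p, F p.1 = (f p).1) (H : (F : C(model g, model g)).Homotopic (ContinuousMap.id _))
    (k : Fin g) (γ : C(UnitAddCircle, Boundary h)) :
    discClass h k (H1map (transportSurface h f : C(Boundary h, Boundary h)) (loopClass γ)) =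
      discClass h k (loopClass γ) := by
  rw [H1map_loopClass, discClass_loopClass, discClass_loopClass, toSurface_transportSurface,
    deg_discMap_comp hF H]

end Transport

end Handlebody

end

theorem mainTheorem4 (g : ℕ) (V : Type) [TopologicalSpace V] (h : Handlebody.model g ≃ₜ V)
    (β : Fin g → C(UnitAddCircle, Handlebody.Boundary h))
    (hβ : ∀ i j : Fin g, Handlebody.HasIntersectionNumber (Handlebody.meridianAnnulus h i) (β j)
      (if i = j then 1 else 0))
    (e : Module.Basis (Fin g ⊕ Fin g) ℚ (Handlebody.H1 (Handlebody.Boundary h)))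
    (ha : ∀ i : Fin g, e (Sum.inl i) = Handlebody.loopClass (Handlebody.meridian h i))
    (hb : ∀ j : Fin g, e (Sum.inr j) = Handlebody.loopClass (β j))
    (B : Matrix (Fin g) (Fin g) ℤ)
    (hB : Matrix.fromBlocks 1 B 0 1 ∈ Matrix.symplecticGroup (Fin g) ℤ) :
    ∃ φ : Handlebody.Mcg (Handlebody.Boundary h),
      φ ∈ Handlebody.handlebodyGroup h ∧
      LinearMap.toMatrix e e (Handlebody.homologyAction (Handlebody.Boundary h) φ) =
        (Matrix.fromBlocks 1 B 0 1).map (fun k : ℤ => (k : ℚ)) ∧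
      Handlebody.ClassActsTriviallyOnPi1 h φ := by
  open Handlebody in
  obtain ⟨F, f, hF, hf, H, hd⟩ :=
    realizable_of_isSymm (isSymm_of_fromBlocks_mem_symplecticGroup hB)
  let fV : homeoPlus (Boundary h) :=
    ⟨transportSurface h f, transportSurface_mem_homeoPlus h hf⟩
  have hext := extends_transport h hF
  refine ⟨QuotientGroup.mk' (isotopicToId (Boundary h)) fV, ⟨fV, ⟨transport h F, hext⟩, rfl⟩, ?_,
    fV, transport h F, rfl, hext,
    actsTriviallyOnPi1_of_homotopic _ (transport_homotopic h H)⟩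
  -- The values of the dual classes on the basis.
  have da : ∀ i k, discClass h k (e (Sum.inl i)) = 0 := fun i k => by
    rw [ha, discClass_meridian]
  have wa : ∀ i k, wallClass h k (e (Sum.inl i)) = if i = k then 1 else 0 := fun i k => by
    rw [ha, wallClass_meridian]
  have db : ∀ j k, discClass h k (e (Sum.inr j)) = if k = j then 1 else 0 := fun j k => by
    rw [hb, discClass_of_hasIntersectionNumber h (hβ k j)]
    push_cast
    rfl
  -- The effect of the homeomorphism on the dual classes.
  let φ : Module.End ℚ (H1 (Boundary h)) :=
    H1map (transportSurface h f : C(Boundary h, Boundary h))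
  have dφ : ∀ γ k, discClass h k (φ (loopClass γ)) = discClass h k (loopClass γ) :=
    fun γ k => discClass_transportSurface h hF H k γ
  have wφ : ∀ γ k, wallClass h k (φ (loopClass γ)) =
      wallClass h k (loopClass γ) + ∑ l, (B k l : ℝ) * discClass h l (loopClass γ) := by
    intro γ k
    simp only [φ, H1map_loopClass, wallClass_loopClass, discClass_loopClass,
      toSurface_transportSurface]
    exact hd _ k
  have hφa : ∀ i, φ (e (Sum.inl i)) = e (Sum.inl i) := by
    intro i
    refine eq_of_discClass_eq_of_wallClass_eq e da wa db (fun k => ?_) fun k => ?_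
    · rw [ha]
      exact dφ _ k
    · rw [ha, wφ, ← ha]
      simp [da]
  have hφb : ∀ j, φ (e (Sum.inr j)) = ∑ i, (B i j : ℚ) • e (Sum.inl i) + e (Sum.inr j) := by
    intro j
    refine eq_of_discClass_eq_of_wallClass_eq e da wa db (fun k => ?_) fun k => ?_
    · rw [map_add, map_sum, hb, dφ, Finset.sum_eq_zero, zero_add]
      intro i _
      rw [map_smul, da, smul_zero]
    · have h1 : ∀ i, wallClass h k ((B i j : ℚ) • e (Sum.inl i)) =
          if i = k then (B k j : ℝ) else 0 := by
        intro i
        rw [map_smul, wa, Rat.smul_def]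
        split_ifs with hik
        · simp [hik]
        · simp
      rw [map_add, map_sum, hb, wφ, ← hb, add_comm]
      simp [db, h1]
  change LinearMap.toMatrix e e φ = _
  ext x y
  rw [LinearMap.toMatrix_apply]
  rcases y with j | j
  · rw [hφa, Module.Basis.repr_self]
    rcases x with i | i <;> simp [Finsupp.single_apply, Matrix.one_apply, eq_comm]
  · rw [hφb]
    rcases x with i | i <;> simp [Finsupp.single_apply, Matrix.one_apply, eq_comm]
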